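/- A \emph{unary pushdown automaton} over $\{a\}$ is a finite structure $\mathcal A=(Q,\Gamma,\bot,q_0,F,\delta)$ with states $Q$, stack alphabet $\Gamma\ni\bot$, initial state $q_0\in Q$, final states $F\subseteq Q$ and transitions $\delta\subseteq (Q\times\{a,\varepsilon\}\times\Gamma)\times(Q\times\Gamma^*)$, where every $(q_1,\sigma,\gamma,q_2,s)\in\delta$ satisfies either $\gamma\ne\bot$ and $s\in(\Gamma\setminus\{\bot\})^*$, or $\gamma=\bot$ and $s\in\{\varepsilon\}\cup(\Gamma\setminus\{\bot\})^*\bot$. Configurations are the elements of $Q\times(\Gamma\setminus\{\bot\})^*\bot$. Such a transition allows the move $(q_1,\gamma s')\vdash_\sigma(q_2,ss')$, except that for $\gamma=\bot$, $s=\varepsilon$ the move is $(q_1,\bot)\vdash_\sigma(q_2,\bot)$. The language $L(\mathcal A)$ is the set of words read along finite sequences of moves from $(q_0,\bot)$ to a configuration with a final state. $\mathcal A$ is deterministic (a \emph{udpda}) if at every configuration at most one move is available. Its \emph{size} is $|Q|\cdot|\Gamma|$, provided that $|s|\le 2$ for all transitions. A \emph{straight-line program} (SLP) over $\{0,1\}$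 is a context-free grammar with finitely many nonterminals, exactly one production for each nonterminal, and no cycles in the relation ``$D$ occurs in the right-hand side of $N$''; it generates exactly one word $\mathrm{str}(\mathcal P)$. It is in Chomsky normal form if every production has the form $N\to b$ with $b\in\{0,1\}$ or $N\to AB$ with nonterminals $A,B$. SLPs are taken in Chomsky normal form, and the \emph{size} of an SLP is then its number of nonterminals. The \emph{characteristic sequence} of $L\subseteq\{a\}^*$ is $c_0c_1c_2\ldots\in\{0,1\}^\omega$ with $c_i=1$ if and only if $a^i\in L$. An \emph{indicator pair} for $L$ is a pair of SLPs $(\mathcal P',\mathcal P'')$ such that $\mathrm{str}(\mathcal P')\cdot\mathrm{str}(\mathcal P'')^\omega$ is the characteristic sequence of $L$; its size is the sum of the sizes of $\mathcal P'$ and $\mathcal P''$. \textbf{Theorem (translation theorem).} For a unary language $L\subseteq\{a\}^*$: (1) if there exists a udpda $\mathcal A$ of size $m$ with $L(\mathcal A)=L$, then there exists an indicator pair for $L$ of size $O(m)$; (2) if there exists an indicator pair for $L$ of size $m$, then there exists a udpda $\mathcal A$ of size $O(m)$ with $L(\mathcal A)=L$. The constants in $O(m)$ are absolute. Both statements are supported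 by polynomial-time algorithms: one computes such an indicator pair from any udpda, the other computes such a udpda from any indicator pair, and the second works, moreover, in logarithmic space. -/

import Mathlib

/-! ## Unary pushdown automata -/

/-- A unary pushdown automaton over the alphabet `{a}` with control states `Q` and stack alphabet
`Γ`.  The letter `a` is `() : Unit`, and a transition label is `some ()` for `a`, `none` for the
empty word.  The top of a stack is the head of the list. -/
structure UPDA (Q Γ : Type*) where
  /-- the bottom-of-the-stack symbol -/
  bot : Γ
  /-- the initial state -/
  start : Q
  /-- the final states -/
  final : Set Q
  /-- the transitions `(q₁, σ, γ, q₂, s)` -/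
  trans : Set (Q × Option Unit × Γ × Q × List Γ)
  /-- `⊥` is never removed, and never pushed above another symbol -/
  trans_bot : ∀ q₁ σ γ q₂ s, (q₁, σ, γ, q₂, s) ∈ trans →
    (γ ≠ bot ∧ bot ∉ s) ∨ (γ = bot ∧ (s = [] ∨ ∃ u, bot ∉ u ∧ s = u ++ [bot]))

namespace UPDA

variable {Q Γ : Type*}

/-- Configurations are the elements of `Q × (Γ \ {⊥})* ⊥`. -/
def IsConfig (A : UPDA Q Γ) (c : Q × List Γ) : Prop :=
  ∃ u, A.bot ∉ u ∧ c.2 = u ++ [A.bot]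

/-- `A.Move c₁ σ c₂`: a move from `c₁` to `c₂` reading `σ` is available to `A` at `c₁`. -/
def Move (A : UPDA Q Γ) (c₁ : Q × List Γ) (σ : Option Unit) (c₂ : Q × List Γ) : Prop :=
  A.IsConfig c₁ ∧ A.IsConfig c₂ ∧ ∃ γ s, (c₁.1, σ, γ, c₂.1, s) ∈ A.trans ∧
    (((γ ≠ A.bot ∨ s ≠ []) ∧ ∃ s', c₁.2 = γ :: s' ∧ c₂.2 = s ++ s') ∨
      (γ = A.bot ∧ s = [] ∧ c₁.2 = [A.bot] ∧ c₂.2 = [A.bot]))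

/-- At every configuration at most one move is available. -/
def Deterministic (A : UPDA Q Γ) : Prop :=
  ∀ c σ₁ c₁ σ₂ c₂, A.Move c σ₁ c₁ → A.Move c σ₂ c₂ → σ₁ = σ₂ ∧ c₁ = c₂

/-- `A.Reaches c w c'`: a finite sequence of moves leads from `c` to `c'` and reads `w`. -/
inductive Reaches (A : UPDA Q Γ) : Q × List Γ → List Unit → Q × List Γ → Prop
  | refl (c : Q × List Γ) : Reaches A c [] c
  | head {c c' c'' : Q × List Γ} {σ : Option Unit} {w : List Unit} :
      A.Move c σ c' → Reaches A c' w c'' → Reaches A c (σ.toList ++ w) c''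

/-- The language of `A`: acceptance is by final state, from the configuration `(q₀, ⊥)`. -/
def lang (A : UPDA Q Γ) : Language Unit :=
  {w | ∃ q s, q ∈ A.final ∧ A.Reaches (A.start, [A.bot]) w (q, s)}

/-- Every transition writes at most two stack symbols. -/
def IsShort (A : UPDA Q Γ) : Prop :=
  ∀ q₁ σ γ q₂ s, (q₁, σ, γ, q₂, s) ∈ A.trans → s.length ≤ 2

/-- The size `|Q| · |Γ|` is defined for automata whose transitions write at most two symbols. -/
def HasSize (A : UPDA Q Γ) (m : ℕ) : Prop :=
  A.IsShort ∧ Nat.card Q * Nat.card Γ = m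

/-- The six numbers that describe a transition `(q₁, σ, γ, q₂, s)` with `|s| ≤ 2`: the last two
are the symbols of `s` shifted by one, with `0` for an absent symbol. -/
def transCode {n k : ℕ} (eQ : Q ≃ Fin n) (eΓ : Γ ≃ Fin k) :
    Q × Option Unit × Γ × Q × List Γ → List ℕ
  | (q₁, σ, γ, q₂, s) =>
    [(eQ q₁ : ℕ), σ.toList.length, (eΓ γ : ℕ), (eQ q₂ : ℕ),
      s[0]?.elim 0 (fun g => (eΓ g : ℕ) + 1), s[1]?.elim 0 (fun g => (eΓ g : ℕ) + 1)]

open Classical in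
/-- The list `x` of numbers is a description of `A`.  After some numbering of states and of stack
symbols, it consists of the number of states, the number of stack symbols, the initial state, one
bit per state (is it final?), one bit per stack symbol (is it `⊥`?), and the transitions, in any
order. -/
def IsCode (A : UPDA Q Γ) (x : List ℕ) : Prop :=
  A.IsShort ∧ ∃ (n k : ℕ) (eQ : Q ≃ Fin n) (eΓ : Γ ≃ Fin k)
    (l : List (Q × Option Unit × Γ × Q × List Γ)), (∀ t, t ∈ l ↔ t ∈ A.trans) ∧
    x = [n, k, (eQ A.start : ℕ)] ++
      List.ofFn (fun i : Fin n => if eQ.symm i ∈ A.final then 1 else 0) ++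
      List.ofFn (fun j : Fin k => if eΓ.symm j = A.bot then 1 else 0) ++
      l.flatMap (transCode eQ eΓ)

end UPDA

/-! ## Straight-line programs -/

/-- A straight-line program with terminals `α` and nonterminals `Δ`. -/
structure SLP (α Δ : Type*) where
  /-- the start nonterminal -/
  start : Δ
  /-- the right-hand sides of the productions -/
  prod : Δ → List (α ⊕ Δ)
  /-- the relation "`D` occurs in the right-hand side of `N`" has no cycles -/
  acyclic : ∀ N, ¬ Relation.TransGen (fun D N => Sum.inr D ∈ prod N) N N

namespace SLP

variable {α Δ : Type*}

theorem wf [Finite Δ] (P : SLP α Δ) :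
    WellFounded (Relation.TransGen (fun D N => Sum.inr D ∈ P.prod N)) :=
  haveI : Std.Irrefl (Relation.TransGen (fun D N => Sum.inr D ∈ P.prod N)) := ⟨P.acyclic⟩
  Finite.wellFounded_of_trans_of_irrefl _

/-- The word generated from the nonterminal `N`, by applying the productions as substitutions. -/
noncomputable def val [Finite Δ] (P : SLP α Δ) : Δ → List α :=
  P.wf.fix fun N rec => (P.prod N).attach.flatMap fun z =>
    match z with
    | ⟨Sum.inl a, _⟩ => [a]
    | ⟨Sum.inr D, h⟩ => rec D (Relation.TransGen.single h)

theorem val_eq [Finite Δ] (P : SLP α Δ) (N : Δ) :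
    P.val N = (P.prod N).flatMap (Sum.elim (fun a => [a]) P.val) := by
  have h1 : P.val N = (P.prod N).attach.flatMap
      fun z => Sum.elim (fun a => [a]) P.val z.1 := by
    unfold val
    rw [WellFounded.fix_eq]
    congr 1
    funext z
    rcases z with ⟨a | D, h⟩ <;> rfl
  rw [h1]
  conv_rhs => rw [← List.attach_map_subtype_val (P.prod N), List.flatMap_map]

/-- The word generated by the program. -/
noncomputable def str [Finite Δ] (P : SLP α Δ) : List α := P.val P.start

/-- Chomsky normal form. -/
def IsCNF (P : SLP α Δ) : Prop :=
  ∀ N, (∃ a, P.prod N = [Sum.inl a]) ∨ (∃ A B, P.prod N = [Sum.inr A, Sum.inr B])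

/-- The size of a program in Chomsky normal form is its number of nonterminals. -/
def HasSize (P : SLP α Δ) (m : ℕ) : Prop :=
  P.IsCNF ∧ Nat.card Δ = m

/-- The list `x` of numbers is a description of the program `P`, which is in Chomsky normal form,
over the alphabet `{0, 1}`.  After some numbering of the nonterminals, it consists of the number of
nonterminals, the start nonterminal, and two numbers for each nonterminal `N` in turn: `0, b` if
the production is `N → b`, and `A + 1, B + 1` if it is `N → A B`. -/
def IsCode (P : SLP Bool Δ) (x : List ℕ) : Prop :=
  P.IsCNF ∧ ∃ (n : ℕ) (e : Δ ≃ Fin n) (r : Fin n → ℕ × ℕ),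
    (∀ N b, P.prod N = [Sum.inl b] → r (e N) = (0, b.toNat)) ∧
    (∀ N A B, P.prod N = [Sum.inr A, Sum.inr B] → r (e N) = ((e A : ℕ) + 1, (e B : ℕ) + 1)) ∧
    x = [n, (e P.start : ℕ)] ++ (List.ofFn r).flatMap (fun z => [z.1, z.2])

end SLP

/-! ## Indicator pairs -/

/-- The infinite sequence `c` is `u · v ^ ω`.  This never holds for an empty `v`. -/
def IsLasso {α : Type*} (u v : List α) (c : ℕ → α) : Prop :=
  ∀ i, (i < u.length → u[i]? = some (c i)) ∧
    (u.length ≤ i → v[(i - u.length) % v.length]? = some (c i))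

open Classical in
/-- The characteristic sequence of a unary language (`true` is `1`, `false` is `0`). -/
noncomputable def charSeq (L : Language Unit) (i : ℕ) : Bool :=
  decide (List.replicate i () ∈ L)

/-- `(P₁, P₂)` is an indicator pair for `L`. -/
def IsIndicatorPair {Δ₁ Δ₂ : Type*} [Finite Δ₁] [Finite Δ₂] (P₁ : SLP Bool Δ₁) (P₂ : SLP Bool Δ₂)
    (L : Language Unit) : Prop :=
  IsLasso P₁.str P₂.str (charSeq L)

/-- The size of a pair is the sum of the sizes. -/
def PairHasSize {Δ₁ Δ₂ : Type*} (P₁ : SLP Bool Δ₁) (P₂ : SLP Bool Δ₂) (m : ℕ) : Prop :=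
  ∃ m₁ m₂, P₁.HasSize m₁ ∧ P₂.HasSize m₂ ∧ m₁ + m₂ = m

/-- A description of a pair is a description of the first program followed by one of the second. -/
def IsPairCode {Δ₁ Δ₂ : Type*} (P₁ : SLP Bool Δ₁) (P₂ : SLP Bool Δ₂) (x : List ℕ) : Prop :=
  ∃ x₁ x₂, P₁.IsCode x₁ ∧ P₂.IsCode x₂ ∧ x = x₁ ++ x₂

/-! ## Random access machines

The input is a finite sequence of natural numbers in read-only input cells, the output is a finite
sequence of natural numbers on a write-only output tape.  There are directly addressed registers
and an indirectly addressed memory.  Each instruction and each test counts as one step; as the only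
arithmetical operations are addition and (truncated) subtraction, this is polynomially equivalent to
the time of Turing machines.  Space is the total number of bits of the contents and of the
addresses of the registers and memory cells in use; input and output are not counted. -/

namespace RAM

/-- Basic instructions. -/
inductive Instr
  /-- `R[i] := v` -/
  | const (i v : ℕ)
  /-- `R[i] := R[j] + R[k]` -/
  | add (i j k : ℕ)
  /-- `R[i] := R[j] - R[k]`, or `0` if `R[j] < R[k]` -/
  | sub (i j k : ℕ)
  /-- `R[i] := M[R[j]]` -/
  | load (i j : ℕ)
  /-- `M[R[i]] := R[j]` -/
  | store (i j : ℕ)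
  /-- `R[i] :=` the number in input cell `R[j]`, or `0` if there is no such cell -/
  | read (i j : ℕ)
  /-- `R[i] :=` the number of input cells -/
  | len (i : ℕ)
  /-- append `R[i]` to the output -/
  | write (i : ℕ)

/-- Programs. -/
inductive Prog
  | skip
  | instr (i : Instr)
  | seq (p q : Prog)
  /-- if `R[i] ≠ 0` then `p` else `q` -/
  | ite (i : ℕ) (p q : Prog)
  /-- while `R[i] ≠ 0` do `p` -/
  | loop (i : ℕ) (p : Prog)

/-- States of the machine. -/
structure State where
  reg : ℕ →₀ ℕ
  mem : ℕ →₀ ℕ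
  out : List ℕ

/-- Number of bits of the addresses and contents of the nonzero cells. -/
def bits (f : ℕ →₀ ℕ) : ℕ := f.sum fun a v => a.size + v.size

/-- The space in use. -/
def State.space (s : State) : ℕ := bits s.reg + bits s.mem

/-- The initial state: all registers and memory cells are `0`, nothing has been written. -/
def State.initial : State := ⟨0, 0, []⟩

/-- The effect of an instruction on input `x`. -/
noncomputable def Instr.apply (x : List ℕ) (s : State) : Instr → State
  | const i v => { s with reg := s.reg.update i v }
  | add i j k => { s with reg := s.reg.update i (s.reg j + s.reg k) }
  | sub i j k => { s with reg := s.reg.update i (s.reg j - s.reg k) }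
  | load i j => { s with reg := s.reg.update i (s.mem (s.reg j)) }
  | store i j => { s with mem := s.mem.update (s.reg i) (s.reg j) }
  | read i j => { s with reg := s.reg.update i (x.getD (s.reg j) 0) }
  | len i => { s with reg := s.reg.update i x.length }
  | write i => { s with out := s.out ++ [s.reg i] }

/-- `Exec x W p s t s'`: on input `x`, the program `p`, started in the state `s`, halts after
exactly `t` steps in the state `s'`, and no state entered on the way uses more than `W` bits. -/
inductive Exec (x : List ℕ) (W : ℕ) : Prog → State → ℕ → State → Prop
  | skip (s : State) : Exec x W Prog.skip s 0 s
  | instr (i : Instr) (s : State) : (i.apply x s).space ≤ W →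
      Exec x W (Prog.instr i) s 1 (i.apply x s)
  | seq {p q : Prog} {s s' s'' : State} {t t' : ℕ} : Exec x W p s t s' → Exec x W q s' t' s'' →
      Exec x W (Prog.seq p q) s (t + t') s''
  | ite_true {i : ℕ} {p q : Prog} {s s' : State} {t : ℕ} : s.reg i ≠ 0 → Exec x W p s t s' →
      Exec x W (Prog.ite i p q) s (t + 1) s'
  | ite_false {i : ℕ} {p q : Prog} {s s' : State} {t : ℕ} : s.reg i = 0 → Exec x W q s t s' →
      Exec x W (Prog.ite i p q) s (t + 1) s'
  | loop_done {i : ℕ} {p : Prog} {s : State} : s.reg i = 0 → Exec x W (Prog.loop i p) s 1 s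
  | loop_step {i : ℕ} {p : Prog} {s s' s'' : State} {t t' : ℕ} : s.reg i ≠ 0 → Exec x W p s t s' →
      Exec x W (Prog.loop i p) s' t' s'' → Exec x W (Prog.loop i p) s (t + t' + 1) s''

/-- The length of an input: the number of bits of its numbers, plus one for each number. -/
def inputLength (x : List ℕ) : ℕ := (x.map fun v => v.size + 1).sum

/-- On input `x` the program halts with output `y`, within `T` steps and within `W` bits. -/
def OutputsWithin (p : Prog) (x y : List ℕ) (T W : ℕ) : Prop :=
  ∃ t ≤ T, ∃ s, Exec x W p State.initial t s ∧ s.out = y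

end RAM

/-! ## A structured language on top of the random access machine -/

namespace RAM

/-! From pairs to automata. The nonterminals of the two programs become stack symbols. A nonterminal
with production `N → A B` on top of the stack is replaced by `A B`; one with a terminal is removed
while the letter is read, and if the terminal is 1, a detour through the only final state precedes
the reading. The bottom symbol stays: on the first visit the start symbol of the first program is
put on it, on every later visit that of the second. Three control states suffice, so the size is `3
* (m + 1)`. After `i` letters the stack, followed by repetitions of the period, spells the
characteristic sequence from position `i` on (`RunInv`). Programs in Chomsky normal form generate
nonempty words, so only finitely many silent moves separate two letters and every word `a ^ i` is
read (`exists_reaches`). The description of this automaton is a local rewriting of the description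
of the pair; every number occurring on the way is bounded by the number of input cells, which gives
logarithmic space.

From automata to pairs. A deterministic automaton over one letter has a single run. Double the
states by a promise bit that records whether a final state was visited since the last letter. When a
letter is read, the run outputs the promise; the output is the characteristic sequence. Where no
transition applies, the promise is output and a dead state outputs zeros forever (`Tables`,
`Models`, `Models.charSeq_iff`). A node is a state with a top symbol. If the run from a node
eventually removes that symbol, then the state it arrives in and the word it outputs do not depend
on the stack below; call the node resolved. Resolution propagates: `i` is resolved as soon as the
first symbol that it pushes is, and then the second one in the state so reached (`Pops.step`). This
is a least fixed point over `(2 * n + 1) * (k + 1)` nodes; each resolution costs at most two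
productions (`resolve_spec`), and after as many rounds as there are nodes nothing changes any more
(`resolveAll_spec`).

From an unresolved node the run never goes below the present stack height. Skipping resolved
excursions gives a successor function on unresolved nodes (`nextNode`, `Resolved.next`), and the
pigeonhole principle makes the walk from the initial node, which carries the bottom symbol and is
therefore unresolved, eventually periodic. The words `u` and `v` output before and along the cycle
yield the pair `(u v, v)`. If `v` is empty, the run loops silently; then one last bit is the
promise, and zeros follow (`Valid.isLasso`). The walk again costs boundedly many productions per
node, so both programs have size linear in `m`.

Both algorithms are written in a small language whose only loop repeats a body once per input cell,
so that a polynomial time bound can be read off the program text (`Cmd.comp_spec`). A syntactic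
condition, no additions and no stores, confines the machine to boundedly many registers with bounded
contents (`Exec.space_le`). The size statements are read off from the algorithmic ones, since every
automaton and every pair in question has a description. -/

theorem Exec.mono {x : List ℕ} {W W' : ℕ} (hW : W ≤ W') {p : Prog} {s s' : State} {t : ℕ}
    (h : Exec x W p s t s') : Exec x W' p s t s' := by
  induction h with
  | skip s => exact .skip s
  | instr i s h => exact .instr i s (h.trans hW)
  | seq _ _ h₁ h₂ => exact .seq h₁ h₂
  | ite_true h _ h₁ => exact .ite_true h h₁
  | ite_false h _ h₁ => exact .ite_false h h₁
  | loop_done h => exact .loop_done h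
  | loop_step h _ _ h₁ h₂ => exact .loop_step h h₁ h₂

/-- Execution within some amount of space. -/
def Halts (x : List ℕ) (p : Prog) (s : State) (t : ℕ) (s' : State) : Prop :=
  ∃ W, Exec x W p s t s'

namespace Halts

variable {x : List ℕ} {p q : Prog} {s s' s'' : State} {t t' i : ℕ}

theorem instr (i : Instr) (s : State) : Halts x (.instr i) s 1 (i.apply x s) :=
  ⟨_, .instr i s le_rfl⟩

theorem seq (h : Halts x p s t s') (h' : Halts x q s' t' s'') :
    Halts x (.seq p q) s (t + t') s'' := by
  obtain ⟨W, h⟩ := h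
  obtain ⟨W', h'⟩ := h'
  exact ⟨max W W', .seq (h.mono (le_max_left _ _)) (h'.mono (le_max_right _ _))⟩

theorem ite_true (hi : s.reg i ≠ 0) (h : Halts x p s t s') :
    Halts x (.ite i p q) s (t + 1) s' :=
  h.imp fun _ h => .ite_true hi h

theorem ite_false (hi : s.reg i = 0) (h : Halts x q s t s') :
    Halts x (.ite i p q) s (t + 1) s' :=
  h.imp fun _ h => .ite_false hi h

theorem loop_step (hi : s.reg i ≠ 0) (h : Halts x p s t s')
    (h' : Halts x (.loop i p) s' t' s'') : Halts x (.loop i p) s (t + t' + 1) s'' := by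
  obtain ⟨W, h⟩ := h
  obtain ⟨W', h'⟩ := h'
  exact ⟨max W W', .loop_step hi (h.mono (le_max_left _ _)) (h'.mono (le_max_right _ _))⟩

end Halts

/-- A sequence of basic instructions. -/
def block : List Instr → Prog
  | [] => .skip
  | i :: l => .seq (.instr i) (block l)

theorem Halts.block {x : List ℕ} (l : List Instr) (s : State) :
    Halts x (block l) s l.length (l.foldl (fun s i => i.apply x s) s) := by
  induction l generalizing s with
  | nil => exact ⟨0, .skip s⟩
  | cons i l ih =>
    rw [List.length_cons, add_comm]
    exact (Halts.instr i s).seq (ih _)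

/-- The names of the arrays. -/
inductive Arr
  | emit | base | push₁ | push₂ | exit | word | left | right | mul

/-- The position of an array among the arrays. -/
def Arr.ix : Arr → ℕ
  | emit => 0 | base => 1 | push₁ => 2 | push₂ => 3 | exit => 4 | word => 5 | left => 6
  | right => 7 | mul => 8

theorem Arr.ix_lt (a : Arr) : a.ix < 16 := by cases a <;> decide

theorem Arr.ix_inj {a b : Arr} (h : a.ix = b.ix) : a = b := by
  cases a <;> cases b <;> first | rfl | simp [Arr.ix] at h

/-- Expressions over variables from `V`. -/
inductive Exp (V : Type)
  | const (c : ℕ)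
  | var (i : V)
  | arr (a : Arr) (e : Exp V)
  | inp (e : Exp V)
  | len
  | add (e f : Exp V)
  | sub (e f : Exp V)

/-- Commands over variables from `V`; `rep p` executes `p` as many times as there are input
cells. -/
inductive Cmd (V : Type)
  | skip
  | assign (i : V) (e : Exp V)
  | store (a : Arr) (e f : Exp V)
  | write (e : Exp V)
  | seq (p q : Cmd V)
  | ite (e : Exp V) (p q : Cmd V)
  | rep (p : Cmd V)

/-- Values of variables and arrays, and the output. -/
structure Store (V : Type) where
  v : V → ℕ
  m : Arr → ℕ → ℕ
  o : List ℕ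

variable {V : Type}

/-- The value of an expression. -/
def Exp.eval (x : List ℕ) (σ : Store V) : Exp V → ℕ
  | const c => c
  | var i => σ.v i
  | arr a e => σ.m a (e.eval x σ)
  | inp e => x.getD (e.eval x σ) 0
  | len => x.length
  | add e f => e.eval x σ + f.eval x σ
  | sub e f => e.eval x σ - f.eval x σ

open Classical in
/-- The effect of a command. -/
noncomputable def Cmd.run (x : List ℕ) : Cmd V → Store V → Store V
  | skip, σ => σ
  | assign i e, σ => { σ with v := Function.update σ.v i (e.eval x σ) }
  | store a e f, σ =>
    { σ with m := Function.update σ.m a (Function.update (σ.m a) (e.eval x σ) (f.eval x σ)) }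
  | write e, σ => { σ with o := σ.o ++ [e.eval x σ] }
  | seq p q, σ => q.run x (p.run x σ)
  | ite e p q, σ => if e.eval x σ ≠ 0 then p.run x σ else q.run x σ
  | rep p, σ => (p.run x)^[x.length] σ

/-- The register of a variable. -/
def varReg (ix : V → ℕ) (i : V) : ℕ := 3 * ix i + 1

/-- The registers for intermediate results. -/
def tmpReg (d : ℕ) : ℕ := 3 * d + 2

/-- The registers for loop counters. -/
def cntReg (d : ℕ) : ℕ := 3 * d + 3

/-- Replace the index in a temporary register by an address. -/
def address (a : Arr) (d : ℕ) : List Instr :=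
  [.add (tmpReg d) (tmpReg d) (tmpReg d), .add (tmpReg d) (tmpReg d) (tmpReg d),
    .add (tmpReg d) (tmpReg d) (tmpReg d), .add (tmpReg d) (tmpReg d) (tmpReg d),
    .const (tmpReg (d + 1)) a.ix, .add (tmpReg d) (tmpReg d) (tmpReg (d + 1))]

/-- Code that evaluates an expression. -/
def Exp.comp (ix : V → ℕ) (d : ℕ) : Exp V → Prog
  | const c => block [.const (tmpReg d) c]
  | var i => block [.sub (tmpReg d) (varReg ix i) 0]
  | arr a e => .seq (e.comp ix d) (block (address a d ++ [.load (tmpReg d) (tmpReg d)]))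
  | inp e => .seq (e.comp ix d) (block [.read (tmpReg d) (tmpReg d)])
  | len => block [.len (tmpReg d)]
  | add e f => .seq (.seq (e.comp ix d) (f.comp ix (d + 1)))
      (block [.add (tmpReg d) (tmpReg d) (tmpReg (d + 1))])
  | sub e f => .seq (.seq (e.comp ix d) (f.comp ix (d + 1)))
      (block [.sub (tmpReg d) (tmpReg d) (tmpReg (d + 1))])

/-- The time for the evaluation of an expression. -/
def Exp.cost : Exp V → ℕ
  | const _ => 1
  | var _ => 1
  | arr _ e => e.cost + 7
  | inp e => e.cost + 1
  | len => 1
  | add e f => e.cost + f.cost + 1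
  | sub e f => e.cost + f.cost + 1

/-- Code for a command. -/
def Cmd.comp (ix : V → ℕ) (d : ℕ) : Cmd V → Prog
  | skip => .skip
  | assign i e => .seq (e.comp ix 0) (block [.sub (varReg ix i) (tmpReg 0) 0])
  | store a e f => .seq (.seq (e.comp ix 0) (block (address a 0)))
      (.seq (f.comp ix 1) (block [.store (tmpReg 0) (tmpReg 1)]))
  | write e => .seq (e.comp ix 0) (block [.write (tmpReg 0)])
  | seq p q => .seq (p.comp ix d) (q.comp ix d)
  | ite e p q => .seq (e.comp ix 0) (.ite (tmpReg 0) (p.comp ix d) (q.comp ix d))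
  | rep p => .seq (block [.len (cntReg d)]) (.loop (cntReg d) (.seq (p.comp ix (d + 1))
      (block [.const (tmpReg 0) 1, .sub (cntReg d) (cntReg d) (tmpReg 0)])))

/-- A bound on the time of a command, in terms of the number of input cells. -/
noncomputable def Cmd.cost : Cmd V → Polynomial ℕ
  | skip => 0
  | assign _ e => (e.cost + 1 : ℕ)
  | store _ e f => (e.cost + f.cost + 7 : ℕ)
  | write e => (e.cost + 1 : ℕ)
  | seq p q => p.cost + q.cost
  | ite e p q => p.cost + q.cost + (e.cost + 1 : ℕ)
  | rep p => Polynomial.X * (p.cost + 3) + 2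

/-- The machine state `s` represents `σ`. -/
structure Sim (ix : V → ℕ) (s : State) (σ : Store V) : Prop where
  var : ∀ i, s.reg (varReg ix i) = σ.v i
  zero : s.reg 0 = 0
  arr : ∀ a i, s.mem (16 * i + a.ix) = σ.m a i
  out : s.out = σ.o

/-- Only register 0 and the registers congruent to 1 modulo 3 carry information about the store;
temporaries and loop counters live in the other residue classes and may change freely. -/
theorem Sim.congr {ix : V → ℕ} {s s' : State} {σ : Store V} (h : Sim ix s σ)
    (hm : s'.mem = s.mem) (ho : s'.out = s.out)
    (hr : ∀ r, r % 3 = 1 ∨ r = 0 → s'.reg r = s.reg r) : Sim ix s' σ where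
  var i := by rw [hr _ (Or.inl (by unfold varReg; omega)), h.var]
  zero := by rw [hr _ (Or.inr rfl), h.zero]
  arr a i := by rw [hm, h.arr]
  out := by rw [ho, h.out]

/-- The arrays are interleaved in memory with stride 16, and four doublings replace the missing
multiplication. -/
theorem address_apply (x : List ℕ) (a : Arr) (d : ℕ) (s : State) :
    ∃ s', Halts x (block (address a d)) s 6 s' ∧ s'.mem = s.mem ∧ s'.out = s.out ∧
      s'.reg (tmpReg d) = 16 * s.reg (tmpReg d) + a.ix ∧
      ∀ r, r ≠ tmpReg d → r ≠ tmpReg (d + 1) → s'.reg r = s.reg r := by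
  refine ⟨_, Halts.block _ s, ?_⟩
  have h1 : tmpReg d ≠ tmpReg (d + 1) := by unfold tmpReg; omega
  refine ⟨by simp [address, Instr.apply], by simp [address, Instr.apply], ?_, ?_⟩
  · simp [address, Instr.apply, h1]
    omega
  · intro r hr hr'
    simp [address, Instr.apply, h1, hr, hr']

theorem Halts.append {x : List ℕ} {l l' : List Instr} {s s' s'' : State} {t t' : ℕ}
    (h : Halts x (RAM.block l) s t s') (h' : Halts x (RAM.block l') s' t' s'') :
    Halts x (RAM.block (l ++ l')) s (t + t') s'' := by
  induction l generalizing s t with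
  | nil =>
    obtain ⟨W, h⟩ := h
    cases h
    simpa [RAM.block] using h'
  | cons i l ih =>
    obtain ⟨W, h⟩ := h
    cases h with
    | seq h₁ h₂ =>
      rw [add_assoc]
      exact Halts.seq ⟨W, h₁⟩ (ih ⟨W, h₂⟩)

/-- The frame condition drives the induction: code at depth `d` leaves the temporaries below `d`
alone, so a first operand survives the evaluation of the second one at depth `d + 1`. Copying a
register is subtraction of register 0, which always holds 0. -/
theorem Exp.comp_spec {ix : V → ℕ} {x : List ℕ} {σ : Store V} (e : Exp V) :
    ∀ (d : ℕ) (s : State), Sim ix s σ → ∃ s', Halts x (e.comp ix d) s e.cost s' ∧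
      s'.mem = s.mem ∧ s'.out = s.out ∧ s'.reg (tmpReg d) = e.eval x σ ∧
      ∀ r, r % 3 ≠ 2 ∨ r < tmpReg d → s'.reg r = s.reg r := by
  have aux : ∀ (d r : ℕ), r % 3 ≠ 2 ∨ r < tmpReg d → r ≠ tmpReg d ∧ r ≠ tmpReg (d + 1) := by
    unfold tmpReg; omega
  induction e with
  | const c =>
    intro d s h
    refine ⟨_, Halts.block _ s, by simp [Instr.apply], by simp [Instr.apply],
      by simp [Instr.apply, eval], fun r hr => ?_⟩
    simp [Instr.apply, aux d r hr]
  | var i =>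
    intro d s h
    refine ⟨_, Halts.block _ s, by simp [Instr.apply], by simp [Instr.apply],
      by simp [Instr.apply, eval, h.zero, h.var], fun r hr => ?_⟩
    simp [Instr.apply, aux d r hr]
  | arr a e ih =>
    intro d s h
    obtain ⟨s₁, e₁, m₁, o₁, v₁, r₁⟩ := ih d s h
    obtain ⟨s₂, e₂, m₂, o₂, v₂, r₂⟩ := address_apply x a d s₁
    have e₃ := Halts.block (x := x) [.load (tmpReg d) (tmpReg d)] s₂
    refine ⟨_, e₁.seq (e₂.append e₃), by simp [Instr.apply, m₁, m₂],
      by simp [Instr.apply, o₁, o₂], ?_, fun r hr => ?_⟩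
    · simp [Instr.apply, eval, v₂, m₂, m₁, v₁, h.arr]
    · simp [Instr.apply, aux d r hr, r₂ r (aux d r hr).1 (aux d r hr).2,
        r₁ r hr]
  | inp e ih =>
    intro d s h
    obtain ⟨s₁, e₁, m₁, o₁, v₁, r₁⟩ := ih d s h
    refine ⟨_, e₁.seq (Halts.block [.read (tmpReg d) (tmpReg d)] s₁), by simp [Instr.apply, m₁],
      by simp [Instr.apply, o₁], by simp [Instr.apply, eval, v₁], fun r hr => ?_⟩
    simp [Instr.apply, aux d r hr, r₁ r hr]
  | len =>
    intro d s h
    refine ⟨_, Halts.block _ s, by simp [Instr.apply], by simp [Instr.apply],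
      by simp [Instr.apply, eval], fun r hr => ?_⟩
    simp [Instr.apply, aux d r hr]
  | add e f ihe ihf =>
    intro d s h
    obtain ⟨s₁, e₁, m₁, o₁, v₁, r₁⟩ := ihe d s h
    obtain ⟨s₂, e₂, m₂, o₂, v₂, r₂⟩ := ihf (d + 1) s₁
      (h.congr m₁ o₁ fun r hr => r₁ r (Or.inl (by omega)))
    refine ⟨_, (e₁.seq e₂).seq (Halts.block [.add (tmpReg d) (tmpReg d) (tmpReg (d + 1))] s₂),
      by simp [Instr.apply, m₁, m₂], by simp [Instr.apply, o₁, o₂], ?_, fun r hr => ?_⟩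
    · simp [Instr.apply, eval, v₂, r₂ (tmpReg d) (Or.inr (by unfold tmpReg; omega)), v₁]
    · simp [Instr.apply, aux d r hr]
      rw [r₂ r (by unfold tmpReg at *; omega), r₁ r hr]
  | sub e f ihe ihf =>
    intro d s h
    obtain ⟨s₁, e₁, m₁, o₁, v₁, r₁⟩ := ihe d s h
    obtain ⟨s₂, e₂, m₂, o₂, v₂, r₂⟩ := ihf (d + 1) s₁
      (h.congr m₁ o₁ fun r hr => r₁ r (Or.inl (by omega)))
    refine ⟨_, (e₁.seq e₂).seq (Halts.block [.sub (tmpReg d) (tmpReg d) (tmpReg (d + 1))] s₂),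
      by simp [Instr.apply, m₁, m₂], by simp [Instr.apply, o₁, o₂], ?_, fun r hr => ?_⟩
    · simp [Instr.apply, eval, v₂, r₂ (tmpReg d) (Or.inr (by unfold tmpReg; omega)), v₁]
    · simp [Instr.apply, aux d r hr]
      rw [r₂ r (by unfold tmpReg at *; omega), r₁ r hr]

/-- The body keeps the counters of depth at most `d`, so inner loops cannot disturb this one. An
iteration costs the body, two instructions that decrease the counter, and one test, hence `B + 3`.
-/
theorem loop_spec {ix : V → ℕ} {x : List ℕ} {p : Prog} {f : Store V → Store V} {B d : ℕ}
    (hp : ∀ s σ, Sim ix s σ → ∃ t ≤ B, ∃ s', Halts x p s t s' ∧ Sim ix s' (f σ) ∧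
      ∀ e < d + 1, s'.reg (cntReg e) = s.reg (cntReg e)) (n : ℕ) :
    ∀ s σ, Sim ix s σ → s.reg (cntReg d) = n →
      ∃ t ≤ n * (B + 3) + 1, ∃ s', Halts x (.loop (cntReg d) (.seq p
        (block [.const (tmpReg 0) 1, .sub (cntReg d) (cntReg d) (tmpReg 0)]))) s t s' ∧
        Sim ix s' (f^[n] σ) ∧ ∀ e < d, s'.reg (cntReg e) = s.reg (cntReg e) := by
  induction n with
  | zero =>
    intro s σ h hn
    exact ⟨1, by simp, s, ⟨0, .loop_done hn⟩, h, fun _ _ => rfl⟩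
  | succ n ih =>
    intro s σ h hn
    obtain ⟨t₁, ht₁, s₁, e₁, h₁, r₁⟩ := hp s σ h
    have e₂ := Halts.block (x := x) [.const (tmpReg 0) 1,
      .sub (cntReg d) (cntReg d) (tmpReg 0)] s₁
    set s₂ := List.foldl (fun s i => Instr.apply x s i) s₁ [.const (tmpReg 0) 1,
      .sub (cntReg d) (cntReg d) (tmpReg 0)] with hs₂
    have hne : ∀ e, cntReg e ≠ tmpReg 0 := fun e => by unfold cntReg tmpReg; omega
    have h₂ : Sim ix s₂ (f σ) := by
      refine h₁.congr (by simp [hs₂, Instr.apply]) (by simp [hs₂, Instr.apply]) fun r hr => ?_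
      have a₁ : r ≠ tmpReg 0 := by unfold tmpReg; omega
      have a₂ : r ≠ cntReg d := by unfold cntReg; omega
      simp [hs₂, Instr.apply, Function.update_apply, a₁, a₂]
    have c₂ : s₂.reg (cntReg d) = n := by
      simp [hs₂, Instr.apply, hne, r₁ d (by omega), hn]
    obtain ⟨t₃, ht₃, s₃, e₃, h₃, r₃⟩ := ih s₂ _ h₂ c₂
    refine ⟨_, ?_, s₃, Halts.loop_step (by omega) (e₁.seq e₂) e₃, h₃, fun e he => ?_⟩
    · simp only [List.length_cons, List.length_nil]
      nlinarith
    · rw [r₃ e he, ← r₁ e (by omega)]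
      have a₂ : cntReg e ≠ cntReg d := by unfold cntReg; omega
      simp [hs₂, Instr.apply, a₂, hne]

/-- The depth `d` counts the enclosing loops and selects a fresh counter. Injectivity of `ix` is
what makes an assignment leave the other variables alone. -/
theorem Cmd.comp_spec {ix : V → ℕ} (hix : Function.Injective ix) {x : List ℕ} (p : Cmd V) :
    ∀ (d : ℕ) (s : State) (σ : Store V), Sim ix s σ →
      ∃ t ≤ p.cost.eval x.length, ∃ s', Halts x (p.comp ix d) s t s' ∧ Sim ix s' (p.run x σ) ∧
      ∀ e < d, s'.reg (cntReg e) = s.reg (cntReg e) := by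
  have hcv : ∀ e i, cntReg e ≠ varReg ix i := fun e i => by unfold cntReg varReg; omega
  have hct : ∀ e i, cntReg e ≠ tmpReg i := fun e i => by unfold cntReg tmpReg; omega
  have htv : ∀ i e, varReg ix i ≠ tmpReg e := fun i e => by unfold tmpReg varReg; omega
  have hv0 : ∀ i, 0 ≠ varReg ix i := fun i => by unfold varReg; omega
  induction p with
  | skip =>
    intro d s σ h
    exact ⟨0, Nat.zero_le _, s, ⟨0, .skip s⟩, h, fun _ _ => rfl⟩
  | assign i e =>
    intro d s σ h
    obtain ⟨s₁, e₁, m₁, o₁, v₁, r₁⟩ := e.comp_spec (x := x) 0 s h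
    have h₁ := h.congr m₁ o₁ fun r hr => r₁ r (Or.inl (by omega))
    refine ⟨_, ?_, _, e₁.seq (Halts.block [.sub (varReg ix i) (tmpReg 0) 0] s₁), ?_, ?_⟩
    · simp [Cmd.cost]
    · constructor
      · intro j
        have : varReg ix j = varReg ix i ↔ j = i :=
          ⟨fun hj => hix (by unfold varReg at hj; omega), fun hj => by rw [hj]⟩
        by_cases hj : j = i
        · subst hj
          simp [Instr.apply, run, v₁, h₁.zero]
        · simp [Instr.apply, run, this, hj, h₁.var]
      · simp [Instr.apply, hv0, h₁.zero]
      · intro a j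
        simp [Instr.apply, run, h₁.arr]
      · simp [Instr.apply, run, h₁.out]
    · intro c hc
      simp [Instr.apply, hcv, r₁ (cntReg c)
        (Or.inl (by unfold cntReg; omega))]
  | store a e f =>
    intro d s σ h
    obtain ⟨s₁, e₁, m₁, o₁, v₁, r₁⟩ := e.comp_spec (x := x) 0 s h
    have h₁ := h.congr m₁ o₁ fun r hr => r₁ r (Or.inl (by omega))
    obtain ⟨s₂, e₂, m₂, o₂, v₂, r₂⟩ := address_apply x a 0 s₁
    have h₂ := h₁.congr m₂ o₂ fun r hr => r₂ r (by unfold tmpReg; omega) (by unfold tmpReg; omega)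
    obtain ⟨s₃, e₃, m₃, o₃, v₃, r₃⟩ := f.comp_spec (x := x) 1 s₂ h₂
    have h₃ := h₂.congr m₃ o₃ fun r hr => r₃ r (Or.inl (by omega))
    refine ⟨_, ?_, _, (e₁.seq e₂).seq (e₃.seq (Halts.block [.store (tmpReg 0) (tmpReg 1)] s₃)),
      ?_, ?_⟩
    · simp [Cmd.cost]
      omega
    · have ht : s₃.reg (tmpReg 0) = 16 * e.eval x σ + a.ix := by
        rw [r₃ _ (Or.inr (by unfold tmpReg; omega)), v₂, v₁]
      constructor
      · intro j
        simp [Instr.apply, run, h₃.var]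
      · simp [Instr.apply, h₃.zero]
      · intro b j
        have := a.ix_lt
        have := b.ix_lt
        by_cases hb : b = a
        · subst hb
          simp [Instr.apply, run, ht, v₃, Function.update_apply, h₃.arr]
        · have : ¬ 16 * j + b.ix = 16 * e.eval x σ + a.ix := by
            have : b.ix ≠ a.ix := fun h => hb (Arr.ix_inj h)
            omega
          simp [Instr.apply, run, ht, hb, this, h₃.arr]
      · simp [Instr.apply, run, h₃.out]
    · intro c hc
      have : cntReg c % 3 ≠ 2 := by unfold cntReg; omega
      simp [Instr.apply, r₃ _ (Or.inl this), r₂ _ (hct _ _) (hct _ _), r₁ _ (Or.inl this)]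
  | write e =>
    intro d s σ h
    obtain ⟨s₁, e₁, m₁, o₁, v₁, r₁⟩ := e.comp_spec (x := x) 0 s h
    have h₁ := h.congr m₁ o₁ fun r hr => r₁ r (Or.inl (by omega))
    refine ⟨_, ?_, _, e₁.seq (Halts.block [.write (tmpReg 0)] s₁), ?_, ?_⟩
    · simp [Cmd.cost]
    · constructor
      · intro j
        simp [Instr.apply, run, h₁.var]
      · simp [Instr.apply, h₁.zero]
      · intro a j
        simp [Instr.apply, run, h₁.arr]
      · simp [Instr.apply, run, h₁.out, v₁]
    · intro c hc
      simp [Instr.apply, r₁ (cntReg c) (Or.inl (by unfold cntReg; omega))]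
  | seq p q ihp ihq =>
    intro d s σ h
    obtain ⟨t₁, ht₁, s₁, e₁, h₁, r₁⟩ := ihp d s σ h
    obtain ⟨t₂, ht₂, s₂, e₂, h₂, r₂⟩ := ihq d s₁ _ h₁
    refine ⟨_, ?_, s₂, e₁.seq e₂, h₂, fun e he => by rw [r₂ e he, r₁ e he]⟩
    simp only [Cmd.cost, Polynomial.eval_add]
    omega
  | ite e p q ihp ihq =>
    intro d s σ h
    obtain ⟨s₁, e₁, m₁, o₁, v₁, r₁⟩ := e.comp_spec (x := x) 0 s h
    have h₁ := h.congr m₁ o₁ fun r hr => r₁ r (Or.inl (by omega))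
    have rc : ∀ c, s₁.reg (cntReg c) = s.reg (cntReg c) := fun c =>
      r₁ _ (Or.inl (by unfold cntReg; omega))
    by_cases he : e.eval x σ = 0
    · obtain ⟨t₂, ht₂, s₂, e₂, h₂, r₂⟩ := ihq d s₁ σ h₁
      refine ⟨_, ?_, s₂, e₁.seq (Halts.ite_false (by rw [v₁, he]) e₂), by simpa [run, he] using h₂,
        fun c hc => by rw [r₂ c hc, rc]⟩
      simp only [Cmd.cost, Polynomial.eval_add, Polynomial.eval_natCast, Nat.cast_id]
      omega
    · obtain ⟨t₂, ht₂, s₂, e₂, h₂, r₂⟩ := ihp d s₁ σ h₁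
      refine ⟨_, ?_, s₂, e₁.seq (Halts.ite_true (by rwa [v₁]) e₂), by simpa [run, he] using h₂,
        fun c hc => by rw [r₂ c hc, rc]⟩
      simp only [Cmd.cost, Polynomial.eval_add, Polynomial.eval_natCast, Nat.cast_id]
      omega
  | rep p ih =>
    intro d s σ h
    have e₁ := Halts.block (x := x) [.len (cntReg d)] s
    set s₁ := List.foldl (fun s i => Instr.apply x s i) s [.len (cntReg d)] with hs₁
    have h₁ : Sim ix s₁ σ := by
      refine h.congr (by simp [hs₁, Instr.apply]) (by simp [hs₁, Instr.apply]) fun r hr => ?_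
      have a₂ : r ≠ cntReg d := by unfold cntReg; omega
      simp [hs₁, Instr.apply, a₂]
    obtain ⟨t₂, ht₂, s₂, e₂, h₂, r₂⟩ := loop_spec (d := d) (ih (d + 1)) x.length s₁ σ h₁
      (by simp [hs₁, Instr.apply])
    refine ⟨_, ?_, s₂, e₁.seq e₂, h₂, fun e he => ?_⟩
    · simp only [Cmd.cost, Polynomial.eval_add, Polynomial.eval_mul, Polynomial.eval_X,
        Polynomial.eval_ofNat, List.length_cons, List.length_nil]
      omega
    · rw [r₂ e he]
      have a₂ : cntReg e ≠ cntReg d := by unfold cntReg; omega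
      simp [hs₁, Instr.apply, a₂]

/-- The store in which everything is `0`. -/
def Store.init : Store V := ⟨fun _ => 0, fun _ _ => 0, []⟩

theorem Cmd.halts [Finite V] (p : Cmd V) : ∃ r : Prog,
    (∃ ix : V → ℕ, r = p.comp ix 0) ∧
    ∀ x, ∃ t ≤ p.cost.eval x.length, ∃ s, Halts x r State.initial t s ∧
      s.out = (p.run x Store.init).o := by
  obtain ⟨ix, hix⟩ := exists_injective_nat V
  refine ⟨p.comp ix 0, ⟨ix, rfl⟩, fun x => ?_⟩
  obtain ⟨t, ht, s, h, hs, -⟩ := p.comp_spec hix (x := x) 0 State.initial Store.init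
    ⟨fun _ => rfl, rfl, fun _ _ => rfl, rfl⟩
  exact ⟨t, ht, s, h, hs.out⟩

theorem length_le_inputLength (x : List ℕ) : x.length ≤ inputLength x := by
  unfold inputLength
  induction x with
  | nil => simp
  | cons a l ih => simp; omega

theorem eval_mono_nat (p : Polynomial ℕ) {a b : ℕ} (h : a ≤ b) : p.eval a ≤ p.eval b := by
  simp only [Polynomial.eval_eq_sum, Polynomial.sum]
  gcongr

/-- Loops are bounded by the number of input cells, so the cost of a command is a polynomial by
recursion on its text. No uniform space bound is claimed: `W` depends on the input. -/
theorem Cmd.exists_polynomial_time [Finite V] (p : Cmd V) : ∃ (r : Prog) (T : Polynomial ℕ),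
    ∀ x, ∃ W, OutputsWithin r x (p.run x Store.init).o (T.eval (inputLength x)) W := by
  obtain ⟨r, -, h⟩ := p.halts
  refine ⟨r, p.cost, fun x => ?_⟩
  obtain ⟨t, ht, s, ⟨W, hW⟩, ho⟩ := h x
  exact ⟨W, t, ht.trans (eval_mono_nat _ (length_le_inputLength x)), s, hW, ho⟩

/-! ### Logarithmic space -/

/-- The instruction does not add or store numbers, uses registers below `K` only, and constants at
most `C`. -/
def Instr.Frugal (K C : ℕ) : Instr → Prop
  | .const i v => i < K ∧ v ≤ C
  | .add _ _ _ => False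
  | .sub i _ _ => i < K
  | .load i _ => i < K
  | .store _ _ => False
  | .read i _ => i < K
  | .len i => i < K
  | .write _ => True

/-- All instructions of the program are frugal. -/
def Prog.Frugal (K C : ℕ) : Prog → Prop
  | .skip => True
  | .instr i => i.Frugal K C
  | .seq p q => p.Frugal K C ∧ q.Frugal K C
  | .ite _ p q => p.Frugal K C ∧ q.Frugal K C
  | .loop _ p => p.Frugal K C

/-- The registers below `K` contain numbers at most `N`; nothing else is in use. -/
structure State.Small (K N : ℕ) (s : State) : Prop where
  reg_le : ∀ i, s.reg i ≤ N
  reg_eq : ∀ i, K ≤ i → s.reg i = 0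
  mem : s.mem = 0

theorem State.Small.space_le {K N : ℕ} {s : State} (h : s.Small K N) :
    s.space ≤ K * (K.size + N.size) := by
  unfold State.space bits
  rw [h.mem, Finsupp.sum_zero_index, add_zero, Finsupp.sum]
  have hs : s.reg.support ⊆ Finset.range K := by
    intro i hi
    rw [Finset.mem_range]
    by_contra hK
    exact (Finsupp.mem_support_iff.1 hi) (h.reg_eq i (not_lt.1 hK))
  refine (Finset.sum_le_sum_of_subset hs).trans ?_
  refine (Finset.sum_le_card_nsmul _ _ (K.size + N.size) fun i hi => ?_).trans (by simp)
  exact add_le_add (Nat.size_le_size (Finset.mem_range.1 hi).le) (Nat.size_le_size (h.reg_le i))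

theorem State.Small.update {K N : ℕ} {s : State} (h : s.Small K N) {i v : ℕ} (hi : i < K)
    (hv : v ≤ N) : State.Small K N { s with reg := s.reg.update i v } where
  reg_le j := by
    simp only [Finsupp.coe_update, Function.update_apply]
    split_ifs
    exacts [hv, h.reg_le j]
  reg_eq j hj := by
    have : j ≠ i := by omega
    simp [this, h.reg_eq j hj]
  mem := h.mem

/-- Without addition, every value that enters a register is a constant, an input entry, the input
length, a difference, or the content of a memory that stays 0. None of them exceeds `N`, and only
`K` registers are ever written. -/
theorem Exec.space_le {x : List ℕ} {K C N : ℕ} (hC : C ≤ N) (hx : x.length ≤ N)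
    (hx' : ∀ v ∈ x, v ≤ N) {W : ℕ} {p : Prog} {s s' : State} {t : ℕ} (h : Exec x W p s t s') :
    p.Frugal K C → s.Small K N →
    Exec x (K * (K.size + N.size)) p s t s' ∧ s'.Small K N := by
  induction h with
  | skip s => exact fun _ hs => ⟨.skip s, hs⟩
  | instr i s h =>
    intro hp hs
    have : (i.apply x s).Small K N := by
      cases i with
      | const i v => exact hs.update hp.1 (hp.2.trans hC)
      | add i j k => exact hp.elim
      | sub i j k => exact hs.update hp ((Nat.sub_le _ _).trans (hs.reg_le j))
      | load i j =>
        refine hs.update hp ?_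
        rw [hs.mem]
        exact Nat.zero_le _
      | store i j => exact hp.elim
      | read i j =>
        refine hs.update hp ?_
        rw [List.getD_eq_getElem?_getD]
        rcases h : x[s.reg j]? with _ | v
        · exact Nat.zero_le _
        · exact hx' v (List.mem_of_getElem? h)
      | len i => exact hs.update hp hx
      | write i => exact ⟨hs.reg_le, hs.reg_eq, hs.mem⟩
    exact ⟨.instr i s this.space_le, this⟩
  | seq _ _ h₁ h₂ =>
    intro hp hs
    obtain ⟨e₁, hs₁⟩ := h₁ hp.1 hs
    obtain ⟨e₂, hs₂⟩ := h₂ hp.2 hs₁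
    exact ⟨.seq e₁ e₂, hs₂⟩
  | ite_true h _ h₁ =>
    intro hp hs
    exact (h₁ hp.1 hs).imp_left (.ite_true h)
  | ite_false h _ h₁ =>
    intro hp hs
    exact (h₁ hp.2 hs).imp_left (.ite_false h)
  | loop_done h => exact fun _ hs => ⟨.loop_done h, hs⟩
  | loop_step h _ _ h₁ h₂ =>
    intro hp hs
    obtain ⟨e₁, hs₁⟩ := h₁ hp hs
    obtain ⟨e₂, hs₂⟩ := h₂ hp hs₁
    exact ⟨.loop_step h e₁ e₂, hs₂⟩

theorem Prog.Frugal.mono {K K' C : ℕ} (hK : K ≤ K') {p : Prog} (h : p.Frugal K C) :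
    p.Frugal K' C := by
  induction p with
  | skip => trivial
  | instr i => cases i <;> simp only [Prog.Frugal, Instr.Frugal] at * <;> omega
  | seq p q hp hq => exact ⟨hp h.1, hq h.2⟩
  | ite i p q hp hq => exact ⟨hp h.1, hq h.2⟩
  | loop i p hp => exact hp h

/-- The expression does not add, does not use arrays, and uses constants at most `C`. -/
def Exp.Frugal (C : ℕ) : Exp V → Prop
  | const c => c ≤ C
  | var _ => True
  | arr _ _ => False
  | inp e => e.Frugal C
  | len => True
  | add _ _ => False
  | sub e f => e.Frugal C ∧ f.Frugal C

/-- All expressions in the command are frugal, and nothing is stored. -/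
def Cmd.Frugal (C : ℕ) : Cmd V → Prop
  | skip => True
  | assign _ e => e.Frugal C
  | store _ _ _ => False
  | write e => e.Frugal C
  | seq p q => p.Frugal C ∧ q.Frugal C
  | ite e p q => e.Frugal C ∧ p.Frugal C ∧ q.Frugal C
  | rep p => p.Frugal C

theorem Exp.Frugal.comp {ix : V → ℕ} {C : ℕ} {e : Exp V} (h : e.Frugal C) :
    ∀ d, ∃ K, (e.comp ix d).Frugal K C := by
  induction e with
  | const c => exact fun d => ⟨tmpReg d + 1, ⟨Nat.lt_succ_self _, h⟩, trivial⟩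
  | var i => exact fun d => ⟨tmpReg d + 1, Nat.lt_succ_self (tmpReg d), trivial⟩
  | arr a e => exact h.elim
  | inp e ih =>
    intro d
    obtain ⟨K, hK⟩ := ih h d
    exact ⟨max K (tmpReg d + 1), hK.mono (le_max_left _ _),
      lt_max_of_lt_right (Nat.lt_succ_self (tmpReg d)), trivial⟩
  | len => exact fun d => ⟨tmpReg d + 1, Nat.lt_succ_self (tmpReg d), trivial⟩
  | add e f => exact h.elim
  | sub e f ihe ihf =>
    intro d
    obtain ⟨K, hK⟩ := ihe h.1 d
    obtain ⟨K', hK'⟩ := ihf h.2 (d + 1)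
    exact ⟨max (max K K') (tmpReg d + 1), ⟨hK.mono (by simp), hK'.mono (by simp)⟩,
      lt_max_of_lt_right (Nat.lt_succ_self (tmpReg d)), trivial⟩

/-- The condition `1 ≤ C` accounts for the constant 1 by which loop counters are decreased. -/
theorem Cmd.Frugal.comp {ix : V → ℕ} {C : ℕ} (hC : 1 ≤ C) {p : Cmd V} (h : p.Frugal C) :
    ∀ d, ∃ K, (p.comp ix d).Frugal K C := by
  induction p with
  | skip => exact fun d => ⟨0, trivial⟩
  | assign i e =>
    intro d
    obtain ⟨K, hK⟩ := Exp.Frugal.comp (ix := ix) h 0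
    exact ⟨max K (varReg ix i + 1), hK.mono (le_max_left _ _),
      lt_max_of_lt_right (Nat.lt_succ_self (varReg ix i)), trivial⟩
  | store a e f => exact h.elim
  | write e =>
    intro d
    obtain ⟨K, hK⟩ := Exp.Frugal.comp (ix := ix) h 0
    exact ⟨K, hK, trivial, trivial⟩
  | seq p q ihp ihq =>
    intro d
    obtain ⟨K, hK⟩ := ihp h.1 d
    obtain ⟨K', hK'⟩ := ihq h.2 d
    exact ⟨max K K', hK.mono (le_max_left _ _), hK'.mono (le_max_right _ _)⟩
  | ite e p q ihp ihq =>
    intro d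
    obtain ⟨K₀, hK₀⟩ := Exp.Frugal.comp (ix := ix) h.1 0
    obtain ⟨K, hK⟩ := ihp h.2.1 d
    obtain ⟨K', hK'⟩ := ihq h.2.2 d
    exact ⟨max K₀ (max K K'), hK₀.mono (by simp), hK.mono (by simp), hK'.mono (by simp)⟩
  | rep p ih =>
    intro d
    obtain ⟨K, hK⟩ := ih h (d + 1)
    refine ⟨max K (cntReg d + tmpReg 0 + 1), ⟨?_, trivial⟩, hK.mono (le_max_left _ _), ⟨?_, hC⟩,
      ?_, trivial⟩
    · exact lt_max_of_lt_right (by omega)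
    · exact lt_max_of_lt_right (by omega)
    · exact lt_max_of_lt_right (by omega)

theorem Cmd.Frugal.exists_log_space [Finite V] {p : Cmd V} {C : ℕ} (hC : 1 ≤ C)
    (hp : p.Frugal C) : ∃ (r : Prog) (T : Polynomial ℕ) (c : ℕ), ∀ x : List ℕ, C ≤ x.length →
      (∀ v ∈ x, v ≤ x.length) →
      OutputsWithin r x (p.run x Store.init).o (T.eval (inputLength x))
        (c * (inputLength x).size) := by
  obtain ⟨_, ⟨ix, rfl⟩, h⟩ := p.halts
  obtain ⟨K, hK⟩ := hp.comp (ix := ix) hC 0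
  -- Each of the `K` registers takes at most `K.size` bits of address and `s` bits of content, where
  -- `s` is the size of the input length, and `K.size + s ≤ (K.size + 1) * s` because `1 ≤ s`.
  refine ⟨p.comp ix 0, p.cost, K * (K.size + 1), fun x hx hx' => ?_⟩
  obtain ⟨t, ht, s, ⟨W, hW⟩, ho⟩ := h x
  have hl := length_le_inputLength x
  obtain ⟨he, -⟩ := hW.space_le (hx.trans hl) hl (fun v hv => (hx' v hv).trans hl) hK
    ⟨fun _ => Nat.zero_le _, fun _ _ => rfl, rfl⟩
  refine ⟨t, ht.trans (eval_mono_nat _ hl), s, he.mono ?_, ho⟩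
  have : 1 ≤ (inputLength x).size := Nat.size_pos.2 (by omega)
  rw [mul_assoc]
  gcongr
  nlinarith [Nat.zero_le K.size]

/-! ### Counted loops -/

/-- If the counter is below the bound, do `p` and increase the counter. -/
def Cmd.guarded (c : V) (b next : Exp V) (p : Cmd V) : Cmd V :=
  .ite (.sub b (.var c)) (.seq p (.assign c next)) .skip

/-- Do `p` for `c = 0, …, b - 1`, provided that `b` is at most the cube of the input length. -/
def Cmd.upto (c : V) (b : Exp V) (p : Cmd V) : Cmd V :=
  .seq (.assign c (.const 0))
    (.rep (.rep (.rep (.guarded c b (.add (.var c) (.const 1)) p))))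

/-- After `M` iterations the counter is `min M N`: surplus iterations do nothing. The expression
`next` is left open because the increment is an addition in one translation and a clamped sum in the
other. -/
theorem Cmd.guarded_iterate {x : List ℕ} {c : V} {b next : Exp V} {p : Cmd V}
    {I : ℕ → Store V → Prop} {N : ℕ}
    (hb : ∀ i σ, I i σ → σ.v c = i → b.eval x σ = N)
    (hp : ∀ i σ, i < N → I i σ → σ.v c = i →
      I (i + 1) ((Cmd.seq p (.assign c next)).run x σ) ∧
      ((Cmd.seq p (.assign c next)).run x σ).v c = i + 1)
    {σ : Store V} (h0 : I 0 σ) (hc : σ.v c = 0) (M : ℕ) :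
    I (min M N) (((Cmd.guarded c b next p).run x)^[M] σ) ∧
      (((Cmd.guarded c b next p).run x)^[M] σ).v c = min M N := by
  induction M with
  | zero => simpa using ⟨h0, hc⟩
  | succ M ih =>
    rw [Function.iterate_succ_apply']
    obtain ⟨h, hv⟩ := ih
    generalize ((Cmd.guarded c b next p).run x)^[M] σ = τ at *
    have hbe := hb _ _ h hv
    unfold guarded
    by_cases hM : M < N
    · have e : min M N = M := by omega
      have e' : min (M + 1) N = M + 1 := by omega
      rw [e] at h hv
      have h2 : (Exp.sub b (.var c)).eval x τ ≠ 0 := by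
        simp only [Exp.eval, hbe, hv]; omega
      rw [e', Cmd.run, if_pos h2]
      exact hp _ _ hM h hv
    · have e : min M N = N := by omega
      have e' : min (M + 1) N = N := by omega
      rw [e] at h hv
      have h2 : (Exp.sub b (.var c)).eval x τ = 0 := by
        simp only [Exp.eval, hbe, hv]; omega
      rw [e', Cmd.run, if_neg (by simp [h2])]
      exact ⟨h, hv⟩

/-- Three nested repetitions provide `x.length ^ 3` iterations, enough for the quadratically many
nodes of an automaton. -/
theorem Cmd.upto_spec {x : List ℕ} {c : V} {b : Exp V} {p : Cmd V} (I : ℕ → Store V → Prop)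
    {N : ℕ} (hN : N ≤ x.length ^ 3)
    (hb : ∀ i σ, I i σ → σ.v c = i → b.eval x σ = N)
    (hp : ∀ i σ, i < N → I i σ → σ.v c = i → (p.run x σ).v c = i ∧
      I (i + 1) ((Cmd.assign c (.add (.var c) (.const 1))).run x (p.run x σ)))
    {σ : Store V} (h0 : I 0 ((Cmd.assign c (.const 0)).run x σ)) :
    I N ((Cmd.upto c b p).run x σ) := by
  have := (Cmd.guarded_iterate (x := x) (c := c) (b := b) (next := .add (.var c) (.const 1))
    (p := p) (I := I) hb (fun i σ hi h hv => ?_) h0 (by simp [Cmd.run, Exp.eval])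
    (x.length ^ 3)).1
  · rw [min_eq_right hN] at this
    convert this using 1
    simp only [Cmd.upto, Cmd.run]
    have e : x.length ^ 3 = x.length * x.length * x.length := by ring
    rw [e, Function.iterate_mul, Function.iterate_mul]
  · obtain ⟨h1, h2⟩ := hp i σ hi h hv
    exact ⟨h2, by simp [Cmd.run, Exp.eval, h1]⟩

end RAM

/-! ## From indicator pairs to automata -/

namespace UPDA

theorem Reaches.trans {Q Γ : Type*} {A : UPDA Q Γ} {c₁ c₂ c₃ : Q × List Γ} {u v : List Unit}
    (h : A.Reaches c₁ u c₂) (h' : A.Reaches c₂ v c₃) : A.Reaches c₁ (u ++ v) c₃ := by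
  induction h with
  | refl c => exact h'
  | head hm _ ih =>
    rw [List.append_assoc]
    exact .head hm (ih h')

theorem Move.reaches {Q Γ : Type*} {A : UPDA Q Γ} {c₁ c₂ : Q × List Γ} {σ : Option Unit}
    (h : A.Move c₁ σ c₂) : A.Reaches c₁ σ.toList c₂ := by
  simpa using Reaches.head h (.refl c₂)

variable {K : ℕ}

/-- The transitions of `ofGrammar` for the nonterminal `j`. -/
def rules (g : Fin K → Bool ⊕ (Fin K × Fin K)) (j : Fin K) :
    List (Fin 3 × Option Unit × Fin (K + 1) × Fin 3 × List (Fin (K + 1))) :=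
  match g j with
  | .inl false => [(1, some (), j.castSucc, 1, [])]
  | .inl true => [(1, none, j.castSucc, 2, [j.castSucc]), (2, some (), j.castSucc, 1, [])]
  | .inr (a, b) => [(1, none, j.castSucc, 1, [a.castSucc, b.castSucc])]

/-- The transitions of `ofGrammar`. -/
def transList (g : Fin K → Bool ⊕ (Fin K × Fin K)) (s₁ s₂ : Fin K) :
    List (Fin 3 × Option Unit × Fin (K + 1) × Fin 3 × List (Fin (K + 1))) :=
  (0, none, Fin.last K, 1, [s₁.castSucc, Fin.last K]) ::
    (1, none, Fin.last K, 1, [s₂.castSucc, Fin.last K]) :: (List.finRange K).flatMap (rules g)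

theorem mem_transList {g : Fin K → Bool ⊕ (Fin K × Fin K)} {s₁ s₂ : Fin K}
    {q₁ σ γ q₂ s} : (q₁, σ, γ, q₂, s) ∈ transList g s₁ s₂ ↔
      (q₁ = 0 ∧ σ = none ∧ γ = Fin.last K ∧ q₂ = 1 ∧ s = [s₁.castSucc, Fin.last K]) ∨
      (q₁ = 1 ∧ σ = none ∧ γ = Fin.last K ∧ q₂ = 1 ∧ s = [s₂.castSucc, Fin.last K]) ∨
      ∃ j, γ = j.castSucc ∧
        ((g j = .inl false ∧ q₁ = 1 ∧ σ = some () ∧ q₂ = 1 ∧ s = []) ∨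
        (g j = .inl true ∧ q₁ = 1 ∧ σ = none ∧ q₂ = 2 ∧ s = [j.castSucc]) ∨
        (g j = .inl true ∧ q₁ = 2 ∧ σ = some () ∧ q₂ = 1 ∧ s = []) ∨
        ∃ a b, g j = .inr (a, b) ∧ q₁ = 1 ∧ σ = none ∧ q₂ = 1 ∧
          s = [a.castSucc, b.castSucc]) := by
  have key : ∀ j, (q₁, σ, γ, q₂, s) ∈ rules g j ↔ γ = j.castSucc ∧
        ((g j = .inl false ∧ q₁ = 1 ∧ σ = some () ∧ q₂ = 1 ∧ s = []) ∨
        (g j = .inl true ∧ q₁ = 1 ∧ σ = none ∧ q₂ = 2 ∧ s = [j.castSucc]) ∨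
        (g j = .inl true ∧ q₁ = 2 ∧ σ = some () ∧ q₂ = 1 ∧ s = []) ∨
        ∃ a b, g j = .inr (a, b) ∧ q₁ = 1 ∧ σ = none ∧ q₂ = 1 ∧
          s = [a.castSucc, b.castSucc]) := by
    intro j
    unfold rules
    rcases g j with (_ | _) | ⟨a, b⟩
    · simp; tauto
    · simp; tauto
    · simp only [List.mem_singleton, Prod.mk.injEq, reduceCtorEq, false_and, false_or]
      constructor
      · rintro ⟨h₁, h₂, h₃, h₄, h₅⟩
        exact ⟨h₃, a, b, rfl, h₁, h₂, h₄, h₅⟩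
      · rintro ⟨h₃, a', b', e, h₁, h₂, h₄, h₅⟩
        obtain ⟨rfl, rfl⟩ := Prod.mk.inj (Sum.inr.inj e)
        exact ⟨h₁, h₂, h₃, h₄, h₅⟩
  simp only [transList, List.mem_cons, List.mem_flatMap, List.mem_finRange, true_and, key,
    Prod.mk.injEq]

/-- The automaton that produces the two words generated by a grammar from `s₁` and `s₂`, the second
of them over and over again. -/
def ofGrammar (g : Fin K → Bool ⊕ (Fin K × Fin K)) (s₁ s₂ : Fin K) :
    UPDA (Fin 3) (Fin (K + 1)) where
  bot := Fin.last K
  start := 0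
  final := {2}
  trans := {t | t ∈ transList g s₁ s₂}
  trans_bot := by
    intro q₁ σ γ q₂ s h
    have hne : ∀ j : Fin K, Fin.last K ≠ j.castSucc := fun j => (Fin.castSucc_ne_last j).symm
    rcases mem_transList.1 h with ⟨-, -, rfl, -, rfl⟩ | ⟨-, -, rfl, -, rfl⟩ | ⟨j, rfl, h₂⟩
    · exact Or.inr ⟨rfl, Or.inr ⟨[s₁.castSucc], by simp [hne], rfl⟩⟩
    · exact Or.inr ⟨rfl, Or.inr ⟨[s₂.castSucc], by simp [hne], rfl⟩⟩
    · refine Or.inl ⟨(hne j).symm, ?_⟩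
      rcases h₂ with ⟨-, -, -, -, rfl⟩ | ⟨-, -, -, -, rfl⟩ | ⟨-, -, -, -, rfl⟩ |
        ⟨a, b, -, -, -, -, rfl⟩ <;> simp [hne]

variable {g : Fin K → Bool ⊕ (Fin K × Fin K)} {s₁ s₂ : Fin K}

theorem ofGrammar_isShort : (ofGrammar g s₁ s₂).IsShort := by
  intro q₁ σ γ q₂ s h
  rcases mem_transList.1 h with ⟨-, -, -, -, rfl⟩ | ⟨-, -, -, -, rfl⟩ | ⟨j, -, h⟩
  · simp
  · simp
  · rcases h with ⟨-, -, -, -, rfl⟩ | ⟨-, -, -, -, rfl⟩ | ⟨-, -, -, -, rfl⟩ |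
      ⟨a, b, -, -, -, -, rfl⟩ <;> simp

theorem transList_unique {q σ γ q₂ s σ' q₂' s'} (h : (q, σ, γ, q₂, s) ∈ transList g s₁ s₂)
    (h' : (q, σ', γ, q₂', s') ∈ transList g s₁ s₂) : σ = σ' ∧ q₂ = q₂' ∧ s = s' := by
  have hne : ∀ j : Fin K, Fin.last K ≠ j.castSucc := fun j => (Fin.castSucc_ne_last j).symm
  rcases mem_transList.1 h with ⟨rfl, rfl, rfl, rfl, rfl⟩ | ⟨rfl, rfl, rfl, rfl, rfl⟩ | ⟨j, rfl, h₁⟩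
  · rcases mem_transList.1 h' with ⟨-, rfl, -, rfl, rfl⟩ | ⟨h, -⟩ | ⟨j, h, -⟩
    · simp
    · simp at h
    · exact (hne j h).elim
  · rcases mem_transList.1 h' with ⟨h, -⟩ | ⟨-, rfl, -, rfl, rfl⟩ | ⟨j, h, -⟩
    · simp at h
    · simp
    · exact (hne j h).elim
  · rcases mem_transList.1 h' with ⟨-, -, h, -⟩ | ⟨-, -, h, -⟩ | ⟨j', hj, h₂⟩
    · exact (hne j h.symm).elim
    · exact (hne j h.symm).elim
    · obtain rfl : j = j' := Fin.castSucc_injective _ hj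
      rcases h₁ with ⟨e, rfl, rfl, rfl, rfl⟩ | ⟨e, rfl, rfl, rfl, rfl⟩ | ⟨e, rfl, rfl, rfl, rfl⟩ |
        ⟨a, b, e, rfl, rfl, rfl, rfl⟩ <;>
      rcases h₂ with ⟨e', e₁, rfl, rfl, rfl⟩ | ⟨e', e₁, rfl, rfl, rfl⟩ | ⟨e', e₁, rfl, rfl, rfl⟩ |
        ⟨a', b', e', e₁, rfl, rfl, rfl⟩ <;> simp_all

/-- State and top symbol determine the transition, and the transition determines the move. The
exceptional move at the bottom never occurs, since both transitions at the bottom symbol write a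
nonempty word. -/
theorem ofGrammar_deterministic : (ofGrammar g s₁ s₂).Deterministic := by
  rintro ⟨q, st⟩ σ₁ ⟨q₁, st₁⟩ σ₂ ⟨q₂, st₂⟩ ⟨-, -, γ, s, ht, h⟩ ⟨-, -, γ', s', ht', h'⟩
  have hs : ∀ {q σ q' s}, (q, σ, Fin.last K, q', s) ∈ (ofGrammar g s₁ s₂).trans → s ≠ [] := by
    intro q σ q' s h
    rcases mem_transList.1 h with ⟨-, -, -, -, rfl⟩ | ⟨-, -, -, -, rfl⟩ | ⟨j, h, -⟩
    · simp
    · simp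
    · exact ((Fin.castSucc_ne_last j) h.symm).elim
  rcases h with ⟨-, r, hr, hr₁⟩ | ⟨rfl, rfl, -, -⟩
  · rcases h' with ⟨-, r', hr', hr₁'⟩ | ⟨rfl, rfl, -, -⟩
    · simp only at hr hr' hr₁ hr₁' ht ht'
      obtain ⟨rfl, rfl⟩ := List.cons.inj (hr.symm.trans hr')
      obtain ⟨rfl, rfl, rfl⟩ := transList_unique ht ht'
      exact ⟨rfl, by rw [hr₁, hr₁']⟩
    · exact (hs ht' rfl).elim
  · exact (hs ht rfl).elim

/-- A stack of nonterminals, on top of the bottom symbol. -/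
def stack (st : List (Fin K)) : List (Fin (K + 1)) := st.map Fin.castSucc ++ [Fin.last K]

theorem isConfig_stack (q : Fin 3) (st : List (Fin K)) :
    (ofGrammar g s₁ s₂).IsConfig (q, stack st) :=
  ⟨st.map Fin.castSucc, by simp [ofGrammar, Fin.castSucc_ne_last], rfl⟩

theorem move_nonterminal {q q' : Fin 3} {σ : Option Unit} {j : Fin K} {s st : List (Fin K)}
    (h : (q, σ, j.castSucc, q', s.map Fin.castSucc) ∈ transList g s₁ s₂) :
    (ofGrammar g s₁ s₂).Move (q, stack (j :: st)) σ (q', stack (s ++ st)) :=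
  ⟨isConfig_stack _ _, isConfig_stack _ _, j.castSucc, s.map Fin.castSucc, h,
    Or.inl ⟨Or.inl (Fin.castSucc_ne_last j), stack st, rfl, by simp [stack]⟩⟩

theorem move_bot {q q' : Fin 3} {σ : Option Unit} {j : Fin K}
    (h : (q, σ, Fin.last K, q', [j.castSucc, Fin.last K]) ∈ transList g s₁ s₂) :
    (ofGrammar g s₁ s₂).Move (q, stack []) σ (q', stack [j]) :=
  ⟨isConfig_stack _ _, isConfig_stack _ _, Fin.last K, [j.castSucc, Fin.last K], h,
    Or.inl ⟨Or.inr (by simp), [], rfl, rfl⟩⟩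

/-- The grammar generates the word `w j` from `j`. -/
def Generates (g : Fin K → Bool ⊕ (Fin K × Fin K)) (w : Fin K → List Bool) : Prop :=
  ∀ j, (∀ b, g j = .inl b → w j = [b]) ∧ ∀ a b, g j = .inr (a, b) → w j = w a ++ w b

/-- After `i` letters, `c` continues with the word on the stack, and then with the period. -/
def Predicts (w : Fin K → List Bool) (s₁ s₂ : Fin K) (c : ℕ → Bool) (i : ℕ)
    (st : List (Fin K)) : Prop :=
  (∀ n, n < (st.flatMap w).length → (st.flatMap w)[n]? = some (c (i + n))) ∧
    (w s₁).length ≤ i + (st.flatMap w).length ∧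
    (i + (st.flatMap w).length - (w s₁).length) % (w s₂).length = 0

/-- The invariant of the runs of `ofGrammar`. -/
def RunInv (g : Fin K → Bool ⊕ (Fin K × Fin K)) (w : Fin K → List Bool) (s₁ s₂ : Fin K)
    (c : ℕ → Bool) (i : ℕ) (x : Fin 3 × List (Fin (K + 1))) : Prop :=
  (x = (0, stack []) ∧ i = 0) ∨ (∃ st, x = (1, stack st) ∧ Predicts w s₁ s₂ c i st) ∨
    ∃ j st, x = (2, stack (j :: st)) ∧ g j = .inl true ∧ Predicts w s₁ s₂ c i (j :: st)

variable {w : Fin K → List Bool} {c : ℕ → Bool} {i : ℕ}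

theorem Predicts.congr {st st' : List (Fin K)} (h : Predicts w s₁ s₂ c i st)
    (he : st'.flatMap w = st.flatMap w) : Predicts w s₁ s₂ c i st' := by
  unfold Predicts
  rwa [he]

/-- Reading a letter uses up exactly the first predicted bit. -/
theorem Predicts.tail {b : Bool} {j : Fin K} {st : List (Fin K)} (hj : w j = [b])
    (h : Predicts w s₁ s₂ c i (j :: st)) : Predicts w s₁ s₂ c (i + 1) st ∧ c i = b := by
  obtain ⟨h₁, h₂, h₃⟩ := h
  simp only [List.flatMap_cons, hj, List.singleton_append, List.length_cons] at h₁ h₂ h₃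
  refine ⟨⟨fun n hn => ?_, by omega, ?_⟩, ?_⟩
  · simpa [add_assoc, add_comm 1 n] using h₁ (n + 1) (by omega)
  · rwa [add_assoc, add_comm 1]
  · simpa using (h₁ 0 (by omega)).symm

theorem Predicts.start (hc : IsLasso (w s₁) (w s₂) c) : Predicts w s₁ s₂ c 0 [s₁] := by
  refine ⟨fun n hn => ?_, by simp, by simp⟩
  simp only [List.flatMap_cons, List.flatMap_nil, List.append_nil] at hn ⊢
  rw [(hc n).1 hn, zero_add]

/-- On an empty stack the number of letters read exceeds the preperiod by a multiple of the period,
so a fresh copy of the period is the correct continuation. -/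
theorem Predicts.refill (hc : IsLasso (w s₁) (w s₂) c) (h : Predicts w s₁ s₂ c i []) :
    Predicts w s₁ s₂ c i [s₂] := by
  obtain ⟨-, h₂, h₃⟩ := h
  simp only [List.flatMap_nil, List.length_nil, add_zero] at h₂ h₃
  refine ⟨fun n hn => ?_, ?_, ?_⟩
  · simp only [List.flatMap_cons, List.flatMap_nil, List.append_nil] at hn ⊢
    have := (hc (i + n)).2 (by omega)
    rwa [show i + n - (w s₁).length = (i - (w s₁).length) + n by omega, Nat.add_mod, h₃, zero_add,
      Nat.mod_mod, Nat.mod_eq_of_lt hn] at this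
  · omega
  · simp only [List.flatMap_cons, List.flatMap_nil, List.append_nil]
    rw [show i + (w s₂).length - (w s₁).length = (i - (w s₁).length) + (w s₂).length by omega,
      Nat.add_mod_right, h₃]

/-- Expanding a nonterminal does not change the word spelled by the stack, removing a terminal
shifts it by one bit, and at the bottom it is refilled. The third alternative of the invariant keeps
a terminal 1 on top during the visit of the final state. -/
theorem RunInv.move (hg : Generates g w) (hc : IsLasso (w s₁) (w s₂) c)
    {x y : Fin 3 × List (Fin (K + 1))} {σ : Option Unit} (h : RunInv g w s₁ s₂ c i x)
    (hm : (ofGrammar g s₁ s₂).Move x σ y) :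
    RunInv g w s₁ s₂ c (i + σ.toList.length) y := by
  have hne : ∀ j : Fin K, Fin.last K ≠ j.castSucc := fun j => (Fin.castSucc_ne_last j).symm
  have hstack : ∀ {j : Fin K} {s' : List (Fin (K + 1))} {st : List (Fin K)},
      stack st = j.castSucc :: s' → ∃ st', st = j :: st' ∧ s' = stack st' := by
    intro j s' st h
    rcases st with _ | ⟨j', st'⟩
    · simp [stack, hne] at h
    · simp only [stack, List.map_cons, List.cons_append, List.cons.injEq] at h
      exact ⟨st', by rw [Fin.castSucc_injective _ h.1], h.2.symm⟩
  have hstack' : ∀ {s' : List (Fin (K + 1))} {st : List (Fin K)},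
      stack st = Fin.last K :: s' → st = [] ∧ s' = [] := by
    intro s' st h
    rcases st with _ | ⟨j', st'⟩
    · simpa [stack] using h
    · simp [stack, Fin.castSucc_ne_last] at h
  obtain ⟨y₁, y₂⟩ := y
  obtain ⟨-, -, γ, s, ht, hs⟩ := hm
  simp only at ht hs
  have hs' : ∃ s', x.2 = γ :: s' ∧ y₂ = s ++ s' := by
    rcases hs with ⟨-, h⟩ | ⟨rfl, rfl, -, -⟩
    · exact h
    · rcases mem_transList.1 ht with ⟨-, -, -, -, h⟩ | ⟨-, -, -, -, h⟩ | ⟨j, h, -⟩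
      · simp at h
      · simp at h
      · exact (hne j h).elim
  obtain ⟨s', hx, rfl⟩ := hs'
  rcases mem_transList.1 ht with ⟨e, rfl, rfl, rfl, rfl⟩ | ⟨e, rfl, rfl, rfl, rfl⟩ | ⟨j, rfl, h'⟩
  · rcases h with ⟨rfl, rfl⟩ | ⟨st, rfl, hp⟩ | ⟨j, st, rfl, hj, hp⟩
    · obtain ⟨-, rfl⟩ := hstack' hx
      exact Or.inr (Or.inl ⟨[s₁], rfl, Predicts.start hc⟩)
    · simp at e
    · simp at e
  · rcases h with ⟨rfl, rfl⟩ | ⟨st, rfl, hp⟩ | ⟨j, st, rfl, hj, hp⟩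
    · simp at e
    · obtain ⟨rfl, rfl⟩ := hstack' hx
      exact Or.inr (Or.inl ⟨[s₂], rfl, hp.refill hc⟩)
    · simp at e
  · rcases h with ⟨rfl, rfl⟩ | ⟨st, rfl, hp⟩ | ⟨j, st, rfl, hj, hp⟩
    · rcases h' with ⟨-, e, -⟩ | ⟨-, e, -⟩ | ⟨-, e, -⟩ | ⟨a, b, -, e, -⟩ <;> simp at e
    · obtain ⟨st', rfl, rfl⟩ := hstack hx
      rcases h' with ⟨e, -, rfl, rfl, rfl⟩ | ⟨e, -, rfl, rfl, rfl⟩ | ⟨-, e, -⟩ |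
        ⟨a, b, e, -, rfl, rfl, rfl⟩
      · exact Or.inr (Or.inl ⟨st', rfl, (hp.tail ((hg j).1 _ e)).1⟩)
      · exact Or.inr (Or.inr ⟨j, st', rfl, e, hp⟩)
      · simp at e
      · exact Or.inr (Or.inl ⟨a :: b :: st', rfl, hp.congr (by simp [(hg j).2 a b e])⟩)
    · obtain ⟨st', hst, rfl⟩ := hstack hx
      obtain ⟨rfl, rfl⟩ := List.cons.inj hst
      rcases h' with ⟨-, e, -⟩ | ⟨-, e, -⟩ | ⟨e, -, rfl, rfl, rfl⟩ | ⟨a, b, -, e, -⟩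
      · simp at e
      · simp at e
      · exact Or.inr (Or.inl ⟨st, rfl, (hp.tail ((hg _).1 _ e)).1⟩)
      · simp at e

theorem RunInv.reaches (hg : Generates g w) (hc : IsLasso (w s₁) (w s₂) c)
    {x y : Fin 3 × List (Fin (K + 1))} {u : List Unit} (hr : (ofGrammar g s₁ s₂).Reaches x u y) :
    ∀ {i}, RunInv g w s₁ s₂ c i x → RunInv g w s₁ s₂ c (i + u.length) y := by
  induction hr with
  | refl x => exact fun h => h
  | head hm _ ih =>
    intro i h
    rw [List.length_append, ← add_assoc]
    exact ih (h.move hg hc hm)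

/-- The leftmost expansion ends: since the right factor is nonempty, the left factor generates a
strictly shorter word. -/
theorem exists_reaches_terminal (hg : Generates g w) (hw : ∀ j, w j ≠ []) (n : ℕ) :
    ∀ (j : Fin K) (st : List (Fin K)), (w j).length = n → ∃ j' st' b, g j' = .inl b ∧
      (ofGrammar g s₁ s₂).Reaches (1, stack (j :: st)) [] (1, stack (j' :: st')) := by
  induction n using Nat.strong_induction_on with
  | _ n ih =>
    intro j st hn
    rcases e : g j with b | ⟨a, b⟩
    · exact ⟨j, st, b, e, .refl _⟩
    · have h₁ := (hg j).2 a b e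
      have h₂ : 0 < (w b).length := List.length_pos_iff.2 (hw b)
      have h₃ := congrArg List.length h₁
      rw [List.length_append] at h₃
      obtain ⟨j', st', b', e', hr⟩ := ih _ (by omega) a (b :: st) rfl
      refine ⟨j', st', b', e', ?_⟩
      exact (Move.reaches (move_nonterminal (s := [a, b]) (mem_transList.2
        (Or.inr (Or.inr ⟨j, rfl, Or.inr (Or.inr (Or.inr ⟨a, b, e, rfl, rfl, rfl, rfl⟩))⟩))))).trans hr

theorem exists_reaches_terminal' (hg : Generates g w) (hw : ∀ j, w j ≠ []) (st : List (Fin K)) :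
    ∃ j' st' b, g j' = .inl b ∧
      (ofGrammar g s₁ s₂).Reaches (1, stack st) [] (1, stack (j' :: st')) := by
  rcases st with _ | ⟨j, st⟩
  · obtain ⟨j', st', b, e, h⟩ := exists_reaches_terminal (s₁ := s₁) (s₂ := s₂) hg hw _ s₂ [] rfl
    exact ⟨j', st', b, e, (Move.reaches (move_bot (mem_transList.2
      (Or.inr (Or.inl ⟨rfl, rfl, rfl, rfl, rfl⟩))))).trans h⟩
  · exact exists_reaches_terminal hg hw _ j st rfl

/-- Progress: after any number of letters the automaton can bring a terminal to the top and read one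
letter more. -/
theorem exists_reaches (hg : Generates g w) (hw : ∀ j, w j ≠ []) (i : ℕ) :
    ∃ j st b, g j = .inl b ∧ (ofGrammar g s₁ s₂).Reaches (0, stack []) (List.replicate i ())
      (1, stack (j :: st)) := by
  induction i with
  | zero =>
    obtain ⟨j', st', b, e, h⟩ := exists_reaches_terminal' (s₁ := s₁) (s₂ := s₂) hg hw [s₁]
    exact ⟨j', st', b, e, (Move.reaches (move_bot (mem_transList.2
      (Or.inl ⟨rfl, rfl, rfl, rfl, rfl⟩)))).trans h⟩
  | succ i ih =>
    obtain ⟨j, st, b, e, h⟩ := ih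
    obtain ⟨j', st', b', e', h'⟩ := exists_reaches_terminal' (s₁ := s₁) (s₂ := s₂) hg hw st
    refine ⟨j', st', b', e', ?_⟩
    have hpop : (ofGrammar g s₁ s₂).Reaches (1, stack (j :: st)) [()] (1, stack st) := by
      cases b
      · exact Move.reaches (move_nonterminal (s := []) (mem_transList.2
          (Or.inr (Or.inr ⟨j, rfl, Or.inl ⟨e, rfl, rfl, rfl, rfl⟩⟩))))
      · exact (Move.reaches (move_nonterminal (s := [j]) (q' := 2) (mem_transList.2
          (Or.inr (Or.inr ⟨j, rfl, Or.inr (Or.inl ⟨e, rfl, rfl, rfl, rfl⟩)⟩))))).trans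
          (Move.reaches (move_nonterminal (s := []) (mem_transList.2
          (Or.inr (Or.inr ⟨j, rfl, Or.inr (Or.inr (Or.inl ⟨e, rfl, rfl, rfl, rfl⟩))⟩)))))
    rw [List.replicate_succ']
    simpa using (h.trans hpop).trans h'

/-- The final state is entered only with a terminal 1 on top, which by the invariant is bit `i` of
the sequence. Conversely, if bit `i` is 1, then a run that has read `i` letters and exposes a
terminal exposes a 1, and a silent move reaches the final state. -/
theorem ofGrammar_lang (hg : Generates g w) (hw : ∀ j, w j ≠ []) {L : Language Unit}
    (hL : IsLasso (w s₁) (w s₂) (charSeq L)) : (ofGrammar g s₁ s₂).lang = L := by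
  ext u
  obtain ⟨i, rfl⟩ : ∃ i, u = List.replicate i () := ⟨u.length, by simp [List.eq_replicate_iff]⟩
  have h0 : RunInv g w s₁ s₂ (charSeq L) 0 (0, stack []) := Or.inl ⟨rfl, rfl⟩
  have hi : List.replicate i () ∈ L ↔ charSeq L i = true := by simp [charSeq]
  rw [hi]
  constructor
  · rintro ⟨q, s, rfl, hr⟩
    have h := RunInv.reaches hg hL hr h0
    rw [List.length_replicate, zero_add] at h
    rcases h with ⟨h, -⟩ | ⟨st, h, -⟩ | ⟨j, st, -, e, hp⟩
    · simp at h
    · simp at h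
    · exact (hp.tail ((hg j).1 _ e)).2
  · intro h
    obtain ⟨j, st, b, e, hr⟩ := exists_reaches (s₁ := s₁) (s₂ := s₂) hg hw i
    have hinv := RunInv.reaches hg hL hr h0
    rw [List.length_replicate, zero_add] at hinv
    rcases hinv with ⟨h, -⟩ | ⟨st', hst, hp⟩ | ⟨j, st, h, -⟩
    · simp at h
    · have : j :: st = st' := (Fin.castSucc_injective K).list_map
        (List.append_cancel_right (Prod.mk.inj hst).2)
      subst this
      -- The exposed terminal is the predicted bit `charSeq L i`.
      obtain rfl : true = b := by rw [← h, (hp.tail ((hg j).1 _ e)).2]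
      refine ⟨2, stack (j :: st), rfl, ?_⟩
      have hr' := hr.trans (Move.reaches (move_nonterminal (s := [j]) (q' := 2) (st := st)
        (mem_transList.2 (Or.inr (Or.inr ⟨j, rfl, Or.inr (Or.inl ⟨e, rfl, rfl, rfl, rfl⟩)⟩)))))
      rwa [Option.toList_none, List.append_nil] at hr'
    · simp at h

end UPDA

/-! ### Codes of straight-line programs -/

namespace SLP

variable {α Δ : Type*}

theorem IsCNF.exists_rhs {P : SLP α Δ} (h : P.IsCNF) : ∃ f : Δ → α ⊕ (Δ × Δ),
    ∀ N, (∀ b, f N = .inl b → P.prod N = [.inl b]) ∧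
      ∀ A B, f N = .inr (A, B) → P.prod N = [.inr A, .inr B] := by
  have : ∀ N, ∃ z : α ⊕ (Δ × Δ), (∀ b, z = .inl b → P.prod N = [.inl b]) ∧
      ∀ A B, z = .inr (A, B) → P.prod N = [.inr A, .inr B] := by
    intro N
    rcases h N with ⟨a, ha⟩ | ⟨A, B, hAB⟩
    · exact ⟨.inl a, by simpa using ha, by simp⟩
    · refine ⟨.inr (A, B), by simp, ?_⟩
      rintro A' B' e
      obtain ⟨rfl, rfl⟩ := Prod.mk.inj (Sum.inr.inj e)
      exact hAB
  choose f hf using this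
  exact ⟨f, hf⟩

theorem val_terminal [Finite Δ] {P : SLP α Δ} {N : Δ} {b : α} (h : P.prod N = [.inl b]) :
    P.val N = [b] := by
  rw [val_eq, h]; rfl

theorem val_pair [Finite Δ] {P : SLP α Δ} {N A B : Δ} (h : P.prod N = [.inr A, .inr B]) :
    P.val N = P.val A ++ P.val B := by
  rw [val_eq, h]; simp

theorem IsCNF.val_ne_nil [Finite Δ] {P : SLP α Δ} (h : P.IsCNF) (N : Δ) : P.val N ≠ [] := by
  induction N using P.wf.induction with
  | _ N ih =>
    rcases h N with ⟨a, ha⟩ | ⟨A, B, hAB⟩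
    · simp [val_terminal ha]
    · simp [val_pair hAB, ih A (Relation.TransGen.single (by simp [hAB]))]

theorem IsCNF.exists_isCode [Finite Δ] {P : SLP Bool Δ} (h : P.IsCNF) : ∃ x, P.IsCode x := by
  obtain ⟨f, hf⟩ := h.exists_rhs
  obtain ⟨n, ⟨e⟩⟩ := Finite.exists_equiv_fin Δ
  refine ⟨_, h, n, e, fun j => match f (e.symm j) with
    | .inl b => (0, b.toNat)
    | .inr (A, B) => ((e A : ℕ) + 1, (e B : ℕ) + 1), ?_, ?_, rfl⟩
  · intro N b hN
    rcases hN' : f N with b' | ⟨A, B⟩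
    · have := (hf N).1 _ hN'
      rw [hN] at this
      simp_all
    · have := (hf N).2 _ _ hN'
      rw [hN] at this
      simp_all
  · intro N A B hN
    rcases hN' : f N with b' | ⟨A', B'⟩
    · have := (hf N).1 _ hN'
      rw [hN] at this
      simp_all
    · have := (hf N).2 _ _ hN'
      rw [hN] at this
      simp_all

end SLP

/-- The numbers of a list of pairs, one after the other. -/
def flattenPairs (l : List (ℕ × ℕ)) : List ℕ := l.flatMap fun z => [z.1, z.2]

theorem length_flattenPairs (l : List (ℕ × ℕ)) : (flattenPairs l).length = 2 * l.length := by
  induction l with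
  | nil => rfl
  | cons a l ih => simp only [flattenPairs, List.flatMap_cons] at *; simp [ih]; omega

theorem getElem?_flattenPairs (l : List (ℕ × ℕ)) (j : ℕ) :
    (flattenPairs l)[2 * j]? = l[j]?.map Prod.fst ∧
      (flattenPairs l)[2 * j + 1]? = l[j]?.map Prod.snd := by
  induction l generalizing j with
  | nil => simp [flattenPairs]
  | cons a l ih =>
    rcases j with _ | j
    · simp [flattenPairs]
    · obtain ⟨h₁, h₂⟩ := ih j
      simp only [flattenPairs, List.flatMap_cons] at *
      rw [show 2 * (j + 1) = 2 * j + 1 + 1 by ring]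
      exact ⟨by simpa using h₁, by simpa using h₂⟩

/-- The code of the transitions of `UPDA.ofGrammar` for a nonterminal with number `j` and a
production that is described by `a` and `b`. -/
def ruleCode (j a b : ℕ) : List ℕ :=
  if a ≠ 0 then [1, 0, j, 1, a, b]
  else if b ≠ 0 then [1, 0, j, 2, j + 1, 0, 2, 1, j, 1, 0, 0]
  else [1, 1, j, 1, 0, 0]

/-- The code of `UPDA.ofGrammar`. -/
def grammarCode (n₁ n₂ s₁ s₂ : ℕ) (r₁ r₂ : ℕ → ℕ × ℕ) : List ℕ :=
  [3, n₁ + n₂ + 1, 0, 0, 0, 1] ++ List.replicate (n₁ + n₂) 0 ++ [1] ++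
    [0, 0, n₁ + n₂, 1, s₁ + 1, n₁ + n₂ + 1, 1, 0, n₁ + n₂, 1, s₂ + n₁ + 1, n₁ + n₂ + 1] ++
    (List.range n₁).flatMap (fun j => ruleCode j (r₁ j).1 (r₁ j).2) ++
    (List.range n₂).flatMap (fun j => if (r₂ j).1 ≠ 0 then
      ruleCode (n₁ + j) ((r₂ j).1 + n₁) ((r₂ j).2 + n₁) else ruleCode (n₁ + j) 0 (r₂ j).2)

theorem List.flatMap_finRange {α : Type*} (n : ℕ) (f : ℕ → List α) :
    (List.finRange n).flatMap (fun j : Fin n => f j) = (List.range n).flatMap f := by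
  rw [← List.map_coe_finRange_eq_range, List.flatMap_map]

theorem List.ofFn_eq_replicate_append {α : Type*} {n : ℕ} {f : Fin (n + 1) → α} {a b : α}
    (h : ∀ j : Fin n, f j.castSucc = a) (h' : f (Fin.last n) = b) :
    List.ofFn f = List.replicate n a ++ [b] := by
  rw [List.ofFn_succ']
  simp [h, h']

theorem List.ofFn_fin_three {α : Type*} (f : Fin 3 → α) : List.ofFn f = [f 0, f 1, f 2] := rfl

open UPDA in
theorem transCode_rules {K : ℕ} {g : Fin K → Bool ⊕ (Fin K × Fin K)} {j : Fin K} {a b : ℕ}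
    (h₁ : ∀ c, g j = .inl c → a = 0 ∧ b = c.toNat)
    (h₂ : ∀ A B, g j = .inr (A, B) → a = A + 1 ∧ b = B + 1) :
    (rules g j).flatMap (transCode (Equiv.refl _) (Equiv.refl _)) = ruleCode j a b := by
  unfold rules ruleCode
  rcases h : g j with (_ | _) | ⟨A, B⟩
  · obtain ⟨rfl, rfl⟩ := h₁ _ h
    simp [transCode]
  · obtain ⟨rfl, rfl⟩ := h₁ _ h
    simp [transCode]
  · obtain ⟨rfl, rfl⟩ := h₂ _ _ h
    simp [transCode]

open UPDA in
-- In the joint numbering the nonterminals of the second program come after the `n₁` of the first.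
-- Their table entries are shifted by `n₁`, except for terminals, which are marked by a first entry
-- 0.
theorem ofGrammar_isCode {n₁ n₂ : ℕ} {g : Fin (n₁ + n₂) → Bool ⊕ (Fin (n₁ + n₂) × Fin (n₁ + n₂))}
    {s₁ : Fin n₁} {s₂ : Fin n₂} {r₁ r₂ : ℕ → ℕ × ℕ}
    (h₁ : ∀ (j : Fin n₁) c, g (j.castAdd n₂) = .inl c → r₁ j = (0, c.toNat))
    (h₁' : ∀ (j : Fin n₁) A B, g (j.castAdd n₂) = .inr (A, B) → r₁ j = ((A : ℕ) + 1, (B : ℕ) + 1))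
    (h₂ : ∀ (j : Fin n₂) c, g (j.natAdd n₁) = .inl c → r₂ j = (0, c.toNat))
    (h₂' : ∀ (j : Fin n₂) A B, g (j.natAdd n₁) = .inr (A, B) →
      (r₂ j).1 ≠ 0 ∧ (r₂ j).1 + n₁ = A + 1 ∧ (r₂ j).2 + n₁ = B + 1) :
    (ofGrammar g (s₁.castAdd n₂) (s₂.natAdd n₁)).IsCode (grammarCode n₁ n₂ s₁ s₂ r₁ r₂) := by
  refine ⟨ofGrammar_isShort, 3, n₁ + n₂ + 1, Equiv.refl _, Equiv.refl _,
    transList g (s₁.castAdd n₂) (s₂.natAdd n₁), fun t => Iff.rfl, ?_⟩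
  have hrules : ((List.finRange (n₁ + n₂)).flatMap (rules g)).flatMap
      (transCode (Equiv.refl _) (Equiv.refl _)) =
      (List.range n₁).flatMap (fun j => ruleCode j (r₁ j).1 (r₁ j).2) ++
      (List.range n₂).flatMap (fun j => if (r₂ j).1 ≠ 0 then
      ruleCode (n₁ + j) ((r₂ j).1 + n₁) ((r₂ j).2 + n₁) else ruleCode (n₁ + j) 0 (r₂ j).2) := by
    rw [List.flatMap_assoc]
    -- One code function for the joint numbering, so that the range splits at `n₁` afterwards.
    set F : ℕ → List ℕ := fun j => if j < n₁ then ruleCode j (r₁ j).1 (r₁ j).2 else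
      if (r₂ (j - n₁)).1 ≠ 0 then
        ruleCode j ((r₂ (j - n₁)).1 + n₁) ((r₂ (j - n₁)).2 + n₁) else
        ruleCode j 0 (r₂ (j - n₁)).2 with hF
    have : ∀ j : Fin (n₁ + n₂), (rules g j).flatMap (transCode (Equiv.refl _) (Equiv.refl _)) =
        F j := by
      intro j
      refine Fin.addCases (fun i => ?_) (fun i => ?_) j
      · rw [transCode_rules (a := (r₁ i).1) (b := (r₁ i).2) (fun c hc => by simp [h₁ i c hc])
          (fun A B hAB => by simp [h₁' i A B hAB])]
        simp [hF]
      · by_cases hi : (r₂ i).1 = 0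
        · rw [transCode_rules (a := 0) (b := (r₂ i).2) (fun c hc => by simp [h₂ i c hc])
            (fun A B hAB => absurd hi (h₂' i A B hAB).1)]
          simp [hF, hi]
        · rw [transCode_rules (a := (r₂ i).1 + n₁) (b := (r₂ i).2 + n₁)
            (fun c hc => absurd (by simp [h₂ i c hc]) hi) (fun A B hAB => (h₂' i A B hAB).2)]
          simp [hF, hi]
    simp only [this]
    rw [List.flatMap_finRange, List.range_add, List.flatMap_append, List.flatMap_map]
    congr 1
    · refine List.flatMap_congr fun j hj => ?_
      simp [hF, List.mem_range.1 hj]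
    · simp [hF]
  rw [List.ofFn_eq_replicate_append (n := n₁ + n₂) (a := 0) (b := 1)
    (fun j => by simp [ofGrammar, Fin.castSucc_ne_last]) (by simp [ofGrammar]), List.ofFn_fin_three,
    grammarCode, transList, List.flatMap_cons, List.flatMap_cons, hrules]
  simp [transCode, ofGrammar, add_comm]

/-! ### The translation from indicator pairs to automata in logarithmic space -/

namespace RAM

/-- A sum that is at most the number of input cells. -/
def Exp.cadd {V : Type} (e f : Exp V) : Exp V := .sub .len (.sub (.sub .len e) f)

/-- Subtracting twice from the input length and then once more yields the sum without any
intermediate value above the input length; this is how a frugal program adds. -/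
theorem Exp.eval_cadd {V : Type} {x : List ℕ} {σ : Store V} {e f : Exp V}
    (h : e.eval x σ + f.eval x σ ≤ x.length) :
    (e.cadd f).eval x σ = e.eval x σ + f.eval x σ := by
  simp only [cadd, eval]; omega

/-- Write the values of several expressions. -/
def Cmd.writes {V : Type} : List (Exp V) → Cmd V
  | [] => .skip
  | e :: l => .seq (.write e) (writes l)

theorem Cmd.run_writes {V : Type} {x : List ℕ} {σ : Store V} (l : List (Exp V)) :
    (Cmd.writes l).run x σ = { σ with o := σ.o ++ l.map (Exp.eval x σ) } := by
  induction l generalizing σ with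
  | nil => simp [writes, run]
  | cons e l ih =>
    have : ∀ (e f : Exp V), f.eval x { σ with o := σ.o ++ [e.eval x σ] } = f.eval x σ := by
      intro e f
      induction f <;> simp_all [Exp.eval]
    simp only [writes, run, ih, List.map_cons, List.append_assoc, List.singleton_append,
      funext (this e)]

/-- Do `p` for `c = 0, …, b - 1`, provided that `b` is at most the input length. -/
def Cmd.cupto {V : Type} (c : V) (b : Exp V) (p : Cmd V) : Cmd V :=
  .seq (.assign c (.const 0)) (.rep (.guarded c b (.cadd (.var c) (.const 1)) p))

/-- The analogue of `Cmd.upto_spec` for frugal programs: the counter is increased by a clamped sum,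
and a single repetition suffices because the bounds are at most linear. -/
theorem Cmd.cupto_spec {V : Type} {x : List ℕ} {c : V} {b : Exp V} {p : Cmd V}
    (I : ℕ → Store V → Prop) {N : ℕ} (hN : N ≤ x.length)
    (hb : ∀ i σ, I i σ → σ.v c = i → b.eval x σ = N)
    (hp : ∀ i σ, i < N → I i σ → σ.v c = i → (p.run x σ).v c = i ∧
      I (i + 1) ((Cmd.assign c (.cadd (.var c) (.const 1))).run x (p.run x σ)))
    {σ : Store V} (h0 : I 0 ((Cmd.assign c (.const 0)).run x σ)) :
    I N ((Cmd.cupto c b p).run x σ) := by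
  have := (Cmd.guarded_iterate (x := x) (c := c) (b := b) (next := .cadd (.var c) (.const 1))
    (p := p) (I := I) hb (fun i σ hi h hv => ?_) h0 (by simp [Cmd.run, Exp.eval]) x.length).1
  · rwa [min_eq_right hN] at this
  · obtain ⟨h1, h2⟩ := hp i σ hi h hv
    refine ⟨h2, ?_⟩
    simp only [run, Function.update_self]
    rw [Exp.eval_cadd (by simp only [Exp.eval, h1]; omega)]
    simp [Exp.eval, h1]

namespace FromPair

/-- The variables of `prog`. -/
inductive Var
  | n | s | n' | s' | p | c | a | b

open Var

instance : Finite Var := by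
  refine Finite.of_surjective (![n, s, n', s', p, c, a, b] : Fin 8 → Var) fun v => ?_
  cases v
  exacts [⟨0, rfl⟩, ⟨1, rfl⟩, ⟨2, rfl⟩, ⟨3, rfl⟩, ⟨4, rfl⟩, ⟨5, rfl⟩, ⟨6, rfl⟩, ⟨7, rfl⟩]

/-- Write the transitions for the nonterminal with number `j`. -/
def emit (j : Exp Var) : Cmd Var :=
  .ite (.var a) (.writes [.const 1, .const 0, j, .const 1, .var a, .var b])
    (.ite (.var b) (.writes [.const 1, .const 0, j, .const 2, j.cadd (.const 1), .const 0,
      .const 2, .const 1, j, .const 1, .const 0, .const 0])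
      (.writes [.const 1, .const 1, j, .const 1, .const 0, .const 0]))

/-- The number of nonterminals. -/
def total : Exp Var := .cadd (.var n) (.var n')

/-- Read the header. -/
def header : Cmd Var :=
  .seq (.assign n (.inp (.const 0))) <| .seq (.assign s (.inp (.const 1))) <|
  .seq (.assign p (.cadd (.const 2) (.cadd (.var n) (.var n)))) <|
  .seq (.assign n' (.inp (.var p))) (.assign s' (.inp (.cadd (.var p) (.const 1))))

/-- The rules for a nonterminal of the first program. -/
def rule₁ : Cmd Var :=
  .seq (.assign a (.inp (.var p))) <| .seq (.assign b (.inp (.cadd (.var p) (.const 1)))) <|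
  .seq (emit (.var c)) (.assign p (.cadd (.var p) (.const 2)))

/-- The rules for a nonterminal of the second program. -/
def rule₂ : Cmd Var :=
  .seq (.assign a (.inp (.var p))) <| .seq (.assign b (.inp (.cadd (.var p) (.const 1)))) <|
  .seq (.ite (.var a) (.seq (.assign a (.cadd (.var a) (.var n)))
    (.assign b (.cadd (.var b) (.var n)))) .skip) <|
  .seq (emit (.cadd (.var n) (.var c))) (.assign p (.cadd (.var p) (.const 2)))

/-- The rules for the first program. -/
def rules₁ : Cmd Var := .seq (.assign p (.const 2)) (.cupto c (.var n) rule₁)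

/-- The rules for the second program. -/
def rules₂ : Cmd Var := .seq (.assign p (.cadd (.var p) (.const 2))) (.cupto c (.var n') rule₂)

/-- The beginning of the output. -/
def preamble : List (Exp Var) :=
  [.const 3, total.cadd (.const 1), .const 0, .const 0, .const 0, .const 1]

/-- The transitions for the bottom of the stack, after the last bit of the table for `⊥`. -/
def bottomRules : List (Exp Var) :=
  [.const 1, .const 0, .const 0, total, .const 1, .cadd (.var s) (.const 1), total.cadd (.const 1),
    .const 1, .const 0, total, .const 1, .cadd (.cadd (.var s') (.var n)) (.const 1),
    total.cadd (.const 1)]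

/-- From a description of an indicator pair compute a description of an automaton. -/
def prog : Cmd Var :=
  .seq header <| .seq (.writes preamble) <| .seq (.cupto c total (.write (.const 0))) <|
  .seq (.writes bottomRules) <| .seq rules₁ rules₂

/-- The largest constant is 3, the number of states. An input has at least 4 cells, so the condition
on `C` in `Cmd.Frugal.exists_log_space` will hold. -/
theorem prog_frugal : prog.Frugal 3 := by
  simp [prog, header, preamble, bottomRules, rules₁, rules₂, rule₁, rule₂, emit, total, Cmd.writes, Cmd.cupto, Cmd.guarded, Cmd.Frugal,
    Exp.cadd, Exp.Frugal]

theorem run_emit {x : List ℕ} {σ : Store Var} {j : Exp Var} (h : j.eval x σ + 1 ≤ x.length) :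
    (emit j).run x σ = { σ with o := σ.o ++ ruleCode (j.eval x σ) (σ.v a) (σ.v b) } := by
  have h' : (j.cadd (.const 1)).eval x σ = j.eval x σ + 1 := Exp.eval_cadd h
  by_cases ha : σ.v a = 0
  · by_cases hb : σ.v b = 0
    · simp [emit, Cmd.run, Cmd.run_writes, Exp.eval, ha, hb, ruleCode]
    · simp [emit, Cmd.run, Cmd.run_writes, Exp.eval, ha, hb, ruleCode, h']
  · simp [emit, Cmd.run, Cmd.run_writes, Exp.eval, ha, ruleCode]

variable {n₁ n₂ s₁ s₂ : ℕ} {r₁ r₂ : ℕ → ℕ × ℕ} {x : List ℕ}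

/-- The input `x` has the given entries. -/
structure Input (n₁ n₂ s₁ s₂ : ℕ) (r₁ r₂ : ℕ → ℕ × ℕ) (x : List ℕ) : Prop where
  length : x.length = 4 + 2 * n₁ + 2 * n₂
  count₁ : x.getD 0 0 = n₁
  start₁ : x.getD 1 0 = s₁
  fst₁ : ∀ j < n₁, x.getD (2 + 2 * j) 0 = (r₁ j).1
  snd₁ : ∀ j < n₁, x.getD (2 + 2 * j + 1) 0 = (r₁ j).2
  count₂ : x.getD (2 + 2 * n₁) 0 = n₂
  start₂ : x.getD (2 + 2 * n₁ + 1) 0 = s₂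
  fst₂ : ∀ j < n₂, x.getD (2 + 2 * n₁ + 2 + 2 * j) 0 = (r₂ j).1
  snd₂ : ∀ j < n₂, x.getD (2 + 2 * n₁ + 2 + 2 * j + 1) 0 = (r₂ j).2
  start_lt₁ : s₁ < n₁
  start_lt₂ : s₂ < n₂
  le₂ : ∀ j < n₂, (r₂ j).1 ≤ n₂ ∧ (r₂ j).2 ≤ n₂

/-- The header has been read, and `y` has been written. -/
structure Ready (n₁ n₂ s₁ s₂ : ℕ) (y : List ℕ) (σ : Store Var) : Prop where
  n : σ.v n = n₁
  s : σ.v s = s₁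
  n' : σ.v n' = n₂
  s' : σ.v s' = s₂
  o : σ.o = y

theorem Ready.eval_total (hx : x.length = 4 + 2 * n₁ + 2 * n₂) {y : List ℕ} {σ : Store Var}
    (h : Ready n₁ n₂ s₁ s₂ y σ) : total.eval x σ = n₁ + n₂ ∧
      (total.cadd (.const 1)).eval x σ = n₁ + n₂ + 1 := by
  have h₁ : total.eval x σ = n₁ + n₂ := by
    rw [total, Exp.eval_cadd (by simp only [Exp.eval, h.n, h.n']; omega)]
    simp [Exp.eval, h.n, h.n']
  refine ⟨h₁, ?_⟩
  rw [Exp.eval_cadd (by simp only [Exp.eval, h₁]; omega), h₁]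
  rfl

theorem run_header (hx : Input n₁ n₂ s₁ s₂ r₁ r₂ x) :
    Ready n₁ n₂ s₁ s₂ [] (header.run x Store.init) := by
  have hl := hx.length
  have h₁ := hx.count₂
  have h₂ := hx.start₂
  -- The nested clamped sum evaluates to the position `2 + 2 * n₁` at which the second program
  -- begins.
  have e₁ : x.length - (x.length - 2 - (x.length - (x.length - n₁ - n₁))) = 2 + 2 * n₁ := by omega
  have e₂ : x.length - (x.length - (2 + 2 * n₁) - 1) = 2 + 2 * n₁ + 1 := by omega
  constructor <;>
  simp only [header, Cmd.run, Exp.eval, Store.init, Exp.cadd, hx.count₁, hx.start₁, ne_eq,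
    reduceCtorEq, not_false_eq_true, Function.update_self, Function.update_of_ne, e₁, e₂, h₁, h₂]

theorem Ready.writes {y : List ℕ} {σ : Store Var} (h : Ready n₁ n₂ s₁ s₂ y σ)
    (l : List (Exp Var)) :
    Ready n₁ n₂ s₁ s₂ (y ++ l.map (Exp.eval x σ)) ((Cmd.writes l).run x σ) := by
  rw [Cmd.run_writes]
  exact ⟨h.n, h.s, h.n', h.s', by rw [h.o]⟩

theorem Ready.zeros (hx : x.length = 4 + 2 * n₁ + 2 * n₂) {y : List ℕ} {σ : Store Var}
    (h : Ready n₁ n₂ s₁ s₂ y σ) : Ready n₁ n₂ s₁ s₂ (y ++ List.replicate (n₁ + n₂) 0)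
      ((Cmd.cupto c total (.write (.const 0))).run x σ) := by
  refine Cmd.cupto_spec (fun i σ => Ready n₁ n₂ s₁ s₂ (y ++ List.replicate i 0) σ)
    (by omega) (fun i σ h _ => (h.eval_total hx).1)
    (fun i σ hi h hc => ⟨by simpa [Cmd.run] using hc, ?_⟩) ?_
  · constructor <;> simp [Cmd.run, Exp.eval, h.n, h.n', h.s, h.s', h.o, List.replicate_succ']
  · constructor <;> simp [Cmd.run, h.n, h.n', h.s, h.s', h.o]

theorem Ready.rules₁ (hx : Input n₁ n₂ s₁ s₂ r₁ r₂ x) {y : List ℕ} {σ : Store Var}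
    (h : Ready n₁ n₂ s₁ s₂ y σ) : Ready n₁ n₂ s₁ s₂
      (y ++ (List.range n₁).flatMap (fun j => ruleCode j (r₁ j).1 (r₁ j).2)) (rules₁.run x σ) ∧
      (rules₁.run x σ).v p = 2 + 2 * n₁ := by
  have hl := hx.length
  refine Cmd.cupto_spec (c := c) (x := x) (b := .var Var.n) (p := rule₁)
    (σ := (Cmd.assign p (.const 2)).run x σ) (fun i σ => Ready n₁ n₂ s₁ s₂
    (y ++ (List.range i).flatMap (fun j => ruleCode j (r₁ j).1 (r₁ j).2)) σ ∧ σ.v p = 2 + 2 * i)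
    (by omega) (fun i σ h _ => h.1.n) (fun i σ hi h hc => ?_) ?_
  · obtain ⟨h, hp⟩ := h
    have e₁ : x.length - (x.length - (2 + 2 * i) - 1) = 2 + 2 * i + 1 := by omega
    have e₂ : x.length - (x.length - (2 + 2 * i) - 2) = 2 + 2 * (i + 1) := by omega
    have f₁ := hx.fst₁ i hi
    have f₂ := hx.snd₁ i hi
    simp only [rule₁, Cmd.run, Exp.eval, hp, f₁, Exp.cadd, Function.update_self, ne_eq, reduceCtorEq,
      not_false_eq_true, Function.update_of_ne, e₁, f₂]
    rw [run_emit (by simp [Exp.eval, hc]; omega)]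
    refine ⟨by simp [hc], ⟨?_, ?_, ?_, ?_, ?_⟩, ?_⟩
    · simp [h.n]
    · simp [h.s]
    · simp [h.n']
    · simp [h.s']
    · simp [h.o, Exp.eval, hc, List.range_succ]
    · simp [hp, e₂]
  · refine ⟨⟨?_, ?_, ?_, ?_, ?_⟩, ?_⟩ <;> simp [Cmd.run, Exp.eval, h.n, h.n', h.s, h.s', h.o]

theorem Ready.rules₂ (hx : Input n₁ n₂ s₁ s₂ r₁ r₂ x) {y : List ℕ} {σ : Store Var}
    (h : Ready n₁ n₂ s₁ s₂ y σ) (hp : σ.v p = 2 + 2 * n₁) : Ready n₁ n₂ s₁ s₂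
      (y ++ (List.range n₂).flatMap (fun j => if (r₂ j).1 ≠ 0 then
        ruleCode (n₁ + j) ((r₂ j).1 + n₁) ((r₂ j).2 + n₁) else ruleCode (n₁ + j) 0 (r₂ j).2))
      (rules₂.run x σ) := by
  have hl := hx.length
  refine (Cmd.cupto_spec (c := c) (x := x) (b := .var Var.n') (p := rule₂)
    (σ := (Cmd.assign p (.cadd (.var p) (.const 2))).run x σ) (fun i σ => Ready n₁ n₂ s₁ s₂
    (y ++ (List.range i).flatMap (fun j => if (r₂ j).1 ≠ 0 then
        ruleCode (n₁ + j) ((r₂ j).1 + n₁) ((r₂ j).2 + n₁) else ruleCode (n₁ + j) 0 (r₂ j).2)) σ ∧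
      σ.v p = 2 + 2 * n₁ + 2 + 2 * i)
    (by omega) (fun i σ h _ => h.1.n') (fun i σ hi h hc => ?_) ?_).1
  · obtain ⟨h, hp⟩ := h
    have e₁ : x.length - (x.length - (2 + 2 * n₁ + 2 + 2 * i) - 1) = 2 + 2 * n₁ + 2 + 2 * i + 1 := by
      omega
    have e₂ : x.length - (x.length - (2 + 2 * n₁ + 2 + 2 * i) - 2) =
      2 + 2 * n₁ + 2 + 2 * (i + 1) := by omega
    have f₁ := hx.fst₂ i hi
    have f₂ := hx.snd₂ i hi
    have f₃ := hx.le₂ i hi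
    have e₃ : x.length - (x.length - (r₂ i).1 - n₁) = (r₂ i).1 + n₁ := by omega
    have e₄ : x.length - (x.length - (r₂ i).2 - n₁) = (r₂ i).2 + n₁ := by omega
    have e₅ : x.length - (x.length - n₁ - i) = n₁ + i := by omega
    simp only [rule₂, Cmd.run, Exp.eval, hp, f₁, Exp.cadd, Function.update_self, ne_eq, reduceCtorEq,
      not_false_eq_true, Function.update_of_ne, e₁, f₂]
    by_cases hr : (r₂ i).1 = 0
    · simp only [hr, not_true_eq_false, if_false]
      rw [run_emit (by simp [Exp.eval, hc, h.n]; omega)]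
      refine ⟨by simp [hc], ⟨?_, ?_, ?_, ?_, ?_⟩, ?_⟩
      · simp [h.n]
      · simp [h.s]
      · simp [h.n']
      · simp [h.s']
      · simp [h.o, Exp.eval, hc, List.range_succ, h.n, hr, e₅]
      · simp [hp, e₂]
    · simp only [hr, not_false_eq_true, if_true]
      rw [run_emit (by simp [Exp.eval, hc, h.n]; omega)]
      refine ⟨by simp [hc], ⟨?_, ?_, ?_, ?_, ?_⟩, ?_⟩
      · simp [h.n]
      · simp [h.s]
      · simp [h.n']
      · simp [h.s']
      · simp [h.o, Exp.eval, hc, List.range_succ, h.n, hr, e₃, e₄, e₅]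
      · simp [hp, e₂]
  · have e₁ : x.length - (x.length - (2 + 2 * n₁) - 2) = 2 + 2 * n₁ + 2 := by omega
    refine ⟨⟨?_, ?_, ?_, ?_, ?_⟩, ?_⟩ <;>
      simp [Cmd.run, Exp.eval, h.n, h.n', h.s, h.s', h.o, Exp.cadd, hp, e₁]

theorem Ready.preamble (hx : x.length = 4 + 2 * n₁ + 2 * n₂) {y : List ℕ} {σ : Store Var}
    (h : Ready n₁ n₂ s₁ s₂ y σ) :
    Ready n₁ n₂ s₁ s₂ (y ++ [3, n₁ + n₂ + 1, 0, 0, 0, 1]) ((Cmd.writes preamble).run x σ) := by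
  convert h.writes FromPair.preamble using 2
  simp only [FromPair.preamble, List.map_cons, List.map_nil, (h.eval_total hx).2, Exp.eval]

theorem Ready.bottomRules (hx : x.length = 4 + 2 * n₁ + 2 * n₂) (hs₁ : s₁ < n₁) (hs₂ : s₂ < n₂)
    {y : List ℕ} {σ : Store Var} (h : Ready n₁ n₂ s₁ s₂ y σ) :
    Ready n₁ n₂ s₁ s₂ (y ++ [1, 0, 0, n₁ + n₂, 1, s₁ + 1, n₁ + n₂ + 1, 1, 0, n₁ + n₂, 1,
      s₂ + n₁ + 1, n₁ + n₂ + 1]) ((Cmd.writes bottomRules).run x σ) := by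
  convert h.writes FromPair.bottomRules using 2
  have e₁ : x.length - (x.length - s₁ - 1) = s₁ + 1 := by omega
  have e₂ : x.length - (x.length - (x.length - (x.length - s₂ - n₁)) - 1) = s₂ + n₁ + 1 := by omega
  simp only [FromPair.bottomRules, List.map_cons, List.map_nil, (h.eval_total hx).1,
    (h.eval_total hx).2]
  simp only [Exp.eval, Exp.cadd, h.s, h.s', h.n, e₁, e₂]

theorem run_prog (hx : Input n₁ n₂ s₁ s₂ r₁ r₂ x) :
    (prog.run x Store.init).o = grammarCode n₁ n₂ s₁ s₂ r₁ r₂ := by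
  have h := (((run_header hx).preamble hx.length).zeros hx.length).bottomRules hx.length
    hx.start_lt₁ hx.start_lt₂
  have h' := h.rules₁ hx
  refine (h'.1.rules₂ hx h'.2).o.trans ?_
  simp [grammarCode]

/-- A number in the table of productions. -/
def tableOf {n : ℕ} (r : Fin n → ℕ × ℕ) (j : ℕ) : ℕ × ℕ := if h : j < n then r ⟨j, h⟩ else 0

theorem input_of_codes {n₁ n₂ : ℕ} {r₁ : Fin n₁ → ℕ × ℕ} {r₂ : Fin n₂ → ℕ × ℕ} {s₁ : Fin n₁}
    {s₂ : Fin n₂} (h : ∀ j, (r₂ j).1 ≤ n₂ ∧ (r₂ j).2 ≤ n₂) :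
    Input n₁ n₂ s₁ s₂ (tableOf r₁) (tableOf r₂) (([n₁, (s₁ : ℕ)] ++ flattenPairs (List.ofFn r₁)) ++
      ([n₂, (s₂ : ℕ)] ++ flattenPairs (List.ofFn r₂))) := by
  have l₁ : (flattenPairs (List.ofFn r₁)).length = 2 * n₁ := by simp [length_flattenPairs]
  have l₂ : (flattenPairs (List.ofFn r₂)).length = 2 * n₂ := by simp [length_flattenPairs]
  have g₁ := getElem?_flattenPairs (List.ofFn r₁)
  have g₂ := getElem?_flattenPairs (List.ofFn r₂)
  have o₁ : ∀ j < n₁, (List.ofFn r₁)[j]? = some (tableOf r₁ j) := fun j hj => by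
    simp [tableOf, hj]
  have o₂ : ∀ j < n₂, (List.ofFn r₂)[j]? = some (tableOf r₂ j) := fun j hj => by
    simp [tableOf, hj]
  simp only [List.cons_append, List.nil_append]
  generalize flattenPairs (List.ofFn r₁) = f₁ at *
  generalize flattenPairs (List.ofFn r₂) = f₂ at *
  have left : ∀ i < 2 * n₁, (n₁ :: (s₁ : ℕ) :: (f₁ ++ n₂ :: (s₂ : ℕ) :: f₂)).getD (2 + i) 0 =
      f₁[i]?.getD 0 := by
    intro i hi
    rw [show 2 + i = i + 1 + 1 by ring, List.getD_eq_getElem?_getD]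
    simp [List.getElem?_append_left (l₁.symm ▸ hi)]
  have right : ∀ i, (n₁ :: (s₁ : ℕ) :: (f₁ ++ n₂ :: (s₂ : ℕ) :: f₂)).getD (2 + 2 * n₁ + i) 0 =
      (n₂ :: (s₂ : ℕ) :: f₂)[i]?.getD 0 := by
    intro i
    rw [show 2 + 2 * n₁ + i = (2 * n₁ + i) + 1 + 1 by ring, List.getD_eq_getElem?_getD]
    rw [List.getElem?_cons_succ, List.getElem?_cons_succ,
      List.getElem?_append_right (by omega), l₁, Nat.add_sub_cancel_left]
  constructor
  · simp [l₁, l₂]; ring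
  · rfl
  · rfl
  · intro j hj
    rw [left _ (by omega), (g₁ j).1, o₁ j hj]; rfl
  · intro j hj
    rw [add_assoc, left _ (by omega), (g₁ j).2, o₁ j hj]; rfl
  · exact right 0
  · exact right 1
  · intro j hj
    rw [add_assoc, right, show 2 + 2 * j = 2 * j + 1 + 1 by ring, List.getElem?_cons_succ,
      List.getElem?_cons_succ, (g₂ j).1, o₂ j hj]; rfl
  · intro j hj
    rw [add_assoc, add_assoc, right, show 2 + (2 * j + 1) = 2 * j + 1 + 1 + 1 by ring,
      List.getElem?_cons_succ, List.getElem?_cons_succ, (g₂ j).2, o₂ j hj]; rfl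
  · exact s₁.2
  · exact s₂.2
  · intro j hj
    simpa [tableOf, hj] using h ⟨j, hj⟩

end FromPair

end RAM

/-- Entries bounded by the number of nonterminals are bounded by the number of cells, as the
logarithmic space bound requires. For a terminal 1 the bound holds because there is at least one
nonterminal. -/
theorem SLP.IsCNF.table_le {Δ : Type*} {P : SLP Bool Δ} (h : P.IsCNF) {n : ℕ} {e : Δ ≃ Fin n}
    {r : Fin n → ℕ × ℕ} (h₁ : ∀ N b, P.prod N = [Sum.inl b] → r (e N) = (0, b.toNat))
    (h₂ : ∀ N A B, P.prod N = [Sum.inr A, Sum.inr B] → r (e N) = ((e A : ℕ) + 1, (e B : ℕ) + 1))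
    (j : Fin n) : (r j).1 ≤ n ∧ (r j).2 ≤ n := by
  obtain ⟨N, rfl⟩ := e.surjective j
  rcases h N with ⟨b, hb⟩ | ⟨A, B, hAB⟩
  · rw [h₁ N b hb]
    exact ⟨Nat.zero_le _, b.toNat_le.trans (Fin.pos (e N))⟩
  · rw [h₂ N A B hAB]
    exact ⟨(e A).2, (e B).2⟩

theorem mem_flattenPairs_ofFn_le {n N : ℕ} {r : Fin n → ℕ × ℕ}
    (h : ∀ j, (r j).1 ≤ N ∧ (r j).2 ≤ N) : ∀ v ∈ flattenPairs (List.ofFn r), v ≤ N := by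
  intro v hv
  simp only [flattenPairs, List.mem_flatMap, List.mem_ofFn, List.mem_cons, List.not_mem_nil,
    or_false] at hv
  obtain ⟨_, ⟨j, rfl⟩, rfl | rfl⟩ := hv
  exacts [(h j).1, (h j).2]

/-! ### Two programs over a common set of nonterminals, and the logarithmic-space translation -/

section Grammar

variable {Δ₁ Δ₂ : Type*} {n₁ n₂ : ℕ}

/-- The right-hand sides of two programs over a common set of numbered nonterminals. -/
def joinRhs (f₁ : Δ₁ → Bool ⊕ (Δ₁ × Δ₁)) (f₂ : Δ₂ → Bool ⊕ (Δ₂ × Δ₂)) (e₁ : Δ₁ ≃ Fin n₁)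
    (e₂ : Δ₂ ≃ Fin n₂) : Fin (n₁ + n₂) → Bool ⊕ (Fin (n₁ + n₂) × Fin (n₁ + n₂)) :=
  Fin.addCases
    (fun i => (f₁ (e₁.symm i)).map id
      (Prod.map (fun N => (e₁ N).castAdd n₂) fun N => (e₁ N).castAdd n₂))
    (fun i => (f₂ (e₂.symm i)).map id
      (Prod.map (fun N => (e₂ N).natAdd n₁) fun N => (e₂ N).natAdd n₁))

/-- The words generated by two programs over a common set of numbered nonterminals. -/
noncomputable def joinVal [Finite Δ₁] [Finite Δ₂] (P₁ : SLP Bool Δ₁) (P₂ : SLP Bool Δ₂)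
    (e₁ : Δ₁ ≃ Fin n₁) (e₂ : Δ₂ ≃ Fin n₂) : Fin (n₁ + n₂) → List Bool :=
  Fin.addCases (fun i => P₁.val (e₁.symm i)) (fun i => P₂.val (e₂.symm i))

variable {P₁ : SLP Bool Δ₁} {P₂ : SLP Bool Δ₂} {f₁ : Δ₁ → Bool ⊕ (Δ₁ × Δ₁)}
  {f₂ : Δ₂ → Bool ⊕ (Δ₂ × Δ₂)} {e₁ : Δ₁ ≃ Fin n₁} {e₂ : Δ₂ ≃ Fin n₂}

theorem generates_joinRhs [Finite Δ₁] [Finite Δ₂]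
    (h₁ : ∀ N, (∀ b, f₁ N = .inl b → P₁.prod N = [.inl b]) ∧
      ∀ A B, f₁ N = .inr (A, B) → P₁.prod N = [.inr A, .inr B])
    (h₂ : ∀ N, (∀ b, f₂ N = .inl b → P₂.prod N = [.inl b]) ∧
      ∀ A B, f₂ N = .inr (A, B) → P₂.prod N = [.inr A, .inr B]) :
    UPDA.Generates (joinRhs f₁ f₂ e₁ e₂) (joinVal P₁ P₂ e₁ e₂) := by
  intro j
  refine Fin.addCases (fun i => ?_) (fun i => ?_) j
  · rcases h : f₁ (e₁.symm i) with b | ⟨A, B⟩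
    · simp [joinRhs, joinVal, h, SLP.val_terminal ((h₁ _).1 b h)]
    · simp [joinRhs, joinVal, h, SLP.val_pair ((h₁ _).2 A B h)]
  · rcases h : f₂ (e₂.symm i) with b | ⟨A, B⟩
    · simp [joinRhs, joinVal, h, SLP.val_terminal ((h₂ _).1 b h)]
    · simp [joinRhs, joinVal, h, SLP.val_pair ((h₂ _).2 A B h)]

theorem exists_logspace_translation :
    ∃ (C : ℕ) (p : RAM.Prog) (T : Polynomial ℕ) (c : ℕ),
      ∀ (Δ₁ Δ₂ : Type) [Finite Δ₁] [Finite Δ₂] (P₁ : SLP Bool Δ₁) (P₂ : SLP Bool Δ₂)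
        (L : Language Unit) (m : ℕ) (x : List ℕ),
        PairHasSize P₁ P₂ m → IsIndicatorPair P₁ P₂ L → IsPairCode P₁ P₂ x →
        ∃ m' ≤ C * m, ∃ (n k : ℕ) (A : UPDA (Fin n) (Fin k)) (y : List ℕ),
          A.Deterministic ∧ A.HasSize m' ∧ A.lang = L ∧ A.IsCode y ∧
          RAM.OutputsWithin p x y (T.eval (RAM.inputLength x))
            (c * (RAM.inputLength x).size) := by
  obtain ⟨p, T, c, hp⟩ := RAM.FromPair.prog_frugal.exists_log_space (by norm_num)
  -- The automaton has size `3 * (m + 1)`, and `m` is positive because both programs have a start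
  -- symbol.
  refine ⟨6, p, T, c, ?_⟩
  rintro Δ₁ Δ₂ _ _ P₁ P₂ L m x ⟨_, _, ⟨hP₁, rfl⟩, ⟨hP₂, rfl⟩, rfl⟩ hL
    ⟨_, _, ⟨-, n₁, e₁, r₁, a₁, b₁, rfl⟩, ⟨-, n₂, e₂, r₂, a₂, b₂, rfl⟩, hx⟩
  obtain ⟨f₁, hf₁⟩ := hP₁.exists_rhs
  obtain ⟨f₂, hf₂⟩ := hP₂.exists_rhs
  have c₁ : Nat.card Δ₁ = n₁ := by simp [Nat.card_congr e₁]
  have c₂ : Nat.card Δ₂ = n₂ := by simp [Nat.card_congr e₂]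
  have t₁ := hP₁.table_le a₁ b₁
  have t₂ := hP₂.table_le a₂ b₂
  have hin := RAM.FromPair.input_of_codes (r₁ := r₁) (s₁ := e₁ P₁.start) (s₂ := e₂ P₂.start) t₂
  replace hx : x = ([n₁, (e₁ P₁.start : ℕ)] ++ flattenPairs (List.ofFn r₁)) ++
      ([n₂, (e₂ P₂.start : ℕ)] ++ flattenPairs (List.ofFn r₂)) := hx
  rw [← hx] at hin
  have hl := hin.length
  have l₁ := hin.start_lt₁
  have l₂ := hin.start_lt₂
  have hle : ∀ v ∈ x, v ≤ x.length := by
    intro v hv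
    rw [hx] at hv
    simp only [List.mem_append, List.mem_cons, List.not_mem_nil, or_false] at hv
    rcases hv with ((rfl | rfl) | hv) | ((rfl | rfl) | hv)
    · omega
    · omega
    · have := mem_flattenPairs_ofFn_le t₁ v hv
      omega
    · omega
    · omega
    · have := mem_flattenPairs_ofFn_le t₂ v hv
      omega
  have hrun := hp x (by omega) hle
  rw [RAM.FromPair.run_prog hin] at hrun
  refine ⟨3 * (n₁ + n₂ + 1), by omega, 3, n₁ + n₂ + 1,
    UPDA.ofGrammar (joinRhs f₁ f₂ e₁ e₂) ((e₁ P₁.start).castAdd n₂) ((e₂ P₂.start).natAdd n₁), _,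
    UPDA.ofGrammar_deterministic, ⟨UPDA.ofGrammar_isShort, by simp⟩,
    UPDA.ofGrammar_lang (generates_joinRhs hf₁ hf₂) (fun j => ?_) ?_,
    ofGrammar_isCode ?_ ?_ ?_ ?_, hrun⟩
  · refine Fin.addCases (fun i => ?_) (fun i => ?_) j
    · simpa [joinVal] using hP₁.val_ne_nil _
    · simpa [joinVal] using hP₂.val_ne_nil _
  · simpa [joinVal, IsIndicatorPair, SLP.str] using hL
  · intro j b hj
    rcases h : f₁ (e₁.symm j) with b' | ⟨A, B⟩ <;> simp [joinRhs, h] at hj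
    subst hj
    simpa [RAM.FromPair.tableOf] using a₁ _ _ ((hf₁ _).1 _ h)
  · intro j A B hj
    rcases h : f₁ (e₁.symm j) with b' | ⟨A', B'⟩ <;> simp [joinRhs, h] at hj
    obtain ⟨rfl, rfl⟩ := hj
    simpa [RAM.FromPair.tableOf] using b₁ _ _ _ ((hf₁ _).2 _ _ h)
  · intro j b hj
    rcases h : f₂ (e₂.symm j) with b' | ⟨A, B⟩ <;> simp [joinRhs, h] at hj
    subst hj
    simpa [RAM.FromPair.tableOf] using a₂ _ _ ((hf₂ _).1 _ h)
  · intro j A B hj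
    rcases h : f₂ (e₂.symm j) with b' | ⟨A', B'⟩ <;> simp [joinRhs, h] at hj
    obtain ⟨rfl, rfl⟩ := hj
    have := b₂ _ _ _ ((hf₂ _).2 _ _ h)
    rw [Equiv.apply_symm_apply] at this
    simp [RAM.FromPair.tableOf, this]
    omega

end Grammar

/-! ## From automata to indicator pairs -/

/-- The set of positions of `true` in the sequence that starts with `w` and continues with `f`. -/
def prep (w : List Bool) (f : ℕ → Prop) (t : ℕ) : Prop :=
  if t < w.length then w[t]? = some true else f (t - w.length)

@[simp] theorem prep_nil (f : ℕ → Prop) : prep [] f = f := by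
  funext t; simp [prep]

theorem prep_append (u v : List Bool) (f : ℕ → Prop) : prep (u ++ v) f = prep u (prep v f) := by
  funext t
  unfold prep
  by_cases h : t < u.length
  · rw [if_pos h, if_pos (by simp; omega), List.getElem?_append_left h]
  · by_cases h' : t - u.length < v.length
    · rw [if_neg h, if_pos h', if_pos (by simp; omega), List.getElem?_append_right (by omega)]
    · rw [if_neg h, if_neg h', if_neg (by simp; omega), List.length_append, Nat.sub_add_eq]

theorem prep_mono {w : List Bool} {f g : ℕ → Prop} (h : ∀ t, f t → g t) {t : ℕ}
    (ht : prep w f t) : prep w g t := by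
  unfold prep at *
  split_ifs at * with hw
  exacts [ht, h _ ht]

theorem prep_congr {w : List Bool} {f g : ℕ → Prop} (h : ∀ t, f t ↔ g t) {t : ℕ} :
    prep w f t ↔ prep w g t := ⟨prep_mono fun t => (h t).1, prep_mono fun t => (h t).2⟩

theorem prep_add {w : List Bool} {f : ℕ → Prop} {t : ℕ} : prep w f (w.length + t) ↔ f t := by
  simp [prep]

/-- A sequence of bits is determined by the positions of `true` once the words supply a bit at every
position; this needs `v ≠ []`. -/
theorem isLasso_of_prep {u v : List Bool} {c : ℕ → Bool} {f : ℕ → Prop} (hv : v ≠ [])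
    (hc : ∀ t, c t = true ↔ prep u f t) (hf : ∀ t, f t ↔ v[t % v.length]? = some true) :
    IsLasso u v c := by
  have aux : ∀ {l : List Bool} {i : ℕ} {b : Bool}, i < l.length →
      (b = true ↔ l[i]? = some true) → l[i]? = some b := by
    intro l i b hi h
    rw [List.getElem?_eq_getElem hi] at *
    cases b <;> cases h' : l[i] <;> simp_all
  intro i
  have h := hc i
  unfold prep at h
  constructor
  · intro hi
    rw [if_pos hi] at h
    exact aux hi h
  · intro hi
    rw [if_neg (not_lt.2 hi), hf] at h
    exact aux (Nat.mod_lt _ (List.length_pos_iff.2 hv)) h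

/-- The transition tables of a machine with a stack.  The configurations of the machine are pairs
of a node and a list of symbols, where a node is a number `(k + 1) * c + g` that combines a control
state `c ≤ 2 * n` and a symbol `g ≤ k`.  At a node with `g = k` the symbol `g` is removed and
the next symbol of the list takes its place.  At another node `i` the machine moves to the state
with number `base i / (k + 1)`, replaces the symbol by `push₁ i` and `push₂ i`, and produces a
sequence of bits, which is encoded by `emit i`. -/
structure Tables where
  n : ℕ
  k : ℕ
  emit : ℕ → ℕ
  base : ℕ → ℕ
  push₁ : ℕ → ℕ
  push₂ : ℕ → ℕ

namespace Tables

variable (T : Tables)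

/-- The number of nodes. -/
def size : ℕ := (2 * T.n + 1) * (T.k + 1)

/-- The node belongs to a state that promises the bit `true`. -/
def Flag (i : ℕ) : Prop := T.n ≤ i / (T.k + 1) ∧ i / (T.k + 1) < 2 * T.n

/-- The sequence of bits that is encoded by a number. -/
def bits : ℕ → List Bool
  | 0 => []
  | 1 => [false]
  | _ => [true]

/-- The positions of `true` in the output within a number of steps. -/
def stream : ℕ → ℕ → List ℕ → ℕ → Prop
  | 0, i, _, t => T.Flag i ∧ t = 0
  | N + 1, i, rest, t =>
    if i % (T.k + 1) = T.k then
      match rest with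
      | [] => stream N i [] t
      | g :: r => stream N (i - T.k + g) r t
    else prep (bits (T.emit i)) (stream N (T.base i + T.push₁ i) (T.push₂ i :: rest)) t

/-- The positions of `true` in the output. -/
def Output (i : ℕ) (rest : List ℕ) (t : ℕ) : Prop := ∃ N, T.stream N i rest t

/-- In `d` steps the machine gets from one configuration to another one, and produces `w`. -/
def YieldsIn (d i : ℕ) (rest : List ℕ) (w : List Bool) (i' : ℕ) (rest' : List ℕ) : Prop :=
  ∀ N t, T.stream (N + d) i rest t ↔ prep w (T.stream N i' rest') t

/-- The entries of the tables are in the right ranges, promises are kept, and the symbol `bot` is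
never removed. -/
structure Valid (bot : ℕ) : Prop where
  emit_le : ∀ i < T.size, i % (T.k + 1) ≠ T.k → T.emit i ≤ 2
  base_dvd : ∀ i < T.size, i % (T.k + 1) ≠ T.k → ∃ c ≤ 2 * T.n, T.base i = (T.k + 1) * c
  push₁_le : ∀ i < T.size, i % (T.k + 1) ≠ T.k → T.push₁ i ≤ T.k
  push₂_le : ∀ i < T.size, i % (T.k + 1) ≠ T.k → T.push₂ i ≤ T.k
  flag : ∀ i < T.size, i % (T.k + 1) ≠ T.k → T.Flag i →
    (T.emit i = 0 ∧ T.Flag (T.base i + T.push₁ i)) ∨ T.emit i = 2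
  push₂_bot : ∀ i < T.size, i % (T.k + 1) = bot → T.push₂ i = bot
  bot_lt : bot < T.k

variable {T}

theorem node_div {c g : ℕ} (hg : g ≤ T.k) : ((T.k + 1) * c + g) / (T.k + 1) = c := by
  rw [Nat.mul_add_div (Nat.succ_pos _), Nat.div_eq_of_lt (by omega), add_zero]

theorem node_mod {c g : ℕ} (hg : g ≤ T.k) : ((T.k + 1) * c + g) % (T.k + 1) = g := by
  rw [Nat.mul_add_mod, Nat.mod_eq_of_lt (by omega)]

theorem node_lt {c g : ℕ} (hc : c ≤ 2 * T.n) (hg : g ≤ T.k) : (T.k + 1) * c + g < T.size := by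
  unfold size
  nlinarith

theorem exists_node {i : ℕ} (hi : i < T.size) :
    ∃ c ≤ 2 * T.n, ∃ g ≤ T.k, i = (T.k + 1) * c + g := by
  refine ⟨i / (T.k + 1), ?_, i % (T.k + 1), ?_, (Nat.div_add_mod _ _).symm⟩
  · exact Nat.lt_succ_iff.1 ((Nat.div_lt_iff_lt_mul (Nat.succ_pos _)).2 hi)
  · exact Nat.lt_succ_iff.1 (Nat.mod_lt _ (Nat.succ_pos _))

theorem flag_node {c g : ℕ} (hg : g ≤ T.k) :
    T.Flag ((T.k + 1) * c + g) ↔ T.n ≤ c ∧ c < 2 * T.n := by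
  rw [Flag, node_div hg]

theorem Valid.next_lt {bot : ℕ} (h : T.Valid bot) {i : ℕ} (hi : i < T.size)
    (hk : i % (T.k + 1) ≠ T.k) : T.base i + T.push₁ i < T.size := by
  obtain ⟨c, hc, e⟩ := h.base_dvd i hi hk
  rw [e]
  exact node_lt hc (h.push₁_le i hi hk)

theorem stream_add_one (N i : ℕ) (rest : List ℕ) (t : ℕ) : T.stream (N + 1) i rest t =
    if i % (T.k + 1) = T.k then
      match rest with
      | [] => T.stream N i [] t
      | g :: r => T.stream N (i - T.k + g) r t
    else prep (bits (T.emit i)) (T.stream N (T.base i + T.push₁ i) (T.push₂ i :: rest)) t := rfl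

theorem stream_step {i : ℕ} (hk : i % (T.k + 1) ≠ T.k) (rest : List ℕ) :
    T.YieldsIn 1 i rest (bits (T.emit i)) (T.base i + T.push₁ i) (T.push₂ i :: rest) := by
  intro N t
  rw [stream_add_one, if_neg hk]

theorem stream_pop {c : ℕ} (g : ℕ) (rest : List ℕ) :
    T.YieldsIn 1 ((T.k + 1) * c + T.k) (g :: rest) [] ((T.k + 1) * c + g) rest := by
  intro N t
  rw [stream_add_one, if_pos (node_mod le_rfl), prep_nil, Nat.add_sub_cancel]

theorem YieldsIn.trans {d d' i i' i'' : ℕ} {r r' r'' : List ℕ} {w w' : List Bool}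
    (h : T.YieldsIn d i r w i' r') (h' : T.YieldsIn d' i' r' w' i'' r'') :
    T.YieldsIn (d' + d) i r (w ++ w') i'' r'' := by
  intro N t
  rw [prep_append, ← add_assoc, h]
  exact prep_congr fun t => h' N t

theorem YieldsIn.output {d i i' : ℕ} {r r' : List ℕ} {w : List Bool}
    (h : T.YieldsIn d i r w i' r') {t : ℕ} (ht : T.Output i' r' t) :
    T.Output i r (w.length + t) := by
  obtain ⟨N, hN⟩ := ht
  exact ⟨N + d, (h N _).2 (prep_add.2 hN)⟩

section Valid

variable {bot : ℕ} (hT : T.Valid bot)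

include hT

/-- A larger number of steps reveals more of the output. The point is the case of 0 steps, where a
flagged node counts its promised `true` as output: by `Valid.flag` the next step either outputs that
bit or hands the promise on. -/
theorem Valid.stream_succ (N : ℕ) : ∀ {i : ℕ} {rest : List ℕ} {t : ℕ}, i < T.size →
    (∀ g ∈ rest, g ≤ T.k) → T.stream N i rest t → T.stream (N + 1) i rest t := by
  induction N with
  | zero =>
    rintro i rest t hi hr ⟨hf, rfl⟩
    by_cases hk : i % (T.k + 1) = T.k
    · rw [stream_add_one, if_pos hk]
      rcases rest with _ | ⟨g, r⟩
      · exact ⟨hf, rfl⟩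
      · refine ⟨?_, rfl⟩
        obtain ⟨c, hc, g', hg', rfl⟩ := exists_node hi
        rw [node_mod hg'] at hk
        subst hk
        rw [flag_node hg'] at hf
        simp only [Nat.add_sub_cancel]
        rwa [flag_node (hr g (by simp))]
    · rw [stream_add_one, if_neg hk]
      rcases hT.flag i hi hk hf with ⟨h, h'⟩ | h
      · rw [h]
        simpa [bits] using ⟨h', rfl⟩
      · rw [h]
        simp [bits, prep]
  | succ N ih =>
    intro i rest t hi hr h
    by_cases hk : i % (T.k + 1) = T.k
    · rw [stream_add_one, if_pos hk] at h ⊢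
      rcases rest with _ | ⟨g, r⟩
      · exact ih hi hr h
      · obtain ⟨c, hc, g', hg', rfl⟩ := exists_node hi
        rw [node_mod hg'] at hk
        subst hk
        simp only [Nat.add_sub_cancel] at h ⊢
        exact ih (node_lt hc (hr g (by simp))) (fun x hx => hr x (by simp [hx])) h
    · rw [stream_add_one, if_neg hk] at h ⊢
      refine prep_mono (fun t ht => ih (hT.next_lt hi hk) ?_ ht) h
      intro g hg
      rcases List.mem_cons.1 hg with rfl | hg
      exacts [hT.push₂_le i hi hk, hr g hg]

theorem Valid.stream_mono {N N' i : ℕ} {rest : List ℕ} {t : ℕ} (hN : N ≤ N') (hi : i < T.size)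
    (hr : ∀ g ∈ rest, g ≤ T.k) (h : T.stream N i rest t) : T.stream N' i rest t := by
  induction hN with
  | refl => exact h
  | step _ ih => exact hT.stream_succ _ hi hr ih

/-- Monotonicity in the number of steps turns the exact count in `YieldsIn` into a statement about
the whole output. -/
theorem Valid.output_iff {d i i' : ℕ} {r r' : List ℕ} {w : List Bool}
    (h : T.YieldsIn d i r w i' r') (hi : i < T.size) (hr : ∀ g ∈ r, g ≤ T.k) {t : ℕ} :
    T.Output i r t ↔ prep w (T.Output i' r') t := by
  constructor
  · rintro ⟨N, hN⟩
    exact prep_mono (fun t ht => ⟨N, ht⟩)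
      ((h N t).1 (hT.stream_mono (Nat.le_add_right N d) hi hr hN))
  · intro ht
    by_cases hw : t < w.length
    · exact ⟨0 + d, (h 0 t).2 (by simpa [prep, hw] using ht)⟩
    · rw [prep, if_neg hw] at ht
      obtain ⟨N, hN⟩ := ht
      exact ⟨N + d, (h N t).2 (by rwa [prep, if_neg hw])⟩

end Valid

/-- From the node `i` the machine eventually removes the symbol, reaches the state with number
`c` and produces `w`. -/
def Pops (T : Tables) (i : ℕ) (w : List Bool) (b : ℕ) : Prop :=
  ∀ g rest, ∃ d, T.YieldsIn d i (g :: rest) w (b + g) rest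

theorem pops_idle (c : ℕ) : T.Pops ((T.k + 1) * c + T.k) [] ((T.k + 1) * c) :=
  fun g rest => ⟨1, stream_pop g rest⟩

/-- Stack discipline: the first pushed symbol must disappear before the second comes to the top, and
the removal of the second amounts to the removal of the original symbol. -/
theorem Pops.step {i b b' : ℕ} {w w' : List Bool} (hk : i % (T.k + 1) ≠ T.k)
    (h : T.Pops (T.base i + T.push₁ i) w b) (h' : T.Pops (b + T.push₂ i) w' b') :
    T.Pops i (bits (T.emit i) ++ (w ++ w')) b' := by
  intro g rest
  obtain ⟨d, hd⟩ := h (T.push₂ i) (g :: rest)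
  obtain ⟨d', hd'⟩ := h' g rest
  exact ⟨_, (stream_step hk _).trans (hd.trans hd')⟩

/-- Whatever the list below a node `i`, the machine gets from `i` to `i'` and produces `w`. -/
def Goes (T : Tables) (pos : Prop) (i : ℕ) (w : List Bool) (i' : ℕ) : Prop :=
  ∀ rest, (∀ g ∈ rest, g ≤ T.k) → ∃ rest', (∀ g ∈ rest', g ≤ T.k) ∧
    ∃ d, (pos → 0 < d) ∧ T.YieldsIn d i rest w i' rest'

theorem Goes.refl (i : ℕ) : T.Goes False i [] i :=
  fun rest hr => ⟨rest, hr, 0, False.elim, fun N t => by rw [prep_nil, Nat.add_zero]⟩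

theorem Goes.trans {p p' : Prop} {i i' i'' : ℕ} {w w' : List Bool} (h : T.Goes p i w i')
    (h' : T.Goes p' i' w' i'') : T.Goes (p ∨ p') i (w ++ w') i'' := by
  intro rest hr
  obtain ⟨r', hr', d, hd, e⟩ := h rest hr
  obtain ⟨r'', hr'', d', hd', e'⟩ := h' r' hr'
  refine ⟨r'', hr'', d' + d, ?_, e.trans e'⟩
  rintro (hp | hp)
  · have := hd hp; omega
  · have := hd' hp; omega

theorem Goes.weaken {p p' : Prop} {i i' : ℕ} {w : List Bool} (h : T.Goes p i w i')
    (hp : p' → p) : T.Goes p' i w i' := fun rest hr =>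
  (h rest hr).imp fun _ h => ⟨h.1, h.2.imp fun _ h => ⟨fun h' => h.1 (hp h'), h.2⟩⟩

/-- This way of advancing leaves the second pushed symbol below the current one; it is used when the
first pushed symbol is never removed. -/
theorem goes_step {i : ℕ} (hk : i % (T.k + 1) ≠ T.k) (hp : T.push₂ i ≤ T.k) :
    T.Goes True i (bits (T.emit i)) (T.base i + T.push₁ i) := by
  intro rest hr
  refine ⟨T.push₂ i :: rest, fun g hg => ?_, 1, by simp, stream_step hk rest⟩
  rcases List.mem_cons.1 hg with rfl | hg
  exacts [hp, hr g hg]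

/-- The other way of advancing: the first pushed symbol is removed again, and the second one becomes
the current symbol over an unchanged list. -/
theorem Pops.goes {i b : ℕ} {w : List Bool} (hk : i % (T.k + 1) ≠ T.k)
    (h : T.Pops (T.base i + T.push₁ i) w b) :
    T.Goes True i (bits (T.emit i) ++ w) (b + T.push₂ i) := by
  intro rest hr
  obtain ⟨d, hd⟩ := h (T.push₂ i) rest
  exact ⟨rest, hr, _, fun _ => Nat.succ_pos _, (stream_step hk rest).trans hd⟩

section Lasso

variable {bot : ℕ} (hT : T.Valid bot)

include hT

/-- Each turn around the cycle outputs `v` but may change the list below, so the claim is proved for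
all lists at once, by induction on the position. -/
theorem Valid.output_periodic {p : Prop} {x : ℕ} {v : List Bool} (hx : x < T.size) (hv : v ≠ [])
    (h : T.Goes p x v x) (t : ℕ) : ∀ rest : List ℕ, (∀ g ∈ rest, g ≤ T.k) →
      (T.Output x rest t ↔ v[t % v.length]? = some true) := by
  induction t using Nat.strong_induction_on with
  | _ t ih =>
    intro rest hr
    obtain ⟨r', hr', d, -, e⟩ := h rest hr
    rw [hT.output_iff e hx hr, prep]
    split_ifs with ht
    · rw [Nat.mod_eq_of_lt ht]
    · have : 0 < v.length := List.length_pos_iff.2 hv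
      rw [ih _ (by omega) r' hr', Nat.mod_eq_sub_mod (not_lt.1 ht)]

/-- A silent turn takes `d > 0` steps, so a witnessing number of steps can be decreased until it is
less than `d`; only the promise at the node can then be the source of a `true`. -/
theorem Valid.output_silent {x : ℕ} (hx : x < T.size) (h : T.Goes True x [] x) {rest : List ℕ}
    (hr : ∀ g ∈ rest, g ≤ T.k) (t : ℕ) : T.Output x rest t ↔ T.Flag x ∧ t = 0 := by
  constructor
  · rintro ⟨N, hN⟩
    induction N using Nat.strong_induction_on generalizing rest with
    | _ N ih =>
      obtain ⟨r', hr', d, hd, e⟩ := h rest hr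
      by_cases hdN : d ≤ N
      · have h₁ := (e (N - d) t).1 (by rwa [Nat.sub_add_cancel hdN])
        rw [prep_nil] at h₁
        exact ih _ (by have := hd trivial; omega) hr' h₁
      -- By monotonicity the number of steps is raised to exactly `d`, which leads back to the node
      -- with no step left.
      · have h₁ := (e 0 t).1 (hT.stream_mono (by omega) hx hr hN)
        rwa [prep_nil] at h₁
  · exact fun h => ⟨0, h⟩

open Classical in
-- The preperiod is `u ++ v` rather than `u`, because `u` may be empty and a program in Chomsky
-- normal form generates no empty word. On a silent cycle the promise supplies one last bit before
-- the zeros, which also makes the preperiod nonempty.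
theorem Valid.isLasso {p : Prop} {i x : ℕ} {u v : List Bool} {c : ℕ → Bool} (hi : i < T.size)
    (hx : x < T.size) (hu : T.Goes p i u x) (hv : T.Goes True x v x)
    (hc : ∀ t, c t = true ↔ T.Output i [] t) :
    (v ≠ [] → IsLasso (u ++ v) v c) ∧
      (v = [] → IsLasso (u ++ [decide (T.Flag x)]) [false] c) := by
  obtain ⟨r, hr, d, -, e⟩ := hu [] (by simp)
  have hc' : ∀ t, c t = true ↔ prep u (T.Output x r) t := fun t =>
    (hc t).trans (hT.output_iff e hi (by simp))
  constructor
  · intro hv'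
    have hf := fun t => hT.output_periodic hx hv' hv t
    refine isLasso_of_prep hv' (f := T.Output x r) (fun t => ?_) fun t => hf t r hr
    rw [hc', prep_append]
    refine prep_congr fun t => ?_
    rw [hf t r hr, prep]
    have hpos : 0 < v.length := List.length_pos_iff.2 hv'
    split_ifs with ht
    · rw [Nat.mod_eq_of_lt ht]
    · rw [hf _ r hr, Nat.mod_eq_sub_mod (not_lt.1 ht)]
  · rintro rfl
    refine isLasso_of_prep (by simp) (f := fun _ => False) (fun t => ?_) fun t => ?_
    · rw [hc', prep_append]
      refine prep_congr fun t => ?_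
      rw [hT.output_silent hx hv hr, prep]
      rcases t with _ | t <;> simp
    · simp [Nat.mod_one]

end Lasso

end Tables

/-! ### The tables of an automaton -/

namespace UPDA

variable {Q Γ : Type*} {n k : ℕ}

open Classical in
/-- The promise after a visit of `q`. -/
noncomputable def promise (A : UPDA Q Γ) (q : Q) (b : Bool) : Bool := b || decide (q ∈ A.final)

/-- The number of a state together with a promise. -/
def stateNum (eQ : Q ≃ Fin n) (q : Q) (b : Bool) : ℕ := eQ q + if b then n else 0

open Classical in
/-- The two symbols that are pushed when `γ` is replaced by `s`. -/
noncomputable def pushes (A : UPDA Q Γ) (eΓ : Γ ≃ Fin k) (γ : Γ) : List Γ → ℕ × ℕ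
  | [] => (k, if γ = A.bot then (eΓ γ : ℕ) else k)
  | [g] => (k, eΓ g)
  | g₁ :: g₂ :: _ => (eΓ g₁, eΓ g₂)

open Classical in
/-- The tables describe `A`. -/
structure Models (A : UPDA Q Γ) (eQ : Q ≃ Fin n) (eΓ : Γ ≃ Fin k) (T : Tables) : Prop where
  n_eq : T.n = n
  k_eq : T.k = k
  hit : ∀ q σ γ q₂ s, (q, σ, γ, q₂, s) ∈ A.trans → ∀ b i,
    i = (k + 1) * stateNum eQ q b + eΓ γ →
    (T.emit i, T.base i, T.push₁ i, T.push₂ i) =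
      ((if σ = none then 0 else 1 + (A.promise q b).toNat),
      (k + 1) * stateNum eQ q₂ (decide (σ = none) && A.promise q b), A.pushes eΓ γ s)
  miss : ∀ q γ, (∀ σ q₂ s, (q, σ, γ, q₂, s) ∉ A.trans) → ∀ b i,
    i = (k + 1) * stateNum eQ q b + eΓ γ →
    (T.emit i, T.base i, T.push₁ i, T.push₂ i) =
      (1 + (A.promise q b).toNat, (k + 1) * (2 * n), k, (eΓ γ : ℕ))
  dead : ∀ g < k, ∀ i, i = (k + 1) * (2 * n) + g →
    (T.emit i, T.base i, T.push₁ i, T.push₂ i) = (1, (k + 1) * (2 * n), k, g)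

theorem stateNum_lt (eQ : Q ≃ Fin n) (q : Q) (b : Bool) : stateNum eQ q b < 2 * n := by
  unfold stateNum
  have := (eQ q).2
  split_ifs <;> omega

theorem le_stateNum {eQ : Q ≃ Fin n} {q : Q} {b : Bool} : n ≤ stateNum eQ q b ↔ b = true := by
  unfold stateNum
  have := (eQ q).2
  cases b
  · simp
  · simp

variable {A : UPDA Q Γ} {eQ : Q ≃ Fin n} {eΓ : Γ ≃ Fin k} {T : Tables}

theorem pushes_le (γ : Γ) (s : List Γ) :
    (A.pushes eΓ γ s).1 ≤ k ∧ (A.pushes eΓ γ s).2 ≤ k := by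
  rcases s with _ | ⟨g, _ | ⟨g', s⟩⟩
  · simp only [pushes]
    split_ifs
    exacts [⟨le_rfl, (eΓ _).2.le⟩, ⟨le_rfl, le_rfl⟩]
  · exact ⟨le_rfl, (eΓ g).2.le⟩
  · exact ⟨(eΓ g).2.le, (eΓ g').2.le⟩

/-- A short transition at `⊥` writes nothing, `⊥`, or one symbol and `⊥`; in each case the second
pushed symbol is `⊥`. -/
theorem pushes_bot (hA : A.IsShort) {q σ q₂ s} (h : (q, σ, A.bot, q₂, s) ∈ A.trans) :
    (A.pushes eΓ A.bot s).2 = eΓ A.bot := by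
  rcases A.trans_bot _ _ _ _ _ h with ⟨h', -⟩ | ⟨-, rfl | ⟨u, -, rfl⟩⟩
  · exact (h' rfl).elim
  · simp [pushes]
  · have := hA _ _ _ _ _ h
    rcases u with _ | ⟨g, _ | ⟨g', u⟩⟩
    · rfl
    · rfl
    · simp at this

/-- Every node that is not idle has a row of one of three kinds: dead, without a transition, or with
one. A flagged node keeps its promise: a silent move passes it on, while a letter or the lack of a
transition outputs 2, the code of `true`. -/
theorem Models.valid (hM : A.Models eQ eΓ T) (hA : A.IsShort) : T.Valid (eΓ A.bot) := by
  have key : ∀ i < T.size, i % (T.k + 1) ≠ T.k → ∃ c ≤ 2 * n, ∃ g < k, i = (k + 1) * c + g ∧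
      (c = 2 * n ∨ ∃ q b γ, c = stateNum eQ q b ∧ g = eΓ γ) := by
    intro i hi hk
    obtain ⟨c, hc, g, hg, rfl⟩ := Tables.exists_node hi
    rw [Tables.node_mod hg] at hk
    rw [hM.k_eq] at *
    rw [hM.n_eq] at *
    refine ⟨c, hc, g, by omega, rfl, ?_⟩
    by_cases h : c = 2 * n
    · exact Or.inl h
    · right
      have hγ : g = eΓ (eΓ.symm ⟨g, by omega⟩) := by simp
      by_cases h' : c < n
      · exact ⟨eQ.symm ⟨c, h'⟩, false, _, by simp [stateNum], hγ⟩
      · exact ⟨eQ.symm ⟨c - n, by omega⟩, true, _, by simp [stateNum]; omega, hγ⟩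
  have rows : ∀ i < T.size, i % (T.k + 1) ≠ T.k → T.emit i ≤ 2 ∧
      (∃ c ≤ 2 * n, T.base i = (k + 1) * c) ∧ T.push₁ i ≤ k ∧ T.push₂ i ≤ k ∧
      (T.Flag i → (T.emit i = 0 ∧ T.Flag (T.base i + T.push₁ i)) ∨ T.emit i = 2) ∧
      (i % (T.k + 1) = eΓ A.bot → T.push₂ i = eΓ A.bot) := by
    intro i hi hk
    obtain ⟨c, hc, g, hg, hi', h⟩ := key i hi hk
    have hmod : i % (T.k + 1) = g := by
      rw [hi', ← hM.k_eq]
      exact Tables.node_mod (by rw [hM.k_eq]; omega)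
    have hflag : ∀ c' g', g' ≤ k → (T.Flag ((k + 1) * c' + g') ↔ n ≤ c' ∧ c' < 2 * n) := by
      intro c' g' hg'
      rw [← hM.k_eq] at hg' ⊢
      rw [Tables.flag_node hg', hM.n_eq]
    rcases h with rfl | ⟨q, b, γ, rfl, rfl⟩
    · have := hM.dead g hg i hi'
      simp only [Prod.mk.injEq] at this
      obtain ⟨e₁, e₂, e₃, e₄⟩ := this
      rw [hmod, e₁, e₂, e₃, e₄, hi', hflag _ _ hg.le]
      exact ⟨by omega, ⟨_, le_rfl, rfl⟩, le_rfl, hg.le, by omega, fun h => h⟩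
    · have hb := le_stateNum (eQ := eQ) (q := q) (b := b)
      by_cases hm : ∀ σ q₂ s, (q, σ, γ, q₂, s) ∉ A.trans
      · have := hM.miss q γ hm b i hi'
        simp only [Prod.mk.injEq] at this
        obtain ⟨e₁, e₂, e₃, e₄⟩ := this
        rw [hmod, e₁, e₂, e₃, e₄, hi', hflag _ _ hg.le]
        refine ⟨?_, ⟨_, le_rfl, rfl⟩, le_rfl, hg.le, ?_, fun h => h⟩
        · cases A.promise q b <;> simp
        · rw [hb]
          rintro ⟨rfl, -⟩
          simp [promise]
      · push Not at hm
        obtain ⟨σ, q₂, s, ht⟩ := hm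
        have := hM.hit q σ γ q₂ s ht b i hi'
        simp only [Prod.mk.injEq] at this
        obtain ⟨e₁, e₂, e₃⟩ := this
        have e₄ := congrArg Prod.fst e₃
        have e₅ := congrArg Prod.snd e₃
        simp only at e₄ e₅
        have hp := pushes_le (A := A) (eΓ := eΓ) γ s
        rw [hmod, e₁, e₂, e₄, e₅, hi', hflag _ _ hg.le, hflag _ _ hp.1]
        refine ⟨?_, ⟨_, (stateNum_lt _ _ _).le, rfl⟩, hp.1, hp.2, ?_, ?_⟩
        · cases A.promise q b <;> cases σ <;> simp
        · rw [hb, le_stateNum]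
          rintro ⟨rfl, -⟩
          rcases σ with _ | σ <;> simp [promise, stateNum_lt]
        · intro h
          obtain rfl : γ = A.bot := eΓ.injective (Fin.ext h)
          exact pushes_bot hA ht
  have hkb := (eΓ A.bot).2
  constructor
  · exact fun i hi hk => (rows i hi hk).1
  · rw [hM.n_eq]
    intro i hi hk
    have := (rows i hi hk).2.1
    rwa [← hM.k_eq] at this
  · intro i hi hk
    have := (rows i hi hk).2.2.1
    rwa [← hM.k_eq] at this
  · intro i hi hk
    have := (rows i hi hk).2.2.2.1
    rwa [← hM.k_eq] at this
  · exact fun i hi hk => (rows i hi hk).2.2.2.2.1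
  · intro i hi hb
    refine (rows i hi ?_).2.2.2.2.2 hb
    rw [hb, hM.k_eq]
    omega
  · rwa [hM.k_eq]

/-- The node and the list of symbols represent the configuration with state `q` and stack `st`, up
to idle symbols. -/
def Encodes (eQ : Q ≃ Fin n) (eΓ : Γ ≃ Fin k) (q : Q) (b : Bool) (st : List Γ) (i : ℕ)
    (rest : List ℕ) : Prop :=
  ∃ g ≤ k, i = (k + 1) * stateNum eQ q b + g ∧
    (g :: rest).filter (fun x => x ≠ k) = st.map (fun γ => (eΓ γ : ℕ))

/-- Up to idle symbols, the two pushed symbols spell the written word; the exceptional transition at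
`⊥` that writes nothing counts as writing `⊥`. -/
theorem pushes_filter (γ : Γ) {s : List Γ} (hs : s.length ≤ 2) (rest : List ℕ) :
    ((A.pushes eΓ γ s).1 :: (A.pushes eΓ γ s).2 :: rest).filter (fun x => x ≠ k) =
      (open Classical in if γ = A.bot ∧ s = [] then [A.bot] else s).map (fun γ => (eΓ γ : ℕ)) ++
        rest.filter (fun x => x ≠ k) := by
  have hne : ∀ g, (eΓ g : ℕ) ≠ k := fun g => (eΓ g).2.ne
  rcases s with _ | ⟨g, _ | ⟨g', _ | ⟨g'', s⟩⟩⟩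
  · by_cases h : γ = A.bot
    · subst h
      simp [pushes, hne]
    · simp [pushes, h]
  · simp [pushes, hne]
  · simp [pushes, hne]
  · simp at hs

theorem Move.stack_eq {c c' : Q × List Γ} {σ : Option Unit} (h : A.Move c σ c') :
    ∃ γ s st, (c.1, σ, γ, c'.1, s) ∈ A.trans ∧ c.2 = γ :: st ∧
      c'.2 = (open Classical in if γ = A.bot ∧ s = [] then [A.bot] else s) ++ st := by
  obtain ⟨-, -, γ, s, ht, ⟨h, st, h₁, h₂⟩ | ⟨rfl, rfl, h₁, h₂⟩⟩ := h
  · refine ⟨γ, s, st, ht, h₁, ?_⟩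
    rw [if_neg (by tauto), h₂]
  · exact ⟨A.bot, [], [], ht, h₁, by simp [h₂]⟩

theorem exists_move {q q₂ : Q} {σ : Option Unit} {γ : Γ} {s st : List Γ}
    (ht : (q, σ, γ, q₂, s) ∈ A.trans) (hc : A.IsConfig (q, γ :: st)) :
    A.Move (q, γ :: st) σ
      (q₂, (open Classical in if γ = A.bot ∧ s = [] then [A.bot] else s) ++ st) := by
  obtain ⟨u, hu, e⟩ := hc
  simp only at e
  by_cases hγ : γ = A.bot
  · subst hγ
    have hst : st = [] ∧ u = [] := by
      rcases u with _ | ⟨a, u⟩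
      · simpa using e
      · simp only [List.cons_append, List.cons.injEq] at e
        rw [← e.1] at hu
        simp at hu
    obtain ⟨rfl, rfl⟩ := hst
    rcases A.trans_bot _ _ _ _ _ ht with ⟨h, -⟩ | ⟨-, rfl | ⟨v, hv, rfl⟩⟩
    · exact (h rfl).elim
    · exact ⟨⟨[], by simp, rfl⟩, ⟨[], by simp, by simp⟩, A.bot, [], ht, Or.inr ⟨rfl, rfl, rfl, by simp⟩⟩
    · exact ⟨⟨[], by simp, rfl⟩, ⟨v, hv, by simp⟩, A.bot, _, ht,
        Or.inl ⟨Or.inr (by simp), [], rfl, by simp⟩⟩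
  · rcases A.trans_bot _ _ _ _ _ ht with ⟨-, h⟩ | ⟨h, -⟩
    · rcases u with _ | ⟨a, u⟩
      · simp only [List.nil_append, List.cons.injEq] at e
        exact (hγ e.1).elim
      · simp only [List.cons_append, List.cons.injEq] at e
        obtain ⟨rfl, rfl⟩ := e
        rw [if_neg (by tauto)]
        simp only [List.mem_cons, not_or] at hu
        exact ⟨⟨_ :: u, by simp [hu], rfl⟩, ⟨s ++ u, by simp [h, hu], by simp⟩, _, s, ht,
          Or.inl ⟨Or.inl hγ, _, rfl, rfl⟩⟩
    · exact (hγ h).elim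

/-- Idle symbols on top are removed silently until the true top symbol appears. -/
theorem Encodes.peel (hM : A.Models eQ eΓ T) {q : Q} {b : Bool} {γ : Γ} {st : List Γ} :
    ∀ {rest : List ℕ} {i : ℕ}, Encodes eQ eΓ q b (γ :: st) i rest →
    ∃ rest' d, T.YieldsIn d i rest [] ((k + 1) * stateNum eQ q b + eΓ γ) rest' ∧
      rest'.filter (fun x => x ≠ k) = st.map (fun γ => (eΓ γ : ℕ)) := by
  intro rest
  induction rest with
  | nil =>
    rintro i ⟨g, hg, rfl, h⟩
    by_cases hgk : g = k
    · simp [hgk] at h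
    · simp only [ne_eq, hgk, not_false_eq_true, decide_true, List.filter_cons_of_pos,
        List.map_cons, List.cons.injEq] at h
      rw [h.1]
      exact ⟨[], 0, fun N t => by rw [prep_nil, Nat.add_zero], h.2⟩
  | cons g' rest ih =>
    rintro i ⟨g, hg, rfl, h⟩
    by_cases hgk : g = k
    · subst hgk
      have hg' : g' ≤ g := by
        by_contra hlt
        have hmem : g' ∈ List.filter (fun x => decide (x ≠ g)) (g :: g' :: rest) := by
          simp; omega
        rw [h] at hmem
        obtain ⟨γ', -, e⟩ := List.mem_map.1 hmem
        have := (eΓ γ').2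
        omega
      obtain ⟨r', d, e, hr'⟩ := ih (i := (g + 1) * stateNum eQ q b + g')
        ⟨g', hg', rfl, by rw [← h]; simp⟩
      have hpop := Tables.stream_pop (T := T) (c := stateNum eQ q b) g' rest
      rw [hM.k_eq] at hpop
      exact ⟨r', d + 1, hpop.trans e, hr'⟩
    · simp only [ne_eq, hgk, not_false_eq_true, decide_true, List.filter_cons_of_pos,
        List.map_cons, List.cons.injEq] at h
      rw [h.1]
      exact ⟨_, 0, fun N t => by rw [prep_nil, Nat.add_zero], h.2⟩

theorem Models.node_mod_ne (hM : A.Models eQ eΓ T) (c : ℕ) (γ : Γ) :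
    ((k + 1) * c + eΓ γ) % (T.k + 1) ≠ T.k := by
  have := (eΓ γ).2
  rw [hM.k_eq, Nat.mul_add_mod, Nat.mod_eq_of_lt (by omega)]
  omega

theorem Models.flag_iff (hM : A.Models eQ eΓ T) {q : Q} {b : Bool} {g : ℕ} (hg : g ≤ k) :
    T.Flag ((k + 1) * stateNum eQ q b + g) ↔ b = true := by
  have := Tables.flag_node (T := T) (c := stateNum eQ q b) (g := g) (by rwa [hM.k_eq])
  rw [hM.k_eq, hM.n_eq, le_stateNum] at this
  rw [this]
  simp [stateNum_lt]

/-- The dead state has no promise and its rows output `false` and return to it, so it never outputs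
`true`. -/
theorem Models.stream_dead (hM : A.Models eQ eΓ T) (N : ℕ) : ∀ {g : ℕ} {rest : List ℕ} {t : ℕ},
    g ≤ k → (∀ x ∈ rest, x ≤ k) → ¬ T.stream N ((k + 1) * (2 * n) + g) rest t := by
  induction N with
  | zero =>
    rintro g rest t hg - ⟨h, -⟩
    have := Tables.flag_node (T := T) (c := 2 * n) (g := g) (by rwa [hM.k_eq])
    rw [hM.k_eq, hM.n_eq] at this
    rw [this] at h
    omega
  | succ N ih =>
    intro g rest t hg hr h
    by_cases hgk : g = k
    · subst hgk
      rcases rest with _ | ⟨g', rest⟩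
      · rw [Tables.stream_add_one, if_pos (by rw [hM.k_eq, Nat.mul_add_mod, Nat.mod_eq_of_lt (by omega)])] at h
        exact ih le_rfl (by simp) h
      · have hpop := Tables.stream_pop (T := T) (c := 2 * n) g' rest
        rw [hM.k_eq] at hpop
        rw [hpop N t, prep_nil] at h
        exact ih (hr g' (by simp)) (fun x hx => hr x (by simp [hx])) h
    · have hmod : ((k + 1) * (2 * n) + g) % (T.k + 1) ≠ T.k := by
        rw [hM.k_eq, Nat.mul_add_mod, Nat.mod_eq_of_lt (by omega)]
        exact hgk
      rw [Tables.stream_step hmod] at h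
      have := hM.dead g (by omega) _ rfl
      simp only [Prod.mk.injEq] at this
      obtain ⟨e₁, e₂, e₃, e₄⟩ := this
      rw [e₁, e₂, e₃, e₄] at h
      rcases t with _ | t
      · simp [prep, Tables.bits] at h
      · rw [prep, if_neg (by simp [Tables.bits])] at h
        refine ih le_rfl (fun x hx => ?_) h
        rcases List.mem_cons.1 hx with rfl | hx
        exacts [hg, hr x hx]

theorem le_of_filter_eq {st : List Γ} {rest : List ℕ}
    (h : rest.filter (fun x => x ≠ k) = st.map (fun γ => (eΓ γ : ℕ))) : ∀ x ∈ rest, x ≤ k := by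
  intro x hx
  by_cases hk : x = k
  · omega
  · have : x ∈ rest.filter (fun x => x ≠ k) := by simp [hx, hk]
    rw [h] at this
    obtain ⟨γ', -, e⟩ := List.mem_map.1 this
    have := (eΓ γ').2
    omega

theorem Encodes.next (hA : A.IsShort) {q q₂ : Q} {σ γ s} (ht : (q, σ, γ, q₂, s) ∈ A.trans)
    {rest : List ℕ} {st : List Γ} (b : Bool)
    (h : rest.filter (fun x => x ≠ k) = st.map (fun γ => (eΓ γ : ℕ))) :
    Encodes eQ eΓ q₂ b ((open Classical in if γ = A.bot ∧ s = [] then [A.bot] else s) ++ st)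
      ((k + 1) * stateNum eQ q₂ b + (A.pushes eΓ γ s).1) ((A.pushes eΓ γ s).2 :: rest) :=
  ⟨_, (pushes_le γ s).1, rfl, by rw [pushes_filter γ (hA _ _ _ _ _ ht), h, List.map_append]⟩

/-- Induction on the number of steps. A `true` at position `t` comes either from an accepting run on
`t` letters or, if `t = 0`, from the promise `b` with which the simulation was started; the first
alternative is needed for the induction, because silent moves pass promises on. -/
theorem Models.sound (hM : A.Models eQ eΓ T) (hA : A.IsShort) (N : ℕ) :
    ∀ {q : Q} {b : Bool} {st : List Γ} {i : ℕ} {rest : List ℕ} {t : ℕ}, A.IsConfig (q, st) →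
      Encodes eQ eΓ q b st i rest → T.stream N i rest t → (b = true ∧ t = 0) ∨
        ∃ q' st', q' ∈ A.final ∧ A.Reaches (q, st) (List.replicate t ()) (q', st') := by
  induction N with
  | zero =>
    rintro q b st i rest t hc ⟨g, hg, rfl, h⟩ ⟨hf, rfl⟩
    rw [hM.flag_iff hg] at hf
    exact Or.inl ⟨hf, rfl⟩
  | succ N ih =>
    rintro q b st i rest t hc ⟨g, hg, rfl, h⟩ hs
    have hpromise : ∀ {t}, A.promise q b = true → t = 0 → (b = true ∧ t = 0) ∨
        ∃ q' st', q' ∈ A.final ∧ A.Reaches (q, st) (List.replicate t ()) (q', st') := by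
      rintro t hp rfl
      simp only [promise, Bool.or_eq_true, decide_eq_true_eq] at hp
      rcases hp with rfl | hp
      · exact Or.inl ⟨rfl, rfl⟩
      · exact Or.inr ⟨q, st, hp, .refl _⟩
    by_cases hgk : g = k
    · subst hgk
      rcases rest with _ | ⟨g', rest⟩
      · obtain ⟨u, -, rfl⟩ := hc
        simp at h
      · have hpop := Tables.stream_pop (T := T) (c := stateNum eQ q b) g' rest
        rw [hM.k_eq] at hpop
        rw [hpop N t, prep_nil] at hs
        simp only [ne_eq, not_true_eq_false, decide_false, Bool.false_eq_true, not_false_eq_true,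
          List.filter_cons_of_neg] at h
        have hg' := le_of_filter_eq h g' (by simp)
        exact ih hc ⟨g', hg', rfl, h⟩ hs
    · simp only [ne_eq, hgk, not_false_eq_true, decide_true, List.filter_cons_of_pos] at h
      rcases st with _ | ⟨γ, st⟩
      · simp at h
      simp only [List.map_cons, List.cons.injEq] at h
      obtain ⟨rfl, h⟩ := h
      rw [Tables.stream_step (hM.node_mod_ne _ _)] at hs
      by_cases hm : ∀ σ q₂ s, (q, σ, γ, q₂, s) ∉ A.trans
      · have := hM.miss q γ hm b _ rfl
        simp only [Prod.mk.injEq] at this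
        obtain ⟨e₁, e₂, e₃, e₄⟩ := this
        rw [e₁, e₂, e₃, e₄] at hs
        rcases t with _ | t
        · rcases hp : A.promise q b with _ | _
          · simp [hp, prep, Tables.bits] at hs
          · exact hpromise hp rfl
        · exfalso
          have hlen : (Tables.bits (1 + (A.promise q b).toNat)).length = 1 := by
            cases A.promise q b <;> rfl
          rw [prep, hlen, if_neg (by omega), Nat.add_sub_cancel] at hs
          refine hM.stream_dead N le_rfl (fun x hx => ?_) hs
          rcases List.mem_cons.1 hx with rfl | hx
          exacts [hg, le_of_filter_eq h x hx]
      · push Not at hm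
        obtain ⟨σ, q₂, s, ht⟩ := hm
        have hmove := exists_move ht hc
        have := hM.hit q σ γ q₂ s ht b _ rfl
        simp only [Prod.mk.injEq] at this
        obtain ⟨e₁, e₂, e₃⟩ := this
        have e₄ := congrArg Prod.fst e₃
        have e₅ := congrArg Prod.snd e₃
        simp only at e₄ e₅
        rw [e₁, e₂, e₄, e₅] at hs
        have henc := fun b => Encodes.next (eQ := eQ) hA ht b h
        rcases σ with _ | σ
        · simp only [if_true, Tables.bits, prep_nil, decide_true, Bool.true_and] at hs
          rcases ih hmove.2.1 (henc _) hs with ⟨hp, h0⟩ | ⟨q', st', hq', hr⟩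
          · exact hpromise hp h0
          · exact Or.inr ⟨q', st', hq', .head hmove hr⟩
        · simp only [reduceCtorEq, if_false, decide_false, Bool.false_and] at hs
          rcases t with _ | t
          · rcases hp : A.promise q b with _ | _
            · simp [hp, prep, Tables.bits] at hs
            · exact hpromise hp rfl
          · have hlen : (Tables.bits (1 + (A.promise q b).toNat)).length = 1 := by
              cases A.promise q b <;> rfl
            rw [prep, hlen, if_neg (by omega), Nat.add_sub_cancel] at hs
            rcases ih hmove.2.1 (henc _) hs with ⟨hp, h0⟩ | ⟨q', st', hq', hr⟩
            · simp at hp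
            · exact Or.inr ⟨q', st', hq', .head hmove hr⟩

/-- Induction on the run: a move contributes one output bit exactly if it reads a letter. At its end
the state is final, so the promise is set. -/
theorem Models.complete (hM : A.Models eQ eΓ T) (hA : A.IsShort) {c c' : Q × List Γ}
    {w : List Unit} (hr : A.Reaches c w c') (hf : c'.1 ∈ A.final) :
    ∀ {b : Bool} {i : ℕ} {rest : List ℕ}, A.IsConfig c → Encodes eQ eΓ c.1 b c.2 i rest →
      T.Output i rest w.length := by
  induction hr with
  | refl c =>
    intro b i rest hc he
    obtain ⟨q, st⟩ := c
    rcases st with _ | ⟨γ, st⟩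
    · obtain ⟨u, -, hu⟩ := hc
      simp at hu
    obtain ⟨r', d, e, hr'⟩ := he.peel hM
    have hp : A.promise q b = true := by simp_all [promise]
    -- One step suffices: it outputs `true`, or it is silent and arrives at a flagged node.
    have key : T.Output ((k + 1) * stateNum eQ q b + eΓ γ) r' 0 := by
      refine ⟨0 + 1, ?_⟩
      rw [Tables.stream_step (hM.node_mod_ne _ _)]
      by_cases hm : ∀ σ q₂ s, (q, σ, γ, q₂, s) ∉ A.trans
      · have := hM.miss q γ hm b _ rfl
        simp only [Prod.mk.injEq] at this
        rw [this.1, hp]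
        simp [prep, Tables.bits]
      · push Not at hm
        obtain ⟨σ, q₂, s, ht⟩ := hm
        have := hM.hit q σ γ q₂ s ht b _ rfl
        simp only [Prod.mk.injEq] at this
        obtain ⟨e₁, e₂, e₃⟩ := this
        have e₄ := congrArg Prod.fst e₃
        simp only at e₄
        rw [e₁, e₂, e₄]
        rcases σ with _ | σ
        · simp only [if_true, Tables.bits, prep_nil, decide_true, Bool.true_and]
          exact ⟨(hM.flag_iff (pushes_le _ _).1).2 hp, rfl⟩
        · simp [prep, Tables.bits, hp]
    simpa using e.output key
  | @head c c₂ c' σ w hm _ ih =>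
    intro b i rest hc he
    obtain ⟨q, st⟩ := c
    obtain ⟨q₂, st₂⟩ := c₂
    have hc₂ := hm.2.1
    obtain ⟨γ, s, st', ht, hst, hst₂⟩ := hm.stack_eq
    simp only at hst hst₂ ht
    subst hst hst₂
    obtain ⟨r', d, e, hr'⟩ := he.peel hM
    have := hM.hit q σ γ q₂ s ht b _ rfl
    simp only [Prod.mk.injEq] at this
    obtain ⟨e₁, e₂, e₃⟩ := this
    have e₄ := congrArg Prod.fst e₃
    have e₅ := congrArg Prod.snd e₃
    simp only at e₄ e₅
    have hstep := Tables.stream_step (hM.node_mod_ne (stateNum eQ q b) γ) r'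
    rw [e₁, e₂, e₄, e₅] at hstep
    have := (e.trans hstep).output (ih hf hc₂ (Encodes.next hA ht _ hr'))
    convert this using 1
    rcases σ with _ | σ
    · simp [Tables.bits]
    · cases A.promise q b <;> simp [Tables.bits, add_comm]

theorem Models.charSeq_iff (hM : A.Models eQ eΓ T) (hA : A.IsShort) (t : ℕ) :
    charSeq A.lang t = true ↔
      T.Output ((k + 1) * stateNum eQ A.start false + eΓ A.bot) [] t := by
  have hc : A.IsConfig (A.start, [A.bot]) := ⟨[], by simp, rfl⟩
  have he : Encodes eQ eΓ A.start false [A.bot] ((k + 1) * stateNum eQ A.start false + eΓ A.bot) [] := by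
    have := (eΓ A.bot).2
    exact ⟨_, this.le, rfl, by simp; omega⟩
  have hi : charSeq A.lang t = true ↔ List.replicate t () ∈ A.lang := by simp [charSeq]
  rw [hi]
  constructor
  · rintro ⟨q, s, hq, hr⟩
    simpa using hM.complete hA hr hq hc he
  · rintro ⟨N, hN⟩
    -- The start has no promise, which excludes the first alternative.
    rcases hM.sound hA N hc he hN with ⟨h, -⟩ | ⟨q', st', hq', hr⟩
    · simp at h
    · exact ⟨q', st', hq', hr⟩

end UPDA

/-! ### The translation from automata to indicator pairs in polynomial time -/

namespace RAM

open Classical in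
-- The form used below: an invariant insensitive to the value of the counter survives its
-- initialization and its increments.
theorem Cmd.upto_inv {V : Type} {x : List ℕ} {c : V} {b : Exp V} {p : Cmd V}
    (I : ℕ → Store V → Prop) {N : ℕ} (hN : N ≤ x.length ^ 3)
    (hb : ∀ i σ, I i σ → b.eval x σ = N)
    (hI : ∀ i σ m, I i σ → I i { σ with v := Function.update σ.v c m })
    (hp : ∀ i σ, i < N → I i σ → σ.v c = i → (p.run x σ).v c = i ∧ I (i + 1) (p.run x σ))
    {σ : Store V} (h0 : I 0 σ) : I N ((Cmd.upto c b p).run x σ) :=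
  Cmd.upto_spec I hN (fun i σ h _ => hb i σ h)
    (fun i σ hi h hc => (hp i σ hi h hc).imp_right fun h => hI _ _ _ h) (hI _ _ _ h0)

namespace FromAutomaton

/-- The variables of `prog`. -/
inductive Var
  | n | k | kk | fb | db | nn | p | g | c | d | e | i | a | b | f | s | q | r | pos | bot | j
  | ca | cb | cr | pc | cur | u | acc | x₀ | fin | s₁ | s₂ | rnd

open Var

instance : Finite Var := by
  refine Finite.of_surjective (![n, k, kk, fb, db, nn, p, g, c, d, e, i, a, b, f, s, q, r, pos,
    bot, j, ca, cb, cr, pc, cur, u, acc, x₀, fin, s₁, s₂, rnd] : Fin 33 → Var) fun v => ?_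
  cases v
  exacts [⟨0, rfl⟩, ⟨1, rfl⟩, ⟨2, rfl⟩, ⟨3, rfl⟩, ⟨4, rfl⟩, ⟨5, rfl⟩, ⟨6, rfl⟩, ⟨7, rfl⟩, ⟨8, rfl⟩,
    ⟨9, rfl⟩, ⟨10, rfl⟩, ⟨11, rfl⟩, ⟨12, rfl⟩, ⟨13, rfl⟩, ⟨14, rfl⟩, ⟨15, rfl⟩, ⟨16, rfl⟩, ⟨17, rfl⟩,
    ⟨18, rfl⟩, ⟨19, rfl⟩, ⟨20, rfl⟩, ⟨21, rfl⟩, ⟨22, rfl⟩, ⟨23, rfl⟩, ⟨24, rfl⟩, ⟨25, rfl⟩, ⟨26, rfl⟩,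
    ⟨27, rfl⟩, ⟨28, rfl⟩, ⟨29, rfl⟩, ⟨30, rfl⟩, ⟨31, rfl⟩, ⟨32, rfl⟩]

/-- The number of states of the machine. -/
def stateCount : Exp Var := .add (.add (.var n) (.var n)) (.const 1)

/-- Store a multiple of `k + 1`, and resolve the idle node of the state `p`. -/
def setupBody : Cmd Var :=
  .seq (.store .mul (.var p) (.var d)) <|
  .seq (.store .exit (.add (.var d) (.var k)) (.add (.var d) (.const 1)))
    (.assign d (.add (.var d) (.var kk)))

/-- Read the numbers of states and symbols, and store the multiples of `k + 1`. -/
def setup : Cmd Var :=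
  .seq (.assign n (.inp (.const 0))) <| .seq (.assign k (.inp (.const 1))) <|
  .seq (.assign kk (.add (.var k) (.const 1))) <| .seq (.assign d (.const 0)) <|
  .seq (.upto p stateCount setupBody) <|
  .seq (.assign fb (.arr .mul (.var n))) <|
  .seq (.assign db (.arr .mul (.add (.var n) (.var n)))) (.assign nn (.add (.var db) (.var kk)))

/-- Store the row of the node `i`. -/
def setRow : Cmd Var :=
  .seq (.store .emit (.var i) (.var e)) <| .seq (.store .base (.var i) (.var d)) <|
  .seq (.store .push₁ (.var i) (.var a)) (.store .push₂ (.var i) (.var b))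

/-- The row of the node with state `p` and symbol `g`, for lack of a transition. -/
def missRow : Cmd Var :=
  .seq (.assign i (.add (.arr .mul (.var p)) (.var g))) <| .seq (.assign d (.var db)) <|
  .seq (.assign a (.var k)) <| .seq (.assign b (.var g)) setRow

/-- The output of the state `p`, for lack of a transition. -/
def missEmit : Cmd Var :=
  .ite (.sub (.var n) (.var p)) (.assign e (.add (.const 1) (.inp (.add (.const 3) (.var p)))))
    (.ite (.sub (.add (.var n) (.var n)) (.var p)) (.assign e (.const 2)) (.assign e (.const 1)))

/-- The tables of a machine without transitions. -/
def missRows : Cmd Var := .upto p stateCount (.seq missEmit (.upto g (.var k) missRow))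

/-- Read a transition. -/
def readTrans : Cmd Var :=
  .seq (.assign q (.inp (.var pos))) <| .seq (.assign s (.inp (.add (.var pos) (.const 1)))) <|
  .seq (.assign g (.inp (.add (.var pos) (.const 2)))) <|
  .seq (.assign r (.arr .mul (.inp (.add (.var pos) (.const 3))))) <|
  .seq (.assign a (.inp (.add (.var pos) (.const 4)))) <|
  .seq (.assign b (.inp (.add (.var pos) (.const 5)))) <|
  .seq (.assign f (.inp (.add (.const 3) (.var q)))) <|
  .assign i (.add (.arr .mul (.var q)) (.var g))

/-- Compute the symbols to be pushed. -/
def setPushes : Cmd Var :=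
  .ite (.var b) (.seq (.assign a (.sub (.var a) (.const 1))) (.assign b (.sub (.var b) (.const 1))))
    (.ite (.var a) (.seq (.assign b (.sub (.var a) (.const 1))) (.assign a (.var k)))
      (.seq (.assign a (.var k)) (.ite (.inp (.add (.add (.const 3) (.var n)) (.var g)))
        (.assign b (.var g)) (.assign b (.var k)))))

/-- The row of the node `i`, for states without a promise. -/
def hitRow₀ : Cmd Var :=
  .seq (.ite (.var s) (.seq (.assign e (.add (.const 1) (.var f))) (.assign d (.var r)))
    (.seq (.assign e (.const 0)) (.ite (.var f) (.assign d (.add (.var r) (.var fb)))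
      (.assign d (.var r))))) setRow

/-- The row of the node `i`, for states with a promise. -/
def hitRow₁ : Cmd Var :=
  .seq (.ite (.var s) (.seq (.assign e (.const 2)) (.assign d (.var r)))
    (.seq (.assign e (.const 0)) (.assign d (.add (.var r) (.var fb))))) setRow

/-- Enter the transition at the position `pos` into the tables. -/
def hitRows : Cmd Var :=
  .seq readTrans <| .seq setPushes <| .seq hitRow₀ <|
  .seq (.assign i (.add (.var i) (.var fb))) <| .seq hitRow₁ <|
  .assign pos (.add (.var pos) (.const 6))

/-- Enter all transitions into the tables. -/
def allHitRows : Cmd Var :=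
  .seq (.assign pos (.add (.const 3) (.add (.var n) (.var k))))
    (.upto c .len (.ite (.sub .len (.var pos)) hitRows .skip))

/-- Compute the tables of the machine. -/
def tables : Cmd Var := .seq setup (.seq missRows allHitRows)

/-- The row of a node. -/
def row (σ : Store Var) (i : ℕ) : ℕ × ℕ × ℕ × ℕ :=
  (σ.m .emit i, σ.m .base i, σ.m .push₁ i, σ.m .push₂ i)

/-- The basic data of the machine with `n` and `k` in the store. -/
structure Params (N K : ℕ) (σ : Store Var) : Prop where
  n : σ.v n = N
  k : σ.v k = K
  fb : σ.v fb = (K + 1) * N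
  db : σ.v db = (K + 1) * (2 * N)
  nn : σ.v nn = (2 * N + 1) * (K + 1)
  mul : ∀ c ≤ 2 * N, σ.m .mul c = (K + 1) * c
  exit_idle : ∀ c ≤ 2 * N, σ.m .exit ((K + 1) * c + K) = (K + 1) * c + 1
  exit_ne : ∀ c g, g < K → σ.m .exit ((K + 1) * c + g) = 0
  word : ∀ i, σ.m .word i = 0
  o : σ.o = []

theorem Params.congr {N K : ℕ} {σ τ : Store Var} (h : Params N K σ)
    (hn : τ.v Var.n = σ.v Var.n) (hk : τ.v Var.k = σ.v Var.k) (hf : τ.v Var.fb = σ.v Var.fb)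
    (hd : τ.v Var.db = σ.v Var.db) (hnn : τ.v Var.nn = σ.v Var.nn) (hm : τ.m .mul = σ.m .mul)
    (he : τ.m .exit = σ.m .exit) (hw : τ.m .word = σ.m .word) (ho : τ.o = σ.o) :
    Params N K τ where
  n := hn.trans h.n
  k := hk.trans h.k
  fb := hf.trans h.fb
  db := hd.trans h.db
  nn := hnn.trans h.nn
  mul := by rw [hm]; exact h.mul
  exit_idle := by rw [he]; exact h.exit_idle
  exit_ne := by rw [he]; exact h.exit_ne
  word := by rw [hw]; exact h.word
  o := ho.trans h.o

theorem node_inj {K c c' g g' : ℕ} (hg : g < K + 1) (hg' : g' < K + 1) :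
    (K + 1) * c + g = (K + 1) * c' + g' ↔ c = c' ∧ g = g' := by
  constructor
  · intro h
    have h₁ := congrArg (· / (K + 1)) h
    have h₂ := congrArg (· % (K + 1)) h
    simp only [Nat.mul_add_div (Nat.succ_pos K), Nat.div_eq_of_lt hg, Nat.div_eq_of_lt hg',
      Nat.mul_add_mod, Nat.mod_eq_of_lt hg, Nat.mod_eq_of_lt hg'] at h₁ h₂
    omega
  · rintro ⟨rfl, rfl⟩; rfl

variable {x : List ℕ} {N K : ℕ}

/-- The multiples of `k + 1` are tabulated by repeated addition, so that later steps find nodes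
without multiplication. At the idle node of a state, the symbol is removed in that very state, so
`exit` points to the state itself; the stored value is shifted by one because 0 means unresolved. -/
theorem setup_spec (hx : 2 * N + 1 ≤ x.length ^ 3) (h₀ : x.getD 0 0 = N) (h₁ : x.getD 1 0 = K) :
    Params N K (setup.run x Store.init) := by
  simp only [setup, Cmd.run, Exp.eval, h₀, h₁, ne_eq, reduceCtorEq, not_false_eq_true,
    Function.update_self, Function.update_of_ne]
  set τ : Store Var := _
  have key := Cmd.upto_inv (x := x) (c := p) (b := stateCount) (p := setupBody)
    (fun P σ => σ.v n = N ∧ σ.v k = K ∧ σ.v kk = K + 1 ∧ σ.v d = (K + 1) * P ∧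
      (∀ c < P, σ.m .mul c = (K + 1) * c) ∧
      (∀ c < P, σ.m .exit ((K + 1) * c + K) = (K + 1) * c + 1) ∧
      (∀ c g, g < K → σ.m .exit ((K + 1) * c + g) = 0) ∧
      (∀ i, σ.m .word i = 0) ∧ σ.o = []) (N := 2 * N + 1) (σ := τ) hx ?_ ?_ ?_ ?_
  · obtain ⟨h₁, h₂, h₃, -, h₄, h₅, h₆, h₇, h₈⟩ := key
    have e₁ := h₄ (N + N) (by omega)
    have e₂ := h₄ N (by omega)
    generalize (Cmd.upto p stateCount setupBody).run x τ = σ at *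
    constructor
    · simp [h₁]
    · simp [h₂]
    · simp [h₁, e₂]
    · simp [h₁, e₁, two_mul]
    · simp [h₁, h₃, e₁]; ring
    · exact fun c hc => h₄ c (by omega)
    · exact fun c hc => h₅ c (by omega)
    · exact h₆
    · exact h₇
    · exact h₈
  · rintro P σ ⟨h₁, -⟩
    simp only [stateCount, Exp.eval, h₁]
    ring
  · intro P σ m h
    simpa only [ne_eq, reduceCtorEq, not_false_eq_true, Function.update_of_ne] using h
  · rintro P σ hP ⟨h₁, h₂, h₃, h₄, h₅, h₆, h₇, h₈, h₉⟩ hc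
    simp only [setupBody, Cmd.run, Exp.eval, h₂, h₃, h₄, hc, ne_eq, reduceCtorEq,
      not_false_eq_true, Function.update_self, Function.update_of_ne, true_and, h₁, h₈, h₉]
    refine ⟨by ring, fun c hc' => ?_, fun c hc' => ?_, fun c g hg => ?_, fun _ => trivial, trivial⟩
    · by_cases h : c = P
      · simp [h]
      · rw [Function.update_of_ne h, h₅ c (by omega)]
    · by_cases h : c = P
      · simp [h]
      · rw [Function.update_of_ne, h₆ c (by omega)]
        rw [ne_eq, node_inj (by omega) (by omega)]
        tauto
    · rw [Function.update_of_ne, h₇ c g hg]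
      rw [ne_eq, node_inj (by omega) (by omega)]
      omega
  · simp [τ, Store.init]

theorem run_setRow (σ : Store Var) : (setRow.run x σ).v = σ.v ∧ (setRow.run x σ).o = σ.o ∧
    (setRow.run x σ).m .mul = σ.m .mul ∧ (setRow.run x σ).m .exit = σ.m .exit ∧
    (setRow.run x σ).m .word = σ.m .word ∧
    ∀ j, row (setRow.run x σ) j = if j = σ.v i then (σ.v e, σ.v d, σ.v a, σ.v b) else row σ j := by
  refine ⟨rfl, rfl, ?_, ?_, ?_, fun j => ?_⟩ <;>
  simp only [setRow, Cmd.run, Exp.eval, ne_eq, reduceCtorEq, not_false_eq_true,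
    Function.update_self, Function.update_of_ne, row]
  by_cases h : j = σ.v i <;> simp [h]

/-- The rows of a machine without transitions. -/
def missValue (x : List ℕ) (N K c g : ℕ) : ℕ × ℕ × ℕ × ℕ :=
  (if c < N then 1 + x.getD (3 + c) 0 else if c < 2 * N then 2 else 1, (K + 1) * (2 * N), K, g)

/-- All rows are first filled as if there were no transitions; existing transitions overwrite them
later, so that absence never has to be tested. -/
theorem missRows_spec (hx : 2 * N + 1 ≤ x.length ^ 3) (hx' : K ≤ x.length ^ 3) {σ : Store Var}
    (h : Params N K σ) : Params N K (missRows.run x σ) ∧ ∀ c ≤ 2 * N, ∀ g < K,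
      row (missRows.run x σ) ((K + 1) * c + g) = missValue x N K c g := by
  have key := Cmd.upto_inv (x := x) (c := p) (b := stateCount)
    (p := .seq missEmit (.upto g (.var k) missRow))
    (fun P σ => Params N K σ ∧ ∀ c < P, ∀ g < K, row σ ((K + 1) * c + g) = missValue x N K c g)
    (N := 2 * N + 1) (σ := σ) hx ?_ ?_ ?_ ?_
  · exact ⟨key.1, fun c hc => key.2 c (by omega)⟩
  · rintro P σ ⟨h, -⟩
    simp only [stateCount, Exp.eval, h.n]
    ring
  · rintro P σ m ⟨h₁, h₂⟩
    exact ⟨h₁.congr (by simp) (by simp) (by simp) (by simp) (by simp) rfl rfl rfl rfl, h₂⟩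
  · rintro P σ hP ⟨h₁, h₂⟩ hc
    have he : ∃ τ, missEmit.run x σ = τ ∧ Params N K τ ∧ (∀ j, row τ j = row σ j) ∧ τ.v p = P ∧
        τ.v e = (missValue x N K P 0).1 := by
      refine ⟨_, rfl, ?_⟩
      unfold missEmit missValue
      by_cases c₁ : P < N
      · have : N - P ≠ 0 := by omega
        simp only [Cmd.run, Exp.eval, h₁.n, hc, this, not_false_eq_true, if_true, ne_eq, c₁]
        exact ⟨h₁.congr (by simp) (by simp) (by simp) (by simp) (by simp) rfl rfl rfl rfl,
          fun _ => rfl, by simp [hc], by simp⟩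
      · by_cases c₂ : P < 2 * N
        · have a₁ : N - P = 0 := by omega
          have a₂ : N + N - P ≠ 0 := by omega
          simp only [Cmd.run, Exp.eval, h₁.n, hc, a₁, a₂, not_false_eq_true, if_true, ne_eq, c₁, c₂,
            not_true_eq_false, if_false]
          exact ⟨h₁.congr (by simp) (by simp) (by simp) (by simp) (by simp) rfl rfl rfl rfl,
            fun _ => rfl, by simp [hc], by simp⟩
        · have a₁ : N - P = 0 := by omega
          have a₂ : N + N - P = 0 := by omega
          simp only [Cmd.run, Exp.eval, h₁.n, hc, a₁, a₂, ne_eq, c₁, c₂,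
            not_true_eq_false, if_false]
          exact ⟨h₁.congr (by simp) (by simp) (by simp) (by simp) (by simp) rfl rfl rfl rfl,
            fun _ => rfl, by simp [hc], by simp⟩
    obtain ⟨τ, hτ, t₁, t₂, t₃, t₄⟩ := he
    rw [Cmd.run, hτ]
    have key := Cmd.upto_inv (x := x) (c := g) (b := .var k) (p := missRow)
      (fun G σ => Params N K σ ∧ σ.v p = P ∧ σ.v e = (missValue x N K P 0).1 ∧
        (∀ c < P, ∀ g < K, row σ ((K + 1) * c + g) = missValue x N K c g) ∧
        ∀ g < G, row σ ((K + 1) * P + g) = missValue x N K P g)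
      (N := K) (σ := τ) hx' ?_ ?_ ?_ ?_
    · obtain ⟨k₁, k₂, -, k₃, k₄⟩ := key
      refine ⟨k₂, k₁, fun c hc g hg => ?_⟩
      rcases Nat.lt_succ_iff_lt_or_eq.1 hc with hc | rfl
      exacts [k₃ c hc g hg, k₄ g hg]
    · rintro G σ ⟨h, -⟩
      exact h.k
    · rintro G σ m ⟨h₁, h₂, h₃, h₄⟩
      exact ⟨h₁.congr (by simp) (by simp) (by simp) (by simp) (by simp) rfl rfl rfl rfl,
        by simpa using h₂, by simpa using h₃, h₄⟩
    · rintro G σ hG ⟨h₁, h₂, h₃, h₄, h₅⟩ hg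
      simp only [missRow, Cmd.run, Exp.eval, ne_eq, reduceCtorEq, not_false_eq_true,
        Function.update_of_ne, h₁.k, h₁.db, h₂, hg, h₁.mul P (by omega)]
      set τ : Store Var := ⟨_, σ.m, σ.o⟩ with hτ
      obtain ⟨r₁, r₂, r₃, r₄, r₅, r₆⟩ := run_setRow (x := x) τ
      have hval : row (setRow.run x τ) ((K + 1) * P + G) = missValue x N K P G := by
        rw [r₆, if_pos (by simp [hτ])]
        simp [hτ, h₃, missValue]
      have hrow : ∀ j, j ≠ (K + 1) * P + G → row (setRow.run x τ) j = row σ j := by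
        intro j hj
        rw [r₆, if_neg (by simpa [hτ] using hj)]
        rfl
      refine ⟨by rw [r₁]; simp [hτ, hg], h₁.congr ?_ ?_ ?_ ?_ ?_ r₃ r₄ r₅ r₂, ?_, ?_, ?_, ?_⟩
      · rw [r₁]; simp [hτ]
      · rw [r₁]; simp [hτ]
      · rw [r₁]; simp [hτ]
      · rw [r₁]; simp [hτ]
      · rw [r₁]; simp [hτ]
      · rw [r₁]; simp [hτ, h₂]
      · rw [r₁]; simp [hτ, h₃]
      · intro c hc g hg
        rw [hrow, h₄ c hc g hg]
        rw [ne_eq, node_inj (by omega) (by omega)]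
        omega
      · intro g hg
        rcases Nat.lt_succ_iff_lt_or_eq.1 hg with hg | rfl
        · rw [hrow, h₅ g hg]
          rw [ne_eq, node_inj (by omega) (by omega)]
          omega
        · exact hval
    · refine ⟨t₁, t₃, t₄, fun c hc g hg => ?_, fun g hg => by omega⟩
      rw [t₂, h₂ c hc g hg]
  · exact ⟨h, fun c hc => by omega⟩

end FromAutomaton

end RAM

/-! ### Reading the transitions of the automaton -/

namespace RAM

namespace FromAutomaton

open Var

variable {Q Γ : Type} {n k : ℕ}

/-- The numbers in the description of an automaton. -/
structure Input (A : UPDA Q Γ) (eQ : Q ≃ Fin n) (eΓ : Γ ≃ Fin k)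
    (l : List (Q × Option Unit × Γ × Q × List Γ)) (x : List ℕ) : Prop where
  length : x.length = 3 + n + k + 6 * l.length
  states : x.getD 0 0 = n
  symbols : x.getD 1 0 = k
  start : x.getD 2 0 = eQ A.start
  final : ∀ q, x.getD (3 + eQ q) 0 = (A.promise q false).toNat
  bot : ∀ γ, x.getD (3 + n + eΓ γ) 0 ≠ 0 ↔ γ = A.bot
  trans : ∀ j t, l[j]? = some t → ∀ i < 6,
    x.getD (3 + n + k + 6 * j + i) 0 = (UPDA.transCode eQ eΓ t).getD i 0

theorem length_flatMap_transCode (eQ : Q ≃ Fin n) (eΓ : Γ ≃ Fin k)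
    (l : List (Q × Option Unit × Γ × Q × List Γ)) :
    (l.flatMap (UPDA.transCode eQ eΓ)).length = 6 * l.length := by
  induction l with
  | nil => rfl
  | cons t l ih =>
    rw [List.flatMap_cons, List.length_append, ih, List.length_cons]
    simp only [UPDA.transCode, List.length_cons, List.length_nil]
    ring

theorem getElem?_flatMap_transCode (eQ : Q ≃ Fin n) (eΓ : Γ ≃ Fin k) :
    ∀ (l : List (Q × Option Unit × Γ × Q × List Γ)) (j : ℕ) (t), l[j]? = some t → ∀ i < 6,
    (l.flatMap (UPDA.transCode eQ eΓ))[6 * j + i]? = (UPDA.transCode eQ eΓ t)[i]? := by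
  have hl : ∀ t, (UPDA.transCode eQ eΓ t).length = 6 := fun t => rfl
  intro l
  induction l with
  | nil => simp
  | cons t' l ih =>
    rintro (_ | j) t h i hi
    · simp only [List.getElem?_cons_zero, Option.some.injEq] at h
      subst h
      rw [List.flatMap_cons, List.getElem?_append_left (by rw [hl]; omega)]
      simp
    · rw [List.flatMap_cons, List.getElem?_append_right (by rw [hl]; omega), hl,
        ← ih j t (by simpa using h) i hi]
      congr 1
      omega

theorem _root_.UPDA.IsCode.input {A : UPDA Q Γ} {x : List ℕ} (h : A.IsCode x) :
    ∃ (n k : ℕ) (eQ : Q ≃ Fin n) (eΓ : Γ ≃ Fin k) (l : List _),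
      (∀ t, t ∈ l ↔ t ∈ A.trans) ∧ Input A eQ eΓ l x := by
  obtain ⟨-, n, k, eQ, eΓ, l, hl, rfl⟩ := h
  refine ⟨n, k, eQ, eΓ, l, hl, ?_⟩
  have hlen := length_flatMap_transCode eQ eΓ l
  have hget := getElem?_flatMap_transCode eQ eΓ l
  constructor
  · simp only [List.length_append, List.length_ofFn, hlen, List.length_cons, List.length_nil]
  · rfl
  · rfl
  · rfl
  · intro q
    have := (eQ q).2
    rw [List.getD_eq_getElem?_getD, List.getElem?_append_left (by simp; omega),
      List.getElem?_append_left (by simp; omega), List.getElem?_append_right (by simp)]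
    simp only [List.length_cons, List.length_nil, Nat.add_sub_cancel_left, UPDA.promise,
      zero_add, Nat.reduceAdd, List.getElem?_ofFn]
    by_cases hq : q ∈ A.final <;> simp [hq]
  · intro γ
    have := (eΓ γ).2
    rw [List.getD_eq_getElem?_getD, List.getElem?_append_left (by simp; omega),
      List.getElem?_append_right (by simp; omega)]
    simp only [List.length_append, List.length_ofFn, List.length_cons, List.length_nil,
      Nat.add_sub_cancel_left, zero_add, Nat.reduceAdd, List.getElem?_ofFn]
    by_cases hq : γ = A.bot <;> simp [hq]
  · intro j t ht i hi
    rw [List.getD_eq_getElem?_getD, List.getElem?_append_right (by simp; omega),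
      List.getD_eq_getElem?_getD, ← hget j t ht i hi]
    congr 2
    simp
    omega

variable {A : UPDA Q Γ} {eQ : Q ≃ Fin n} {eΓ : Γ ≃ Fin k}
  {l : List (Q × Option Unit × Γ × Q × List Γ)} {x : List ℕ}

/-- The transition has been read. -/
structure Loaded (A : UPDA Q Γ) (eQ : Q ≃ Fin n) (eΓ : Γ ≃ Fin k)
    (t : Q × Option Unit × Γ × Q × List Γ) (σ : Store Var) : Prop where
  params : Params n k σ
  s : σ.v s = t.2.1.toList.length
  r : σ.v r = (k + 1) * eQ t.2.2.2.1
  f : σ.v f = (A.promise t.1 false).toNat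
  pushes : (σ.v a, σ.v b) = A.pushes eΓ t.2.2.1 t.2.2.2.2

theorem load_spec (hx : Input A eQ eΓ l x) {j : ℕ} {t} (hj : l[j]? = some t)
    (hs : t.2.2.2.2.length ≤ 2) {σ : Store Var} (h : Params n k σ)
    (hpos : σ.v pos = 3 + n + k + 6 * j) :
    ∃ τ, (readTrans.seq setPushes).run x σ = τ ∧ Loaded A eQ eΓ t τ ∧ τ.m = σ.m ∧
      τ.v pos = σ.v pos ∧ τ.v c = σ.v c ∧ τ.v i = (k + 1) * eQ t.1 + eΓ t.2.2.1 := by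
  obtain ⟨q₁, o, γ, q₂, s'⟩ := t
  have e := hx.trans j _ hj
  have e0 := e 0 (by omega)
  have e1 := e 1 (by omega)
  have e2 := e 2 (by omega)
  have e3 := e 3 (by omega)
  have e4 := e 4 (by omega)
  have e5 := e 5 (by omega)
  have hq₁ := (eQ q₁).2
  have hq₂ := (eQ q₂).2
  have hf := hx.final q₁
  have hb := hx.bot γ
  simp only [UPDA.transCode, List.getD_cons_zero, List.getD_cons_succ] at e0 e1 e2 e3 e4 e5
  refine ⟨_, rfl, ?_⟩
  simp only [Cmd.run, readTrans, Exp.eval, hpos, ne_eq, reduceCtorEq, not_false_eq_true,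
    Function.update_self, Function.update_of_ne, add_zero] at e0 e1 e2 e3 e4 e5 ⊢
  simp only [e0, e1, e2, e3, e4, e5, hf, h.mul _ (show (eQ q₁ : ℕ) ≤ 2 * n by omega),
    h.mul _ (show (eQ q₂ : ℕ) ≤ 2 * n by omega)]
  set τ : Store Var := ⟨_, σ.m, σ.o⟩ with hτ
  have hp : Params n k τ :=
    h.congr (by simp [hτ]) (by simp [hτ]) (by simp [hτ]) (by simp [hτ]) (by simp [hτ]) rfl rfl rfl rfl
  have hn := hp.n
  have hk := hp.k
  have h₁ : τ.v a = s'[0]?.elim 0 (fun g => (eΓ g : ℕ) + 1) := by simp [hτ]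
  have h₂ : τ.v b = s'[1]?.elim 0 (fun g => (eΓ g : ℕ) + 1) := by simp [hτ]
  have h₃ : τ.v g = eΓ γ := by simp [hτ]
  have h₄ : τ.v s = o.toList.length := by simp [hτ]
  have h₅ : τ.v f = (A.promise q₁ false).toNat := by simp [hτ]
  have h₆ : τ.v r = (k + 1) * eQ q₂ := by simp [hτ]
  have h₇ : τ.v pos = 3 + n + k + 6 * j := by simp [hτ, hpos]
  have h₈ : τ.v c = σ.v c := by simp [hτ]
  have h₉ : τ.v i = (k + 1) * eQ q₁ + eΓ γ := by simp [hτ]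
  have hm : τ.m = σ.m := rfl
  clear_value τ
  rw [← hm, ← h₈]
  -- Decoding the written word changes `a` and `b` only; the cases below check these two values for
  -- words of length 0, 1 and 2.
  have fin : ∀ (u : Store Var), (u.v a, u.v b) = A.pushes eΓ γ s' →
      u.m = τ.m → u.o = τ.o → (∀ v, v ≠ a → v ≠ b → u.v v = τ.v v) →
      Loaded A eQ eΓ (q₁, o, γ, q₂, s') u ∧ u.m = τ.m ∧ u.v pos = 3 + n + k + 6 * j ∧
        u.v c = τ.v c ∧ u.v i = (k + 1) * eQ q₁ + eΓ γ := by
    intro u hu hm ho hv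
    refine ⟨⟨hp.congr (hv _ (by simp) (by simp)) (hv _ (by simp) (by simp))
      (hv _ (by simp) (by simp)) (hv _ (by simp) (by simp)) (hv _ (by simp) (by simp))
      (by rw [hm]) (by rw [hm]) (by rw [hm]) ho, ?_, ?_, ?_, hu⟩, hm, ?_, ?_, ?_⟩
    all_goals rw [hv _ (by simp) (by simp)]
    all_goals assumption
  rcases s' with _ | ⟨g₁, _ | ⟨g₂, _ | ⟨g₃, s'⟩⟩⟩
  · simp only [List.getElem?_nil, Option.elim_none] at h₁ h₂
    by_cases hγ : γ = A.bot
    · have hb' := hb.2 hγ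
      refine fin _ ?_ ?_ ?_ ?_
      all_goals simp only [setPushes, Cmd.run, Exp.eval, h₁, h₂, hn, hk, h₃, hb', ne_eq, reduceCtorEq,
        not_false_eq_true, not_true_eq_false, if_true, if_false, Function.update_of_ne]
      · simp [UPDA.pushes, hγ]
      · intro v ha hb
        simp [ha, hb]
    · have hb' : x.getD (3 + n + eΓ γ) 0 = 0 := by tauto
      refine fin _ ?_ ?_ ?_ ?_
      all_goals simp only [setPushes, Cmd.run, Exp.eval, h₁, h₂, hn, hk, h₃, hb', ne_eq, reduceCtorEq,
        not_false_eq_true, not_true_eq_false, if_false, Function.update_of_ne]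
      · simp [UPDA.pushes, hγ]
      · intro v ha hb
        simp [ha, hb]
  · simp only [List.getElem?_cons_zero, Option.elim_some, List.getElem?_cons_succ,
      List.getElem?_nil, Option.elim_none] at h₁ h₂
    refine fin _ ?_ ?_ ?_ ?_
    all_goals simp only [setPushes, Cmd.run, Exp.eval, h₁, h₂, hk, ne_eq, reduceCtorEq,
        not_false_eq_true, not_true_eq_false, if_true, if_false, Function.update_of_ne,
        Nat.add_one_ne_zero]
    · simp [UPDA.pushes]
    · intro v ha hb
      simp [ha, hb]
  · simp only [List.getElem?_cons_zero, Option.elim_some, List.getElem?_cons_succ] at h₁ h₂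
    refine fin _ ?_ ?_ ?_ ?_
    all_goals simp only [setPushes, Cmd.run, Exp.eval, h₁, h₂, ne_eq, reduceCtorEq,
        not_false_eq_true, if_true, Function.update_of_ne,
        Nat.add_one_ne_zero]
    · simp [UPDA.pushes]
    · intro v ha hb
      simp [ha, hb]
  · simp at hs

/-- The row of a node for a transition. -/
noncomputable def hitValue (A : UPDA Q Γ) (eQ : Q ≃ Fin n) (eΓ : Γ ≃ Fin k)
    (t : Q × Option Unit × Γ × Q × List Γ) (b : Bool) : ℕ × ℕ × ℕ × ℕ :=
  (if t.2.1 = none then 0 else 1 + (A.promise t.1 b).toNat,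
    (k + 1) * UPDA.stateNum eQ t.2.2.2.1 (decide (t.2.1 = none) && A.promise t.1 b),
    A.pushes eΓ t.2.2.1 t.2.2.2.2)

theorem hitRow_spec {t} (b : Bool) {σ : Store Var} (h : Loaded A eQ eΓ t σ) :
    ∃ τ, (if b then hitRow₁ else hitRow₀).run x σ = τ ∧ Loaded A eQ eΓ t τ ∧
      τ.v pos = σ.v pos ∧ τ.v c = σ.v c ∧ τ.v i = σ.v i ∧
      ∀ j, row τ j = if j = σ.v i then hitValue A eQ eΓ t b else row σ j := by
  obtain ⟨q₁, o, γ, q₂, s'⟩ := t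
  obtain ⟨hp, h₁, h₂, h₃, h₄⟩ := h
  simp only at h₁ h₂ h₃ h₄
  -- What remains in each case is the pair of the output code and the target state; the final
  -- `setRow` is common to all of them.
  have fin : ∀ (u : Store Var), (u.v e, u.v d) = ((hitValue A eQ eΓ (q₁, o, γ, q₂, s') b).1,
      (hitValue A eQ eΓ (q₁, o, γ, q₂, s') b).2.1) →
      u.m = σ.m → u.o = σ.o → (∀ v, v ≠ e → v ≠ d → u.v v = σ.v v) →
      ∃ τ, setRow.run x u = τ ∧ Loaded A eQ eΓ (q₁, o, γ, q₂, s') τ ∧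
      τ.v pos = σ.v pos ∧ τ.v c = σ.v c ∧ τ.v i = σ.v i ∧
      ∀ j, row τ j = if j = σ.v i then hitValue A eQ eΓ (q₁, o, γ, q₂, s') b else row σ j := by
    intro u hu hm ho hv
    obtain ⟨r₁, r₂, r₃, r₄, r₅, r₆⟩ := run_setRow (x := x) u
    have hv' : ∀ v, v ≠ e → v ≠ d → (setRow.run x u).v v = σ.v v := fun v he hd => by
      rw [r₁, hv v he hd]
    refine ⟨_, rfl, ⟨hp.congr (hv' _ (by simp) (by simp)) (hv' _ (by simp) (by simp))
      (hv' _ (by simp) (by simp)) (hv' _ (by simp) (by simp)) (hv' _ (by simp) (by simp))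
      (by rw [r₃, hm]) (by rw [r₄, hm]) (by rw [r₅, hm]) (by rw [r₂, ho]), ?_, ?_, ?_, ?_⟩,
      ?_, ?_, ?_, ?_⟩
    · rwa [hv' _ (by simp) (by simp)]
    · rwa [hv' _ (by simp) (by simp)]
    · rwa [hv' _ (by simp) (by simp)]
    · rwa [hv' a (by simp) (by simp), hv' Var.b (by simp) (by simp)]
    · rw [hv' _ (by simp) (by simp)]
    · rw [hv' _ (by simp) (by simp)]
    · rw [hv' _ (by simp) (by simp)]
    · intro j
      rw [r₆, hv i (by simp) (by simp), hv a (by simp) (by simp), hv Var.b (by simp) (by simp), h₄]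
      simp only [Prod.mk.injEq] at hu
      rw [hu.1, hu.2]
      by_cases hj : j = σ.v i
      · rw [if_pos hj, if_pos hj]; rfl
      · rw [if_neg hj, if_neg hj, row, row, hm]
  rcases o with _ | o
  · simp only [Option.toList_none, List.length_nil] at h₁
    cases b
    · by_cases hq : A.promise q₁ false = true
      · simp only [hq, Bool.toNat_true] at h₃
        simp only [Bool.false_eq_true, if_false, hitRow₀, Cmd.run, Exp.eval, h₁, h₃, h₂, hp.fb,
          ne_eq, reduceCtorEq, one_ne_zero, not_false_eq_true, if_true, not_true_eq_false,
          Function.update_of_ne]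
        refine fin _ ?_ ?_ ?_ ?_
        · simp [hitValue, hq, UPDA.stateNum, mul_add]
        exacts [rfl, rfl, fun v h h' => by simp [h, h']]
      · simp only [hq, Bool.toNat_false] at h₃
        simp only [Bool.false_eq_true, if_false, hitRow₀, Cmd.run, Exp.eval, h₁, h₃, h₂,
          ne_eq, reduceCtorEq, not_false_eq_true, not_true_eq_false,
          Function.update_of_ne]
        refine fin _ ?_ ?_ ?_ ?_
        · simp [hitValue, hq, UPDA.stateNum]
        exacts [rfl, rfl, fun v h h' => by simp [h, h']]
    · simp only [if_true, hitRow₁, Cmd.run, Exp.eval, h₁, h₂, hp.fb,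
          ne_eq, reduceCtorEq, not_false_eq_true, not_true_eq_false, if_false,
          Function.update_of_ne]
      refine fin _ ?_ ?_ ?_ ?_
      · simp [hitValue, UPDA.promise, UPDA.stateNum, mul_add]
      exacts [rfl, rfl, fun v h h' => by simp [h, h']]
  · simp only [Option.toList_some, List.length_cons, List.length_nil, zero_add] at h₁
    cases b
    · simp only [Bool.false_eq_true, if_false, hitRow₀, Cmd.run, Exp.eval, h₁, h₃, h₂,
          ne_eq, reduceCtorEq, one_ne_zero, not_false_eq_true, if_true,
          Function.update_of_ne]
      refine fin _ ?_ ?_ ?_ ?_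
      · simp [hitValue, UPDA.stateNum]
      exacts [rfl, rfl, fun v h h' => by simp [h, h']]
    · simp only [if_true, hitRow₁, Cmd.run, Exp.eval, h₁, h₂,
          ne_eq, reduceCtorEq, one_ne_zero, not_false_eq_true,
          Function.update_of_ne]
      refine fin _ ?_ ?_ ?_ ?_
      · simp [hitValue, UPDA.promise, UPDA.stateNum]
      exacts [rfl, rfl, fun v h h' => by simp [h, h']]

theorem Loaded.congr {t} {σ τ : Store Var} (h : Loaded A eQ eΓ t σ) (hm : τ.m = σ.m)
    (ho : τ.o = σ.o) (hv : ∀ v, v ≠ i → τ.v v = σ.v v) : Loaded A eQ eΓ t τ where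
  params := h.params.congr (hv _ (by simp)) (hv _ (by simp)) (hv _ (by simp)) (hv _ (by simp))
    (hv _ (by simp)) (by rw [hm]) (by rw [hm]) (by rw [hm]) ho
  s := by rw [hv _ (by simp), h.s]
  r := by rw [hv _ (by simp), h.r]
  f := by rw [hv _ (by simp), h.f]
  pushes := by rw [hv _ (by simp), hv b (by simp), h.pushes]

theorem hitRows_spec (hx : Input A eQ eΓ l x) {j : ℕ} {t} (hj : l[j]? = some t)
    (hs : t.2.2.2.2.length ≤ 2) {σ : Store Var} (h : Params n k σ)
    (hpos : σ.v pos = 3 + n + k + 6 * j) :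
    ∃ τ, hitRows.run x σ = τ ∧ Params n k τ ∧ τ.v pos = 3 + n + k + 6 * (j + 1) ∧
      τ.v c = σ.v c ∧ ∀ i, row τ i =
        if i = (k + 1) * UPDA.stateNum eQ t.1 true + eΓ t.2.2.1 then hitValue A eQ eΓ t true
        else if i = (k + 1) * UPDA.stateNum eQ t.1 false + eΓ t.2.2.1 then
          hitValue A eQ eΓ t false
        else row σ i := by
  obtain ⟨τ₁, e₁, l₁, m₁, p₁, c₁, i₁⟩ := load_spec hx hj hs h hpos
  obtain ⟨τ₂, e₂, l₂, p₂, c₂, i₂, r₂⟩ := hitRow_spec (x := x) false l₁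
  have l₃ : Loaded A eQ eΓ t
      ((Cmd.assign i (.add (.var i) (.var fb))).run x τ₂) :=
    l₂.congr rfl rfl fun v hv => by simp [Cmd.run, hv]
  obtain ⟨τ₄, e₄, l₄, p₄, c₄, i₄, r₄⟩ := hitRow_spec (x := x) true l₃
  refine ⟨_, rfl, ?_⟩
  have : hitRows.run x σ = (Cmd.assign pos (.add (.var pos) (.const 6))).run x τ₄ := by
    rw [← e₄, ← e₂, ← e₁]
    rfl
  rw [this]
  refine ⟨l₄.params.congr (by simp [Cmd.run]) (by simp [Cmd.run]) (by simp [Cmd.run])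
    (by simp [Cmd.run]) (by simp [Cmd.run]) rfl rfl rfl rfl, ?_, ?_, fun i' => ?_⟩
  · simp only [Cmd.run, Exp.eval, Function.update_self, p₄]
    simp [p₂, p₁, hpos]
    ring
  · simp [Cmd.run, c₄, c₂, c₁]
  · have e : ∀ i', row ((Cmd.assign i (.add (.var i) (.var fb))).run x τ₂) i' = row τ₂ i' :=
      fun _ => rfl
    have e' : row ((Cmd.assign pos (.add (.var pos) (.const 6))).run x τ₄) i' = row τ₄ i' := rfl
    rw [e', r₄, e, r₂]
    simp only [Cmd.run, Exp.eval, Function.update_self, i₂, i₁, l₂.params.fb, UPDA.stateNum,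
      if_true, Bool.false_eq_true, if_false, add_zero]
    -- The copy of a state with a promise lies `n` states, that is `(k + 1) * n` nodes, further on.
    have e₅ : (k + 1) * (eQ t.1 : ℕ) + eΓ t.2.2.1 + (k + 1) * n =
      (k + 1) * (eQ t.1 + n) + eΓ t.2.2.1 := by ring
    rw [e₅]
    have e₆ : row τ₁ i' = row σ i' := by rw [row, row, m₁]
    rw [e₆]

end FromAutomaton

end RAM

/-! ### Correctness of the tables -/

namespace RAM

namespace FromAutomaton

open Var

variable {Q Γ : Type} {n k : ℕ} {A : UPDA Q Γ} {eQ : Q ≃ Fin n} {eΓ : Γ ≃ Fin k}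
  {l : List (Q × Option Unit × Γ × Q × List Γ)} {x : List ℕ}

theorem stateNum_inj {q q' : Q} {b b' : Bool} :
    UPDA.stateNum eQ q b = UPDA.stateNum eQ q' b' ↔ q = q' ∧ b = b' := by
  constructor
  · intro h
    have h₁ := (eQ q).2
    have h₂ := (eQ q').2
    have hb : b = b' := by
      cases b <;> cases b' <;> simp [UPDA.stateNum] at h ⊢ <;> omega
    subst hb
    refine ⟨eQ.injective (Fin.ext ?_), rfl⟩
    simpa [UPDA.stateNum] using h
  · rintro ⟨rfl, rfl⟩; rfl

theorem state_node_inj {q q' : Q} {b b' : Bool} {γ γ' : Γ} :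
    (k + 1) * UPDA.stateNum eQ q b + eΓ γ = (k + 1) * UPDA.stateNum eQ q' b' + eΓ γ' ↔
      q = q' ∧ b = b' ∧ γ = γ' := by
  rw [node_inj (by omega) (by omega), stateNum_inj, and_assoc, ← Fin.ext_iff,
    eΓ.injective.eq_iff]

/-- Determinism speaks of moves, not of transitions: at `⊥`, writing nothing and writing `⊥` are the
same move. The row does not distinguish them, so the order in which transitions are entered is
irrelevant. -/
theorem hitValue_eq (hA : A.Deterministic) {t t'} (ht : t ∈ A.trans) (ht' : t' ∈ A.trans)
    (hq : t.1 = t'.1) (hγ : t.2.2.1 = t'.2.2.1) (b : Bool) :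
    hitValue A eQ eΓ t b = hitValue A eQ eΓ t' b := by
  obtain ⟨q, o, γ, q₂, s⟩ := t
  obtain ⟨q', o', γ', q₂', s'⟩ := t'
  simp only at hq hγ
  subst hq hγ
  have hc : ∃ st, A.IsConfig (q, γ :: st) := by
    by_cases h : γ = A.bot
    · exact ⟨[], [], by simp, by simp [h]⟩
    · exact ⟨[A.bot], [γ], by simpa using fun h' => h h'.symm, rfl⟩
  obtain ⟨st, hc⟩ := hc
  obtain ⟨rfl, h⟩ := hA _ _ _ _ _ (UPDA.exists_move ht hc) (UPDA.exists_move ht' hc)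
  simp only [Prod.mk.injEq, List.append_cancel_right_eq] at h
  obtain ⟨rfl, h⟩ := h
  suffices h : A.pushes eΓ γ s = A.pushes eΓ γ s' by
    simp only [hitValue, h]
  by_cases hγ : γ = A.bot
  · subst hγ
    have key : ∀ s, A.pushes eΓ A.bot (open Classical in if s = [] then [A.bot] else s) =
        A.pushes eΓ A.bot s := by
      intro s
      by_cases h : s = []
      · simp [h, UPDA.pushes]
      · simp [h]
    simp only [true_and] at h
    rw [← key s, ← key s', h]
  · simp only [hγ, false_and, if_false] at h
    rw [h]

/-- The transitions in the list have been entered into the tables. -/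
structure Entered (A : UPDA Q Γ) (eQ : Q ≃ Fin n) (eΓ : Γ ≃ Fin k)
    (l : List (Q × Option Unit × Γ × Q × List Γ)) (x : List ℕ) (σ : Store Var) : Prop where
  params : Params n k σ
  miss : ∀ q b γ, (∀ t ∈ l, t.1 = q → t.2.2.1 ≠ γ) →
    row σ ((k + 1) * UPDA.stateNum eQ q b + eΓ γ) = missValue x n k (UPDA.stateNum eQ q b) (eΓ γ)
  hit : ∀ b, ∀ t ∈ l, row σ ((k + 1) * UPDA.stateNum eQ t.1 b + eΓ t.2.2.1) = hitValue A eQ eΓ t b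
  dead : ∀ g < k, row σ ((k + 1) * (2 * n) + g) = missValue x n k (2 * n) g

theorem allHitRows_spec (hx : Input A eQ eΓ l x) (hl : ∀ t ∈ l, t ∈ A.trans)
    (hA : A.Deterministic) (hs : A.IsShort) {σ : Store Var} (h : Entered A eQ eΓ [] x σ) :
    Entered A eQ eΓ l x (allHitRows.run x σ) := by
  have hlen := hx.length
  rw [allHitRows, Cmd.run]
  -- There are more iterations than transitions; once `pos` has reached the end of the input the
  -- surplus ones do nothing, hence the minimum in the invariant.
  have key := Cmd.upto_inv (x := x) (c := c) (b := .len) (p := .ite (.sub .len (.var pos)) hitRows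
      .skip) (fun r σ => Entered A eQ eΓ (l.take r) x σ ∧
        σ.v pos = 3 + n + k + 6 * min r l.length) (N := x.length)
    (σ := (Cmd.assign pos (.add (.const 3) (.add (.var Var.n) (.var Var.k)))).run x σ)
    (Nat.le_self_pow (by norm_num) _) (fun _ _ _ => rfl) ?_ ?_ ?_
  · rw [List.take_of_length_le (by omega)] at key
    exact key.1
  · rintro r σ m ⟨⟨h₁, h₂, h₃, h₄⟩, h₅⟩
    exact ⟨⟨h₁.congr (by simp) (by simp) (by simp) (by simp) (by simp) rfl rfl rfl rfl,
      h₂, h₃, h₄⟩, by simpa using h₅⟩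
  · rintro r σ - ⟨h₁, h₂⟩ hc
    by_cases hr : r < l.length
    · obtain ⟨t, ht⟩ : ∃ t, l[r]? = some t := ⟨_, List.getElem?_eq_getElem hr⟩
      have htm := hl t (List.mem_of_getElem? ht)
      rw [min_eq_left hr.le] at h₂
      have hpos : (Exp.sub .len (.var pos)).eval x σ ≠ 0 := by
        simp only [Exp.eval, h₂]; omega
      rw [Cmd.run, if_pos hpos, min_eq_left (show r + 1 ≤ l.length from hr)]
      obtain ⟨τ, e, t₁, t₂, t₃, t₄⟩ := hitRows_spec hx ht (hs _ _ _ _ _ htm) h₁.params h₂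
      have htake : l.take (r + 1) = l.take r ++ [t] := by
        rw [List.take_add_one, ht]; rfl
      have hrow : ∀ q b γ, row τ ((k + 1) * UPDA.stateNum eQ q b + eΓ γ) =
          open Classical in if q = t.1 ∧ γ = t.2.2.1 then hitValue A eQ eΓ t b else
            row σ ((k + 1) * UPDA.stateNum eQ q b + eΓ γ) := by
        intro q b γ
        rw [t₄]
        by_cases hc : q = t.1 ∧ γ = t.2.2.1
        · rw [if_pos hc]
          obtain ⟨rfl, rfl⟩ := hc
          cases b
          · rw [if_neg (by rw [state_node_inj]; simp), if_pos rfl]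
          · rw [if_pos rfl]
        · rw [if_neg (by rw [state_node_inj]; tauto), if_neg (by rw [state_node_inj]; tauto),
            if_neg hc]
      rw [e]
      refine ⟨t₃.trans hc, ⟨t₁, ?_, ?_, ?_⟩, t₂⟩
      · intro q b γ hm
        rw [htake] at hm
        rw [hrow, if_neg, h₁.miss]
        · exact fun t' ht' => hm t' (by simp [ht'])
        · rintro ⟨rfl, rfl⟩
          exact hm t (by simp) rfl rfl
      · intro b t' ht'
        rw [hrow]
        split_ifs with hc
        · exact hitValue_eq hA htm (hl _ (List.mem_of_mem_take ht')) hc.1.symm hc.2.symm b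
        · rw [htake, List.mem_append, List.mem_singleton] at ht'
          rcases ht' with ht' | rfl
          · exact h₁.hit b t' ht'
          · exact (hc ⟨rfl, rfl⟩).elim
      · intro g hg
        rw [t₄, if_neg, if_neg, h₁.dead g hg]
        all_goals
          rw [node_inj (by omega) (by have := (eΓ t.2.2.1).2; omega)]
          have := UPDA.stateNum_lt eQ t.1 true
          have := UPDA.stateNum_lt eQ t.1 false
          omega
    · rw [min_eq_right (by omega)] at h₂
      have hpos : (Exp.sub .len (.var pos)).eval x σ = 0 := by
        simp only [Exp.eval, h₂]; omega
      rw [Cmd.run, if_neg (by simp [hpos]), Cmd.run, min_eq_right (by omega),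
        List.take_of_length_le (by omega)]
      rw [List.take_of_length_le (by omega)] at h₁
      exact ⟨hc, h₁, h₂⟩
  · obtain ⟨h₁, h₂, h₃, h₄⟩ := h
    refine ⟨⟨h₁.congr (by simp [Cmd.run]) (by simp [Cmd.run]) (by simp [Cmd.run])
      (by simp [Cmd.run]) (by simp [Cmd.run]) rfl rfl rfl rfl, h₂, h₃, h₄⟩, ?_⟩
    simp [Cmd.run, Exp.eval, h₁.n, h₁.k]
    ring

/-- The tables in the store. -/
def storeTables (n k : ℕ) (σ : Store Var) : Tables :=
  ⟨n, k, σ.m .emit, σ.m .base, σ.m .push₁, σ.m .push₂⟩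

theorem Entered.models (hx : Input A eQ eΓ l x) (hl : ∀ t, t ∈ l ↔ t ∈ A.trans) {σ : Store Var}
    (h : Entered A eQ eΓ l x σ) : A.Models eQ eΓ (storeTables n k σ) where
  n_eq := rfl
  k_eq := rfl
  hit := by
    rintro q o γ q₂ s ht b _ rfl
    exact h.hit b _ ((hl _).2 ht)
  miss := by
    rintro q γ hm b _ rfl
    refine (h.miss q b γ ?_).trans ?_
    · rintro ⟨q', o, γ', q₂, s⟩ ht rfl rfl
      exact hm _ _ _ ((hl _).1 ht)
    · have hq := (eQ q).2
      cases b
      · have := hx.final q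
        simp only [missValue, UPDA.stateNum, Bool.false_eq_true, if_false, add_zero, hq, if_true, this]
      · simp [missValue, UPDA.stateNum, UPDA.promise]
        omega
  dead := by
    rintro g hg _ rfl
    refine (h.dead g hg).trans ?_
    simp only [missValue, lt_irrefl, if_false, show ¬ 2 * n < n by omega]

/-- The left-hand side bounds the number of productions and exceeds the number of nodes, so the
cubic loops cover everything that is to be done. -/
theorem Input.bound (hx : Input A eQ eΓ l x) :
    6 * ((2 * n + 1) * (k + 1)) + 3 ≤ x.length ^ 3 := by
  have h : n + k + 3 ≤ x.length := by have := hx.length; omega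
  calc 6 * ((2 * n + 1) * (k + 1)) + 3 ≤ (n + k + 3) ^ 3 := by
        have : (n + k + 3) ^ 3 = (n + k) ^ 3 + 9 * n ^ 2 + 9 * k ^ 2 + 18 * (n * k) + 27 * n +
          27 * k + 27 := by ring
        have : 6 * ((2 * n + 1) * (k + 1)) + 3 = 12 * (n * k) + 12 * n + 6 * k + 9 := by ring
        have := Nat.zero_le ((n + k) ^ 3)
        have := Nat.zero_le (n ^ 2)
        have := Nat.zero_le (k ^ 2)
        omega
    _ ≤ _ := Nat.pow_le_pow_left h 3

theorem tables_spec (hx : Input A eQ eΓ l x) (hl : ∀ t, t ∈ l ↔ t ∈ A.trans)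
    (hA : A.Deterministic) (hs : A.IsShort) :
    ∃ σ, tables.run x Store.init = σ ∧ Params n k σ ∧ A.Models eQ eΓ (storeTables n k σ) := by
  have hb := hx.bound
  have hn : 2 * n + 1 ≤ x.length ^ 3 := by nlinarith
  have hk : k ≤ x.length ^ 3 := by nlinarith
  have h₁ := setup_spec hn hx.states hx.symbols
  obtain ⟨h₂, h₃⟩ := missRows_spec hn hk h₁
  have h₄ := allHitRows_spec hx (fun t ht => (hl t).1 ht) hA hs
    ⟨h₂, fun q b γ _ => h₃ _ (UPDA.stateNum_lt eQ q b).le _ (eΓ γ).2, by simp,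
      fun g hg => h₃ _ le_rfl g hg⟩
  exact ⟨_, rfl, h₄.params, h₄.models hx hl⟩

end FromAutomaton

end RAM

/-! ### Straight-line programs in arrays -/

namespace RAM

/-- The word generated from the nonterminal with number `j`, for a grammar whose productions are
given by two functions: `L j = 0` for a terminal `R j`, and otherwise the right-hand side consists
of the nonterminals `L j - 1` and `R j - 1`. -/
def arrayVal (L R : ℕ → ℕ) (j : ℕ) : List Bool :=
  if _h : (0 < L j ∧ L j ≤ j) ∧ 0 < R j ∧ R j ≤ j then
    arrayVal L R (L j - 1) ++ arrayVal L R (R j - 1)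
  else [R j ≠ 0]
termination_by j
decreasing_by all_goals omega

/-- The word with number `r`: numbers are shifted by one, to include the empty word. -/
def arrayWord (L R : ℕ → ℕ) : ℕ → List Bool
  | 0 => []
  | j + 1 => arrayVal L R j

theorem arrayVal_ne_nil {L R : ℕ → ℕ} (j : ℕ) : arrayVal L R j ≠ [] := by
  induction j using Nat.strong_induction_on with
  | _ j ih =>
    rw [arrayVal]
    split_ifs with h
    · simp [ih (L j - 1) (by omega)]
    · simp

theorem arrayWord_eq_nil {L R : ℕ → ℕ} {r : ℕ} : arrayWord L R r = [] ↔ r = 0 := by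
  rcases r with _ | j
  · simp [arrayWord]
  · simp [arrayWord, arrayVal_ne_nil]

theorem arrayVal_congr {L R L' R' : ℕ → ℕ} {N : ℕ} (hL : ∀ j < N, L j = L' j)
    (hR : ∀ j < N, R j = R' j) {j : ℕ} (hj : j < N) : arrayVal L R j = arrayVal L' R' j := by
  induction j using Nat.strong_induction_on with
  | _ j ih =>
    rw [arrayVal, arrayVal.eq_1 L', hL j hj, hR j hj]
    split_ifs with h
    · rw [ih _ (by omega) (by omega), ih _ (by omega) (by omega)]
    · rfl

theorem arrayWord_congr {L R L' R' : ℕ → ℕ} {N : ℕ} (hL : ∀ j < N, L j = L' j)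
    (hR : ∀ j < N, R j = R' j) {r : ℕ} (hr : r ≤ N) : arrayWord L R r = arrayWord L' R' r := by
  rcases r with _ | j
  · rfl
  · exact arrayVal_congr hL hR hr

/-- The first `N` productions form a straight-line program, which starts with the terminals. -/
structure IsGrammar (L R : ℕ → ℕ) (N : ℕ) : Prop where
  left : ∀ j < N, L j ≤ j
  right : ∀ j < N, R j ≤ j
  zero_or : ∀ j < N, (L j = 0 ∧ R j ≤ 1) ∨ (0 < L j ∧ 0 < R j)
  false : L 0 = 0 ∧ R 0 = 0
  true : L 1 = 0 ∧ R 1 = 1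
  two_le : 2 ≤ N

namespace IsGrammar

variable {L R : ℕ → ℕ} {N : ℕ}

/-- The codes of output bits coincide with the shifted numbers of the two terminals, so an entry of
`emit` serves directly as the number of a word. -/
theorem word_bits (h : IsGrammar L R N) {e : ℕ} (he : e ≤ 2) :
    arrayWord L R e = Tables.bits e := by
  have h₁ := h.false
  have h₂ := h.true
  interval_cases e
  · rfl
  · simp [arrayWord, arrayVal, Tables.bits, h₁]
  · simp [arrayWord, arrayVal, Tables.bits, h₂]

theorem rule_lt (h : IsGrammar L R N) (j : Fin N) : L j - 1 < N ∧ R j - 1 < N := by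
  have h₁ := h.left j j.2
  have h₂ := h.right j j.2
  omega

/-- The straight-line program. -/
def slp (h : IsGrammar L R N) (s : Fin N) : SLP Bool (Fin N) where
  start := s
  prod j := if L j = 0 then [.inl (R j ≠ 0)] else
    [.inr ⟨L j - 1, (h.rule_lt j).1⟩, .inr ⟨R j - 1, (h.rule_lt j).2⟩]
  acyclic := by
    -- Right-hand sides mention smaller numbers only.
    have key : ∀ D j : Fin N, Relation.TransGen (fun D j : Fin N => Sum.inr D ∈
        (if L j = 0 then [Sum.inl (decide (R j ≠ 0))] else
        [.inr ⟨L j - 1, (h.rule_lt j).1⟩, .inr ⟨R j - 1, (h.rule_lt j).2⟩] :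
          List (Bool ⊕ Fin N))) D j → D < j := by
      intro D j hD
      have one : ∀ D j : Fin N, Sum.inr D ∈
        (if L j = 0 then [Sum.inl (decide (R j ≠ 0))] else
        [.inr ⟨L j - 1, (h.rule_lt j).1⟩, .inr ⟨R j - 1, (h.rule_lt j).2⟩] :
          List (Bool ⊕ Fin N)) → D < j := by
        intro D j hD
        have h₁ := h.left j j.2
        have h₂ := h.right j j.2
        have h₃ := h.zero_or j j.2
        split_ifs at hD with hL
        · simp at hD
        · simp only [List.mem_cons, Sum.inr.injEq, List.not_mem_nil, or_false] at hD
          rcases hD with rfl | rfl <;> · rw [Fin.lt_def]; simp only; omega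
      induction hD with
      | single h' => exact one _ _ h'
      | tail _ h' ih => exact ih.trans (one _ _ h')
    exact fun j hj => lt_irrefl _ (key j j hj)

theorem slp_isCNF (h : IsGrammar L R N) (s : Fin N) : (h.slp s).IsCNF := by
  intro j
  by_cases hL : L j = 0
  · exact Or.inl ⟨_, if_pos hL⟩
  · exact Or.inr ⟨_, _, if_neg hL⟩

theorem slp_hasSize (h : IsGrammar L R N) (s : Fin N) : (h.slp s).HasSize N :=
  ⟨h.slp_isCNF s, by simp⟩

theorem slp_val (h : IsGrammar L R N) (s : Fin N) (j : ℕ) (hj : j < N) :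
    (h.slp s).val ⟨j, hj⟩ = arrayVal L R j := by
  induction j using Nat.strong_induction_on with
  | _ j ih =>
    have h₁ := h.left j hj
    have h₂ := h.right j hj
    have h₃ := h.zero_or j hj
    rw [arrayVal]
    by_cases hL : L j = 0
    · rw [dif_neg (by omega)]
      exact SLP.val_terminal (if_pos hL)
    · rw [dif_pos (by omega), ← ih _ (by omega) (by omega), ← ih _ (by omega) (by omega)]
      exact SLP.val_pair (if_neg hL)

theorem slp_str (h : IsGrammar L R N) {r : ℕ} (hr : r - 1 < N) (h0 : r ≠ 0) :
    (h.slp ⟨r - 1, hr⟩).str = arrayWord L R r := by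
  obtain ⟨j, rfl⟩ := Nat.exists_eq_succ_of_ne_zero h0
  exact h.slp_val _ _ _

theorem slp_isCode (h : IsGrammar L R N) (s : Fin N) :
    (h.slp s).IsCode ([N, (s : ℕ)] ++ (List.range N).flatMap fun j => [L j, R j]) := by
  refine ⟨h.slp_isCNF s, N, Equiv.refl _, fun j => (L j, R j), ?_, ?_, ?_⟩
  · intro j b hj
    have h₃ := h.zero_or j j.2
    by_cases hL : L j = 0
    · have e : (h.slp s).prod j = [.inl (decide (R j ≠ 0))] := if_pos hL
      rw [hj] at e
      simp only [List.cons.injEq, Sum.inl.injEq, and_true] at e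
      subst e
      have hR : R j = 0 ∨ R j = 1 := by omega
      rcases hR with hR | hR <;> simp [hL, hR]
    · have e : (h.slp s).prod j = [.inr _, .inr _] := if_neg hL
      rw [hj] at e
      simp at e
  · intro j A B hj
    have h₃ := h.zero_or j j.2
    by_cases hL : L j = 0
    · have e : (h.slp s).prod j = [.inl (decide (R j ≠ 0))] := if_pos hL
      rw [hj] at e
      simp at e
    · have e : (h.slp s).prod j = [.inr _, .inr _] := if_neg hL
      rw [hj] at e
      simp only [List.cons.injEq, Sum.inr.injEq, and_true] at e
      obtain ⟨rfl, rfl⟩ := e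
      simp only [Equiv.refl_apply]
      rw [Nat.sub_add_cancel (by omega), Nat.sub_add_cancel (by omega)]
  · rw [List.ofFn_eq_map, List.flatMap_map]
    exact congrArg _ (List.flatMap_finRange N fun j => [L j, R j]).symm

theorem push (h : IsGrammar L R N) {a b : ℕ} (ha : a ≤ N) (hb : b ≤ N) (ha' : a ≠ 0) (hb' : b ≠ 0) :
    IsGrammar (Function.update L N a) (Function.update R N b) (N + 1) := by
  have h2 := h.two_le
  have hu : ∀ (f : ℕ → ℕ) c j, Function.update f N c j = if j = N then c else f j :=
    fun f c j => Function.update_apply ..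
  constructor
  · intro j hj
    rw [hu]
    split_ifs with e
    exacts [e ▸ ha, h.left j (by omega)]
  · intro j hj
    rw [hu]
    split_ifs with e
    exacts [e ▸ hb, h.right j (by omega)]
  · intro j hj
    rw [hu, hu]
    split_ifs with e
    exacts [by omega, h.zero_or j (by omega)]
  · rw [hu, hu, if_neg (by omega), if_neg (by omega)]; exact h.false
  · rw [hu, hu, if_neg (by omega), if_neg (by omega)]; exact h.true
  · omega

theorem push_word {r : ℕ} (hr : r ≤ N) (a b : ℕ) :
    arrayWord (Function.update L N a) (Function.update R N b) r = arrayWord L R r :=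
  arrayWord_congr (fun _ hj => Function.update_of_ne hj.ne _ _)
    (fun _ hj => Function.update_of_ne hj.ne _ _) hr

/-- The new production has number `N`, hence its word has number `N + 1`; its factors keep their
meaning because they use older productions only. -/
theorem push_new {a b : ℕ} (ha : a ≤ N) (hb : b ≤ N) (ha' : a ≠ 0) (hb' : b ≠ 0) :
    arrayWord (Function.update L N a) (Function.update R N b) (N + 1) =
      arrayWord L R a ++ arrayWord L R b := by
  rw [← push_word (L := L) (R := R) ha a b, ← push_word (L := L) (R := R) hb a b]
  conv_lhs => rw [arrayWord, arrayVal]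
  simp only [Function.update_self]
  rw [dif_pos (by omega)]
  obtain ⟨a, rfl⟩ := Nat.exists_eq_succ_of_ne_zero ha'
  obtain ⟨b, rfl⟩ := Nat.exists_eq_succ_of_ne_zero hb'
  rfl

end IsGrammar

/-! ### Concatenation of words in the stored grammar -/

namespace FromAutomaton

open Var

variable {x : List ℕ}

/-- Make `cr` the number of the concatenation of the words with the numbers `ca` and `cb`. -/
def catVars : Cmd Var :=
  .ite (.var ca) (.ite (.var cb)
    (.seq (.store .left (.var pc) (.var ca)) <| .seq (.store .right (.var pc) (.var cb)) <|
      .seq (.assign pc (.add (.var pc) (.const 1))) (.assign cr (.var pc)))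
    (.assign cr (.var ca))) (.assign cr (.var cb))

/-- Make `cr` the number of the concatenation of the words with the numbers `e` and `f`. -/
def cat (e f : Exp Var) : Cmd Var := .seq (.assign ca e) (.seq (.assign cb f) catVars)

/-- The word with number `r`. -/
def Store.word (σ : Store Var) (r : ℕ) : List Bool := arrayWord (σ.m .left) (σ.m .right) r

/-- The grammar in the store. -/
def Store.Grammar (σ : Store Var) : Prop := IsGrammar (σ.m .left) (σ.m .right) (σ.v pc)

/-- The store `τ` is obtained from `σ` by extending the grammar by at most `c` productions, and
changing the variables `V`. -/
structure Extends (c : ℕ) (V : Set Var) (σ τ : Store Var) : Prop where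
  grammar : Store.Grammar τ
  pc_le : τ.v pc ≤ σ.v pc + c
  le_pc : σ.v pc ≤ τ.v pc
  word : ∀ r ≤ σ.v pc, Store.word τ r = Store.word σ r
  m : ∀ a, a ≠ .left → a ≠ .right → τ.m a = σ.m a
  o : τ.o = σ.o
  v : ∀ v, v ≠ pc → v ∉ V → τ.v v = σ.v v

theorem Extends.trans {c c' : ℕ} {V V' : Set Var} {σ τ υ : Store Var} (h : Extends c V σ τ)
    (h' : Extends c' V' τ υ) : Extends (c + c') (V ∪ V') σ υ where
  grammar := h'.grammar
  pc_le := by have := h.pc_le; have := h'.pc_le; omega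
  le_pc := h.le_pc.trans h'.le_pc
  word r hr := (h'.word r (hr.trans h.le_pc)).trans (h.word r hr)
  m a hl hr := (h'.m a hl hr).trans (h.m a hl hr)
  o := h'.o.trans h.o
  v v hv hV := by
    rw [Set.mem_union, not_or] at hV
    exact (h'.v v hv hV.2).trans (h.v v hv hV.1)

theorem Extends.mono {c c' : ℕ} {V V' : Set Var} {σ τ : Store Var} (h : Extends c V σ τ)
    (hc : c ≤ c') (hV : V ⊆ V') : Extends c' V' σ τ where
  grammar := h.grammar
  pc_le := h.pc_le.trans (by omega)
  le_pc := h.le_pc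
  word := h.word
  m := h.m
  o := h.o
  v v hv hv' := h.v v hv fun h => hv' (hV h)

theorem Extends.assign {σ : Store Var} (h : Store.Grammar σ) {w : Var} (hw : w ≠ pc) (e : Exp Var) :
    Extends 0 {w} σ ((Cmd.assign w e).run x σ) where
  grammar := by simpa [Store.Grammar, Cmd.run, hw.symm] using h
  pc_le := by simp [Cmd.run, hw.symm]
  le_pc := by simp [Cmd.run, hw.symm]
  word r hr := rfl
  m a hl hr := rfl
  o := rfl
  v v _ hV := by simp [Cmd.run, show v ≠ w from hV]

/-- The empty word has number 0 and no nonterminal, so a concatenation with it returns the other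
factor; only two nonempty factors cost a production. -/
theorem catVars_spec {σ : Store Var} (h : Store.Grammar σ) (ha : σ.v ca ≤ σ.v pc)
    (hb : σ.v cb ≤ σ.v pc) : Extends 1 {cr} σ (catVars.run x σ) ∧
      (catVars.run x σ).v cr ≤ (catVars.run x σ).v pc ∧
      Store.word (catVars.run x σ) ((catVars.run x σ).v cr) =
        Store.word σ (σ.v ca) ++ Store.word σ (σ.v cb) := by
  by_cases ha' : σ.v ca = 0
  · have e : catVars.run x σ = (Cmd.assign cr (.var cb)).run x σ := by
      simp [catVars, Cmd.run, Exp.eval, ha']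
    rw [e]
    refine ⟨(Extends.assign h (by simp) _).mono (by simp) subset_rfl, ?_, ?_⟩
    · simpa [Cmd.run, Exp.eval] using hb
    · simp [Cmd.run, Exp.eval, ha', Store.word, arrayWord]
  by_cases hb' : σ.v cb = 0
  · have e : catVars.run x σ = (Cmd.assign cr (.var ca)).run x σ := by
      simp [catVars, Cmd.run, Exp.eval, ha', hb']
    rw [e]
    refine ⟨(Extends.assign h (by simp) _).mono (by simp) subset_rfl, ?_, ?_⟩
    · simpa [Cmd.run, Exp.eval] using ha
    · simp [Cmd.run, Exp.eval, hb', Store.word, arrayWord]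
  rw [catVars, Cmd.run, if_pos (by simp [Exp.eval, ha']), Cmd.run,
    if_pos (by simp [Exp.eval, hb'])]
  simp only [Cmd.run, Exp.eval]
  refine ⟨⟨?_, ?_, ?_, ?_, ?_, ?_, ?_⟩, ?_, ?_⟩
  · simpa [Store.Grammar] using h.push ha hb ha' hb'
  · simp
  · simp
  · intro r hr
    simpa [Store.word] using IsGrammar.push_word hr (σ.v ca) (σ.v cb)
  · intro a hl hr
    simp [hl, hr]
  · rfl
  · intro v hv hV
    simp [show v ≠ cr from hV, hv]
  · simp
  · simpa [Store.word] using IsGrammar.push_new ha hb ha' hb'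

/-- The second expression is evaluated after `ca` has been overwritten, which the hypothesis on `f`
reflects; `f` may still refer to an earlier result in `cr`. -/
theorem cat_spec {σ : Store Var} (h : Store.Grammar σ) {e f : Exp Var} {a b : ℕ}
    (he : e.eval x σ = a) (hf : f.eval x ((Cmd.assign ca e).run x σ) = b) (ha : a ≤ σ.v pc)
    (hb : b ≤ σ.v pc) : ∃ τ, (cat e f).run x σ = τ ∧ Extends 1 {ca, cb, cr} σ τ ∧
      τ.v cr ≤ τ.v pc ∧ Store.word τ (τ.v cr) = Store.word σ a ++ Store.word σ b := by
  have h₁ := Extends.assign (x := x) h (show ca ≠ pc by simp) e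
  have h₂ := Extends.assign (x := x) h₁.grammar (show cb ≠ pc by simp) f
  have va : ((Cmd.assign cb f).run x ((Cmd.assign ca e).run x σ)).v ca = a := by
    simp [Cmd.run, he]
  have vb : ((Cmd.assign cb f).run x ((Cmd.assign ca e).run x σ)).v cb = b := by
    rw [← hf]; simp [Cmd.run]
  have vp : ((Cmd.assign cb f).run x ((Cmd.assign ca e).run x σ)).v pc = σ.v pc := by
    simp [Cmd.run]
  obtain ⟨h₃, h₄, h₅⟩ := catVars_spec (x := x) h₂.grammar (by rw [va, vp]; exact ha)
    (by rw [vb, vp]; exact hb)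
  refine ⟨_, rfl, ((h₁.trans h₂).trans h₃).mono (by simp) ?_, h₄, ?_⟩
  · intro v
    simp
    tauto
  · rw [va, vb] at h₅
    exact h₅

end FromAutomaton

end RAM

/-! ### Resolving nodes -/

namespace RAM

namespace FromAutomaton

open Var

variable {x : List ℕ} {T : Tables} {bot : ℕ}

/-- Try to resolve the node `i`, that is, to find out where its symbol is removed. -/
def resolve : Cmd Var :=
  .ite (.arr .exit (.var i)) .skip <|
  .seq (.assign j (.add (.arr .base (.var i)) (.arr .push₁ (.var i)))) <|
  .ite (.arr .exit (.var j))
    (.seq (.assign b (.add (.sub (.arr .exit (.var j)) (.const 1)) (.arr .push₂ (.var i)))) <|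
    .ite (.arr .exit (.var b))
      (.seq (cat (.arr .word (.var j)) (.arr .word (.var b))) <|
      .seq (cat (.arr .emit (.var i)) (.var cr)) <|
      .seq (.store .word (.var i) (.var cr)) (.store .exit (.var i) (.arr .exit (.var b))))
      .skip) .skip

/-- Resolve as many nodes as possible. -/
def resolveAll : Cmd Var := .upto rnd (.var nn) (.upto i (.var nn) resolve)

/-- The nodes that have been resolved are described correctly in the store. -/
structure Resolved (T : Tables) (bot : ℕ) (σ : Store Var) : Prop where
  grammar : Store.Grammar σ
  emit : σ.m .emit = T.emit
  base : σ.m .base = T.base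
  push₁ : σ.m .push₁ = T.push₁
  push₂ : σ.m .push₂ = T.push₂
  nn : σ.v nn = T.size
  idle : ∀ i < T.size, i % (T.k + 1) = T.k → σ.m .exit i ≠ 0
  not_bot : ∀ i < T.size, i % (T.k + 1) = bot → σ.m .exit i = 0
  word_le : ∀ i < T.size, σ.m .exit i ≠ 0 → σ.m .word i ≤ σ.v pc
  exit_dvd : ∀ i < T.size, σ.m .exit i ≠ 0 → ∃ c ≤ 2 * T.n, σ.m .exit i = (T.k + 1) * c + 1
  pops : ∀ i < T.size, σ.m .exit i ≠ 0 →
    T.Pops i (Store.word σ (σ.m .word i)) (σ.m .exit i - 1)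

/-- The number of nodes that have been resolved. -/
def resolvedCount (T : Tables) (f : ℕ → ℕ) : ℕ := ((Finset.range T.size).filter (f · ≠ 0)).card

/-- The node cannot be resolved at once. -/
def IsStable (T : Tables) (f : ℕ → ℕ) (i : ℕ) : Prop :=
  f i = 0 → f (T.base i + T.push₁ i) ≠ 0 →
    f (f (T.base i + T.push₁ i) - 1 + T.push₂ i) = 0

theorem Resolved.congr {σ τ : Store Var} {c : ℕ} {V : Set Var} (h : Resolved T bot σ)
    (he : Extends c V σ τ) (hV : Var.nn ∉ V) : Resolved T bot τ := by
  have hw : τ.m .word = σ.m .word := he.m _ (by simp) (by simp)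
  have hx : τ.m .exit = σ.m .exit := he.m _ (by simp) (by simp)
  constructor
  · exact he.grammar
  · rw [he.m _ (by simp) (by simp), h.emit]
  · rw [he.m _ (by simp) (by simp), h.base]
  · rw [he.m _ (by simp) (by simp), h.push₁]
  · rw [he.m _ (by simp) (by simp), h.push₂]
  · rw [he.v _ (by simp) hV, h.nn]
  · rw [hx]; exact h.idle
  · rw [hx]; exact h.not_bot
  · rw [hx, hw]; exact fun i hi hi' => (h.word_le i hi hi').trans he.le_pc
  · rw [hx]; exact h.exit_dvd
  · rw [hx, hw]
    intro i hi hi'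
    rw [he.word _ (h.word_le i hi hi')]
    exact h.pops i hi hi'

theorem resolvedCount_update {f : ℕ → ℕ} {i c : ℕ} (hi : i < T.size) (hf : f i = 0) (hc : c ≠ 0) :
    resolvedCount T (Function.update f i c) = resolvedCount T f + 1 := by
  have : (Finset.range T.size).filter (Function.update f i c · ≠ 0) =
      insert i ((Finset.range T.size).filter (f · ≠ 0)) := by
    ext j
    by_cases h : j = i
    · simp [h, hi, hc]
    · simp [h]
  rw [resolvedCount, this, Finset.card_insert_of_notMem (by simp [hf]), resolvedCount]

/-- Either nothing can be done for the node, or one more node becomes resolved at the price of two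
concatenations. The amortized bound on productions rests on this alternative: unsuccessful attempts
are free. -/
theorem resolve_spec (hT : T.Valid bot) {σ : Store Var} (h : Resolved T bot σ) {I : ℕ}
    (hI : I < T.size) (hv : σ.v i = I) :
    ∃ τ, resolve.run x σ = τ ∧ Resolved T bot τ ∧ τ.o = σ.o ∧
      (∀ v, v ≠ pc → v ∉ ({ca, cb, cr, j, b} : Set Var) → τ.v v = σ.v v) ∧
      ((τ.m .exit = σ.m .exit ∧ IsStable T (σ.m .exit) I ∧ τ.v pc = σ.v pc) ∨
        (¬ IsStable T (σ.m .exit) I ∧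
        resolvedCount T (τ.m .exit) = resolvedCount T (σ.m .exit) + 1 ∧
        τ.v pc ≤ σ.v pc + 2)) := by
  rw [resolve, Cmd.run]
  by_cases h₁ : σ.m .exit I = 0
  swap
  · rw [if_pos (by simpa [Exp.eval, hv] using h₁)]
    exact ⟨_, rfl, h, rfl, fun _ _ _ => rfl, Or.inl ⟨rfl, fun h' => (h₁ h').elim, rfl⟩⟩
  rw [if_neg (by simpa [Exp.eval, hv] using h₁), Cmd.run]
  have hk : I % (T.k + 1) ≠ T.k := fun hk => h.idle I hI hk h₁
  have x₁ := Extends.assign (x := x) h.grammar (show j ≠ pc by simp)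
    (.add (.arr .base (.var i)) (.arr .push₁ (.var i)))
  have r₁ := h.congr x₁ (by simp)
  have j₁ : ((Cmd.assign j (.add (.arr .base (.var i)) (.arr .push₁ (.var i)))).run x σ).v j =
      T.base I + T.push₁ I := by simp [Cmd.run, Exp.eval, h.base, h.push₁, hv]
  have i₁ := x₁.v i (by simp) (by simp)
  have hJ := hT.next_lt hI hk
  generalize (Cmd.assign j (.add (.arr .base (.var i)) (.arr .push₁ (.var i)))).run x σ = τ at *
  have e₁ := x₁.m .exit (by simp) (by simp)
  set J := T.base I + T.push₁ I with hJdef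
  by_cases h₂ : σ.m .exit J = 0
  · rw [Cmd.run, if_neg (by simpa [Exp.eval, j₁, e₁] using h₂), Cmd.run]
    refine ⟨_, rfl, r₁, x₁.o, fun v h h' => x₁.v v h fun h'' => h' ?_,
      Or.inl ⟨e₁, fun _ h' => (h' h₂).elim, ?_⟩⟩
    · simp at h''; simp [h'']
    · have := x₁.pc_le; have := x₁.le_pc; omega
  rw [Cmd.run, if_pos (by simpa [Exp.eval, j₁, e₁] using h₂), Cmd.run]
  have x₂ := Extends.assign (x := x) r₁.grammar (show b ≠ pc by simp)
    (.add (.sub (.arr .exit (.var j)) (.const 1)) (.arr .push₂ (.var i)))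
  have r₂ := r₁.congr x₂ (by simp)
  have b₂ : ((Cmd.assign b (.add (.sub (.arr .exit (.var j)) (.const 1)) (.arr .push₂ (.var i)))).run
      x τ).v b = σ.m .exit J - 1 + T.push₂ I := by
    simp [Cmd.run, Exp.eval, j₁, e₁, i₁, r₁.push₂, hv]
  have i₂ := x₂.v i (by simp) (by simp)
  have j₂ := x₂.v j (by simp) (by simp)
  generalize (Cmd.assign b (.add (.sub (.arr .exit (.var j)) (.const 1))
    (.arr .push₂ (.var i)))).run x τ = υ at *
  have x₁₂ := x₁.trans x₂
  have e₂ := x₁₂.m .exit (by simp) (by simp)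
  obtain ⟨c, hc, hcJ⟩ := h.exit_dvd J hJ h₂
  have hB : σ.m .exit J - 1 + T.push₂ I < T.size := by
    rw [hcJ, Nat.add_sub_cancel]
    exact Tables.node_lt hc (hT.push₂_le I hI hk)
  -- A node with the bottom symbol leads to another such node, since its second pushed symbol is the
  -- bottom again; therefore such nodes are never resolved.
  have hBbot : I % (T.k + 1) = bot → σ.m .exit (σ.m .exit J - 1 + T.push₂ I) = 0 := by
    intro hb
    refine h.not_bot _ hB ?_
    rw [hcJ, Nat.add_sub_cancel, hT.push₂_bot I hI hb, Tables.node_mod hT.bot_lt.le]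
  set B := σ.m .exit J - 1 + T.push₂ I with hBdef
  by_cases h₃ : σ.m .exit B = 0
  · rw [Cmd.run, if_neg (by simpa [Exp.eval, b₂, e₂] using h₃), Cmd.run]
    refine ⟨_, rfl, r₂, x₁₂.o, fun v h h' => x₁₂.v v h fun h'' => h' ?_,
      Or.inl ⟨e₂, fun _ _ => h₃, ?_⟩⟩
    · simp at h''; simp; tauto
    · have := x₁₂.pc_le; have := x₁₂.le_pc; omega
  rw [Cmd.run, if_pos (by simpa [Exp.eval, b₂, e₂] using h₃), Cmd.run]
  have w₂ := x₁₂.m .word (by simp) (by simp)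
  obtain ⟨φ, e, x₃, c₃, d₃⟩ := cat_spec (x := x) r₂.grammar (e := .arr .word (.var j))
    (f := .arr .word (.var b)) (a := σ.m .word J) (b := σ.m .word B)
    (by simp [Exp.eval, j₂, j₁, w₂]) (by simp [Cmd.run, Exp.eval, b₂, w₂])
    ((h.word_le J hJ h₂).trans x₁₂.le_pc) ((h.word_le B hB h₃).trans x₁₂.le_pc)
  rw [e, Cmd.run]
  have x₁₃ := x₁₂.trans x₃
  have hemit := hT.emit_le I hI hk
  -- The output of the step itself is put in front.
  obtain ⟨ψ, e', x₄, c₄, d₄⟩ := cat_spec (x := x) x₃.grammar (e := .arr .emit (.var i))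
    (f := .var cr) (a := T.emit I) (b := φ.v cr)
    (by simp only [Exp.eval]
        rw [x₁₃.v i (by simp) (by simp), hv, x₁₃.m .emit (by simp) (by simp), h.emit])
    (by simp [Cmd.run, Exp.eval])
    (hemit.trans x₃.grammar.two_le) c₃
  rw [e']
  have x₁₄ := x₁₃.trans x₄
  have r₄ := h.congr x₁₄ (by simp)
  have hword : Store.word ψ (ψ.v cr) = Tables.bits (T.emit I) ++
      (Store.word σ (σ.m .word J) ++ Store.word σ (σ.m .word B)) := by
    rw [d₄, d₃, x₁₂.word _ (h.word_le J hJ h₂), x₁₂.word _ (h.word_le B hB h₃)]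
    congr 1
    exact x₃.grammar.word_bits hemit
  have hpops := Tables.Pops.step hk (h.pops J hJ h₂) (h.pops B hB h₃)
  rw [← hword] at hpops
  have hi := x₁₄.v i (by simp) (by simp)
  have hbb : ψ.v b = B := by
    rw [x₄.v b (by simp) (by simp), x₃.v b (by simp) (by simp), b₂]
  have hex := x₁₄.m .exit (by simp) (by simp)
  refine ⟨_, rfl, ?_⟩
  set ω := Cmd.run x _ ψ with hω
  have ωv : ω.v = ψ.v := rfl
  have ωo : ω.o = ψ.o := rfl
  have ωm : ∀ a, a ≠ .word → a ≠ .exit → ω.m a = ψ.m a := fun a h h' => by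
    simp [hω, Cmd.run, h, h']
  have ωw : ω.m .word = Function.update (ψ.m .word) I (ψ.v cr) := by
    simp [hω, Cmd.run, Exp.eval, hi, hv]
  have ωx : ω.m .exit = Function.update (σ.m .exit) I (σ.m .exit B) := by
    simp [hω, Cmd.run, Exp.eval, hi, hv, hbb, hex]
  have ωword : Store.word ω = Store.word ψ := by
    funext r
    rw [Store.word, Store.word, ωm _ (by simp) (by simp), ωm _ (by simp) (by simp)]
  clear_value ω
  refine ⟨⟨?_, ?_, ?_, ?_, ?_, ?_, ?_, ?_, ?_, ?_, ?_⟩,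
    ωo.trans x₁₄.o, fun v h h' => ωv ▸ x₁₄.v v h fun h'' => h' ?_, Or.inr ⟨fun h => ?_, ?_, ?_⟩⟩
  · rw [Store.Grammar, ωm _ (by simp) (by simp), ωm _ (by simp) (by simp), ωv]
    exact r₄.grammar
  · rw [ωm _ (by simp) (by simp), r₄.emit]
  · rw [ωm _ (by simp) (by simp), r₄.base]
  · rw [ωm _ (by simp) (by simp), r₄.push₁]
  · rw [ωm _ (by simp) (by simp), r₄.push₂]
  · rw [ωv, r₄.nn]
  · intro i hi hi'
    rw [ωx, Function.update_of_ne (by rintro rfl; exact hk hi')]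
    exact h.idle i hi hi'
  · intro i hi hi'
    rw [ωx, Function.update_of_ne (by rintro rfl; exact h₃ (hBbot hi'))]
    exact h.not_bot i hi hi'
  · intro i hi
    rw [ωx, ωw, ωv]
    by_cases hiI : i = I
    · rw [hiI, Function.update_self, Function.update_self]
      exact fun _ => c₄
    · rw [Function.update_of_ne hiI, Function.update_of_ne hiI, ← hex]
      exact r₄.word_le i hi
  · intro i hi
    rw [ωx]
    by_cases hiI : i = I
    · rw [hiI, Function.update_self]
      exact h.exit_dvd B hB
    · rw [Function.update_of_ne hiI]
      exact h.exit_dvd i hi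
  · intro i hi
    rw [ωx, ωw, ωword]
    by_cases hiI : i = I
    · rw [hiI, Function.update_self, Function.update_self]
      exact fun _ => hpops
    · rw [Function.update_of_ne hiI, Function.update_of_ne hiI, ← hex]
      exact r₄.pops i hi
  · simp at h''; simp; tauto
  · exact h₃ (h h₁ h₂)
  · rw [ωx]
    exact resolvedCount_update hI h₁ h₃
  · have := x₁₄.pc_le
    rw [ωv]
    omega

theorem isStable_of_resolvedCount {f : ℕ → ℕ} (h : T.size ≤ resolvedCount T f) {i : ℕ}
    (hi : i < T.size) : IsStable T f i := by
  intro h0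
  have : ((Finset.range T.size).filter (f · ≠ 0)) = Finset.range T.size :=
    Finset.eq_of_subset_of_card_le (Finset.filter_subset _ _) (by simpa [resolvedCount] using h)
  have h' := Finset.mem_range.2 hi
  rw [← this] at h'
  simp [h0] at h'

/-- The number of resolved nodes is the potential: it bounds the productions, and each round
increases it unless all nodes are stable already. It is at most the number of nodes, so that many
rounds reach stability. -/
theorem resolveAll_spec (hT : T.Valid bot) (hN : T.size ≤ x.length ^ 3) {σ : Store Var}
    (h : Resolved T bot σ) (hpc : σ.v pc ≤ 2) :
    ∃ τ, resolveAll.run x σ = τ ∧ Resolved T bot τ ∧ τ.o = σ.o ∧ τ.v pc ≤ 2 + 2 * T.size ∧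
      (∀ i < T.size, IsStable T (τ.m .exit) i) ∧
      ∀ v, v ≠ pc → v ∉ ({rnd, i, ca, cb, cr, j, b} : Set Var) → τ.v v = σ.v v := by
  have key := Cmd.upto_inv (x := x) (c := rnd) (b := .var nn) (p := .upto i (.var nn) resolve)
    (fun r τ => Resolved T bot τ ∧ τ.o = σ.o ∧
      τ.v pc ≤ 2 + 2 * resolvedCount T (τ.m .exit) ∧
      ((∀ i < T.size, IsStable T (τ.m .exit) i) ∨ r ≤ resolvedCount T (τ.m .exit)) ∧
      ∀ v, v ≠ pc → v ∉ ({rnd, i, ca, cb, cr, j, b} : Set Var) → τ.v v = σ.v v)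
    (N := T.size) (σ := σ) hN (fun _ _ h => h.1.nn) ?_ ?_ ?_
  · obtain ⟨k₁, k₂, k₃, k₄, k₅⟩ := key
    refine ⟨_, rfl, k₁, k₂, k₃.trans ?_, ?_, k₅⟩
    · have : resolvedCount T (((Cmd.upto rnd (.var nn) (.upto i (.var nn) resolve)).run x σ).m .exit)
          ≤ T.size := (Finset.card_filter_le _ _).trans (by simp)
      omega
    · rcases k₄ with k₄ | k₄
      · exact k₄
      · exact fun i hi => isStable_of_resolvedCount k₄ hi
  · rintro r τ m ⟨k₁, k₂, k₃, k₄, k₅⟩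
    have e := Extends.assign (x := x) k₁.grammar (show rnd ≠ pc by simp) (.const m)
    refine ⟨k₁.congr e (by simp), k₂, by simpa using k₃, k₄, fun v hv hv' => ?_⟩
    rw [← k₅ v hv hv']
    simp at hv'
    simp [hv']
  · rintro r τ hr ⟨k₁, k₂, k₃, k₄, k₅⟩ hc
    -- Within a round: either nothing has changed and the nodes visited so far are stable, or the
    -- round started from an unstable state and has resolved something.
    have key := Cmd.upto_inv (x := x) (c := i) (b := .var nn) (p := resolve)
      (fun I υ => Resolved T bot υ ∧ υ.o = σ.o ∧ υ.v rnd = r ∧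
        υ.v pc ≤ 2 + 2 * resolvedCount T (υ.m .exit) ∧
        ((υ.m .exit = τ.m .exit ∧ ∀ i < I, IsStable T (τ.m .exit) i) ∨
          (¬ (∀ i < T.size, IsStable T (τ.m .exit) i) ∧
            resolvedCount T (τ.m .exit) < resolvedCount T (υ.m .exit))) ∧
        ∀ v, v ≠ pc → v ∉ ({rnd, i, ca, cb, cr, j, b} : Set Var) → υ.v v = σ.v v)
      (N := T.size) (σ := τ) hN (fun _ _ h => h.1.nn) ?_ ?_ ?_
    · obtain ⟨l₁, l₂, l₃, l₄, l₅, l₆⟩ := key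
      refine ⟨l₃, l₁, l₂, l₄, ?_, l₆⟩
      rcases l₅ with ⟨l, l'⟩ | ⟨l, l'⟩
      · left
        rwa [l]
      · right
        rcases k₄ with k₄ | k₄
        · exact (l k₄).elim
        · omega
    · rintro I υ m ⟨k₁, k₂, k₃, k₄, k₅, k₆⟩
      have e := Extends.assign (x := x) k₁.grammar (show i ≠ pc by simp) (.const m)
      refine ⟨k₁.congr e (by simp), k₂, by simpa using k₃, by simpa using k₄, k₅,
        fun v hv hv' => ?_⟩
      rw [← k₆ v hv hv']
      simp at hv'
      simp [hv']
    · rintro I υ hI ⟨l₁, l₂, l₃, l₄, l₅, l₆⟩ hi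
      obtain ⟨φ, e, r₁, r₂, r₃, r₄⟩ := resolve_spec (x := x) hT l₁ hI hi
      rw [e]
      refine ⟨by rw [r₃ i (by simp) (by simp), hi], r₁, r₂.trans l₂,
        by rw [r₃ rnd (by simp) (by simp), l₃], ?_, ?_, fun v hv hv' => ?_⟩
      · rcases r₄ with ⟨r, -, r'⟩ | ⟨-, r, r'⟩
        · rw [r, r']; exact l₄
        · omega
      · rcases r₄ with ⟨r, r', -⟩ | ⟨r, r', -⟩
        · rcases l₅ with ⟨l, l'⟩ | ⟨l, l'⟩
          · refine Or.inl ⟨r.trans l, fun i hi => ?_⟩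
            rcases Nat.lt_succ_iff_lt_or_eq.1 hi with hi | rfl
            · exact l' i hi
            · rwa [← l]
          · exact Or.inr ⟨l, by rwa [r]⟩
        · rcases l₅ with ⟨l, l'⟩ | ⟨l, l'⟩
          · rw [l] at r r'
            exact Or.inr ⟨fun h => r (h I hI), by omega⟩
          · exact Or.inr ⟨l, by omega⟩
      · rw [r₃ v hv (by simp at hv' ⊢; tauto), l₆ v hv hv']
    · exact ⟨k₁, k₂, hc, k₃, Or.inl ⟨rfl, by simp⟩, k₅⟩
  · exact ⟨h, rfl, by omega, Or.inr (by omega), fun _ _ _ => rfl⟩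

end FromAutomaton

end RAM

/-! ### The walk along unresolved nodes -/

namespace RAM

namespace FromAutomaton

open Var

variable {x : List ℕ} {T : Tables} {bot : ℕ}

/-- The next node with the same list below it or, if there is none, the next node. -/
def nextNode (T : Tables) (f : ℕ → ℕ) (i : ℕ) : ℕ :=
  if f (T.base i + T.push₁ i) = 0 then T.base i + T.push₁ i
  else f (T.base i + T.push₁ i) - 1 + T.push₂ i

/-- Proceed to the next node, and record the output. -/
def walkStep : Cmd Var :=
  .seq (.assign j (.add (.arr .base (.var cur)) (.arr .push₁ (.var cur)))) <|
  .seq (cat (.var acc) (.arr .emit (.var cur))) <|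
  .ite (.arr .exit (.var j))
    (.seq (.assign cur (.add (.sub (.arr .exit (.var j)) (.const 1)) (.arr .push₂ (.var cur)))) <|
      .seq (cat (.var cr) (.arr .word (.var j))) (.assign acc (.var cr)))
    (.seq (.assign cur (.var j)) (.assign acc (.var cr)))

/-- Walk until the node `x₀` is reached again. -/
def walkCycle : Cmd Var :=
  .upto c (.var nn) <| .ite (.var fin) .skip <| .seq walkStep <|
    .ite (.sub (.var cur) (.var x₀)) .skip <| .ite (.sub (.var x₀) (.var cur)) .skip <|
    .assign fin (.const 1)

/-- Walk until a cycle has been entered, and once along the cycle. -/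
def walk : Cmd Var :=
  .seq (.assign acc (.const 0)) <| .seq (.upto c (.var nn) walkStep) <|
  .seq (.assign u (.var acc)) <| .seq (.assign x₀ (.var cur)) <| .seq (.assign fin (.const 0)) <|
  .seq (.assign acc (.const 0)) walkCycle

/-- The nodes that have not been resolved. -/
def Unresolved (T : Tables) (f : ℕ → ℕ) (i : ℕ) : Prop := i < T.size ∧ f i = 0

/-- Stability says exactly that an unresolved node whose first pushed symbol is removed continues
with an unresolved node. -/
theorem Resolved.next (hT : T.Valid bot) {σ : Store Var} (h : Resolved T bot σ)
    (hs : ∀ i < T.size, IsStable T (σ.m .exit) i) {I : ℕ} (hI : Unresolved T (σ.m .exit) I) :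
    Unresolved T (σ.m .exit) (nextNode T (σ.m .exit) I) := by
  obtain ⟨h₁, h₂⟩ := hI
  have hk : I % (T.k + 1) ≠ T.k := fun hk => h.idle I h₁ hk h₂
  have hJ := hT.next_lt h₁ hk
  rw [nextNode]
  split_ifs with h₃
  · exact ⟨hJ, h₃⟩
  · refine ⟨?_, hs I h₁ h₂ h₃⟩
    obtain ⟨c, hc, e⟩ := h.exit_dvd _ hJ h₃
    rw [e, Nat.add_sub_cancel]
    exact Tables.node_lt hc (hT.push₂_le I h₁ hk)

theorem Resolved.next_iterate (hT : T.Valid bot) {σ : Store Var} (h : Resolved T bot σ)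
    (hs : ∀ i < T.size, IsStable T (σ.m .exit) i) {I : ℕ} (hI : Unresolved T (σ.m .exit) I)
    (r : ℕ) : Unresolved T (σ.m .exit) ((nextNode T (σ.m .exit))^[r] I) := by
  induction r with
  | zero => exact hI
  | succ r ih =>
    rw [Function.iterate_succ_apply']
    exact h.next hT hs ih

/-- The two cases of `nextNode` are `goes_step` and `Pops.goes`; the output of a skipped excursion
is a word already in the grammar, so two concatenations suffice. -/
theorem walkStep_spec (hT : T.Valid bot) {σ : Store Var} (h : Resolved T bot σ) {I : ℕ}
    (hI : Unresolved T (σ.m .exit) I) (hv : σ.v cur = I) (ha : σ.v acc ≤ σ.v pc) :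
    ∃ τ, walkStep.run x σ = τ ∧ Extends 2 {ca, cb, cr, j, cur, acc} σ τ ∧
      τ.v cur = nextNode T (σ.m .exit) I ∧ τ.v acc ≤ τ.v pc ∧
      ∃ w, Store.word τ (τ.v acc) = Store.word σ (σ.v acc) ++ w ∧
        T.Goes True I w (nextNode T (σ.m .exit) I) := by
  obtain ⟨h₁, h₂⟩ := hI
  have hk : I % (T.k + 1) ≠ T.k := fun hk => h.idle I h₁ hk h₂
  have hJ := hT.next_lt h₁ hk
  rw [walkStep, Cmd.run]
  have x₁ := Extends.assign (x := x) h.grammar (show j ≠ pc by simp)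
    (.add (.arr .base (.var cur)) (.arr .push₁ (.var cur)))
  have j₁ : ((Cmd.assign j (.add (.arr .base (.var cur)) (.arr .push₁ (.var cur)))).run x σ).v j =
      T.base I + T.push₁ I := by simp [Cmd.run, Exp.eval, h.base, h.push₁, hv]
  generalize (Cmd.assign j (.add (.arr .base (.var cur)) (.arr .push₁ (.var cur)))).run x σ = τ
    at *
  set J := T.base I + T.push₁ I with hJdef
  have hemit := hT.emit_le I h₁ hk
  obtain ⟨φ, e, x₂, c₂, d₂⟩ := cat_spec (x := x) x₁.grammar (e := .var acc)
    (f := .arr .emit (.var cur)) (a := σ.v acc) (b := T.emit I)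
    (by simp only [Exp.eval]; rw [x₁.v _ (by simp) (by simp)])
    (by simp only [Exp.eval, Cmd.run, ne_eq, reduceCtorEq, not_false_eq_true,
          Function.update_of_ne]
        rw [x₁.v _ (by simp) (by simp), hv, x₁.m .emit (by simp) (by simp), h.emit])
    (ha.trans x₁.le_pc) (hemit.trans x₁.grammar.two_le)
  have hw : Store.word φ (φ.v cr) = Store.word σ (σ.v acc) ++ Tables.bits (T.emit I) := by
    rw [d₂, x₁.word _ ha]
    congr 1
    exact x₁.grammar.word_bits hemit
  have x₁₂ := x₁.trans x₂
  have j₂ : φ.v j = J := by rw [x₂.v _ (by simp) (by simp), j₁]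
  have hx : φ.m .exit = σ.m .exit := x₁₂.m .exit (by simp) (by simp)
  have hcur : φ.v cur = I := by rw [x₁₂.v _ (by simp) (by simp), hv]
  rw [Cmd.run, e]
  by_cases h₃ : σ.m .exit J = 0
  · have hn : nextNode T (σ.m .exit) I = J := by rw [nextNode, if_pos h₃]
    rw [Cmd.run, if_neg (by simpa [Exp.eval, j₂, hx] using h₃), Cmd.run, hn]
    have x₃ := Extends.assign (x := x) x₂.grammar (show cur ≠ pc by simp) (.var j)
    have x₄ := Extends.assign (x := x) x₃.grammar (show acc ≠ pc by simp) (.var cr)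
    refine ⟨_, rfl, ((x₁₂.trans x₃).trans x₄).mono (by simp) ?_, ?_, ?_, Tables.bits (T.emit I),
      ?_, Tables.goes_step hk (hT.push₂_le I h₁ hk)⟩
    · intro v; simp; tauto
    · simp [Cmd.run, Exp.eval, j₂]
    · simpa [Cmd.run, Exp.eval] using c₂
    · rw [← hw]; simp [Cmd.run, Exp.eval, Store.word]
  · have hn : nextNode T (σ.m .exit) I = σ.m .exit J - 1 + T.push₂ I := by
      rw [nextNode, if_neg h₃]
    rw [Cmd.run, if_pos (by simpa [Exp.eval, j₂, hx] using h₃), Cmd.run, hn]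
    have x₃ := Extends.assign (x := x) x₂.grammar (show cur ≠ pc by simp)
      (.add (.sub (.arr .exit (.var j)) (.const 1)) (.arr .push₂ (.var cur)))
    have hcur₃ : ((Cmd.assign cur (.add (.sub (.arr .exit (.var j)) (.const 1))
        (.arr .push₂ (.var cur)))).run x φ).v cur = σ.m .exit J - 1 + T.push₂ I := by
      simp only [Cmd.run, Exp.eval, Function.update_self]
      rw [j₂, hx, hcur, x₁₂.m .push₂ (by simp) (by simp), h.push₂]
    generalize (Cmd.assign cur (.add (.sub (.arr .exit (.var j)) (.const 1))
      (.arr .push₂ (.var cur)))).run x φ = ψ at *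
    have x₁₃ := x₁₂.trans x₃
    have c₃ : ψ.v cr = φ.v cr := x₃.v _ (by simp) (by simp)
    obtain ⟨ω, e₄, x₄, c₄, d₄⟩ := cat_spec (x := x) x₃.grammar (e := .var cr)
      (f := .arr .word (.var j)) (a := ψ.v cr) (b := σ.m .word J) rfl
      (by simp only [Exp.eval, Cmd.run, ne_eq, reduceCtorEq, not_false_eq_true,
            Function.update_of_ne]
          rw [x₃.v _ (by simp) (by simp), j₂, x₁₃.m .word (by simp) (by simp)])
      (by rw [c₃]; exact c₂.trans x₃.le_pc)
      ((h.word_le J hJ h₃).trans x₁₃.le_pc)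
    have x₅ := Extends.assign (x := x) x₄.grammar (show acc ≠ pc by simp) (.var cr)
    rw [Cmd.run, e₄]
    refine ⟨_, rfl, ((x₁₃.trans x₄).trans x₅).mono (by simp) ?_, ?_, ?_,
      Tables.bits (T.emit I) ++ Store.word σ (σ.m .word J), ?_,
      Tables.Pops.goes hk (h.pops J hJ h₃)⟩
    · intro v; simp; tauto
    · rw [x₅.v _ (by simp) (by simp), x₄.v _ (by simp) (by simp), hcur₃]
    · simpa [Cmd.run, Exp.eval] using c₄
    · have e₅ : ((Cmd.assign acc (.var cr)).run x ω).v acc = ω.v cr := by simp [Cmd.run, Exp.eval]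
      rw [e₅, x₅.word _ c₄, d₄, c₃, x₃.word _ c₂, hw, List.append_assoc,
        x₁₃.word _ (h.word_le J hJ h₃)]

open Classical in
theorem Extends.update {c : ℕ} {V : Set Var} {σ τ : Store Var} (h : Extends c V σ τ) (w : Var)
    (hw : w ≠ pc) (hV : w ∈ V) (m : ℕ) :
    Extends c V σ { τ with v := Function.update τ.v w m } :=
  (h.trans (Extends.assign (x := []) h.grammar hw (.const m))).mono le_rfl
    (Set.union_subset subset_rfl (Set.singleton_subset_iff.2 hV))

theorem Extends.refl {σ : Store Var} (h : Store.Grammar σ) (V : Set Var) : Extends 0 V σ σ :=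
  ⟨h, by simp, le_rfl, fun _ _ => rfl, fun _ _ _ => rfl, rfl, fun _ _ _ => rfl⟩

theorem walk_upto (hT : T.Valid bot) (hN : T.size ≤ x.length ^ 3) {σ : Store Var}
    (h : Resolved T bot σ) (hs : ∀ i < T.size, IsStable T (σ.m .exit) i)
    {I : ℕ} (hI : Unresolved T (σ.m .exit) I) (hv : σ.v cur = I) (ha : σ.v acc = 0) :
    ∃ τ, (Cmd.upto c (.var nn) walkStep).run x σ = τ ∧
      Extends (2 * T.size) {ca, cb, cr, j, cur, acc, c} σ τ ∧
      τ.v cur = (nextNode T (σ.m .exit))^[T.size] I ∧ τ.v acc ≤ τ.v pc ∧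
      T.Goes False I (Store.word τ (τ.v acc)) (τ.v cur) := by
  refine ⟨_, rfl, Cmd.upto_inv (fun r τ => Extends (2 * r) {ca, cb, cr, j, cur, acc, c} σ τ ∧
      τ.v cur = (nextNode T (σ.m .exit))^[r] I ∧ τ.v acc ≤ τ.v pc ∧
      T.Goes False I (Store.word τ (τ.v acc)) (τ.v cur)) hN (fun r τ h' => ?_) ?_ ?_ ?_⟩
  · simp only [Exp.eval]
    rw [h'.1.v _ (by simp) (by simp), h.nn]
  · rintro r τ m ⟨h₁, h₂⟩
    exact ⟨h₁.update c (by simp) (by simp) m, by simpa [Store.word] using h₂⟩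
  · rintro r τ hr ⟨h₁, h₂, h₃, h₄⟩ hc
    have hx : τ.m .exit = σ.m .exit := h₁.m _ (by simp) (by simp)
    obtain ⟨υ, e, x₁, v₁, a₁, w, hw, hg⟩ := walkStep_spec (x := x) hT (h.congr h₁ (by simp))
      (by rw [hx]; exact h.next_iterate hT hs hI r) h₂ h₃
    rw [e]
    refine ⟨by rw [x₁.v _ (by simp) (by simp), hc], (h₁.trans x₁).mono (by omega) ?_, ?_, a₁, ?_⟩
    · intro v; simp
    · rw [v₁, hx, Function.iterate_succ_apply']
    · rw [hw, v₁]
      rw [h₂] at h₄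
      exact (h₄.trans hg).weaken False.elim
  · refine ⟨Extends.refl h.grammar _, hv, by simp [ha], ?_⟩
    rw [ha, hv]
    exact Tables.Goes.refl I

/-- The loop has a fixed length, so `fin` freezes the walk after the first return to `x₀`; the
hypothesis `hp` ensures that the return happens in time. At least one step is taken, which makes the
cycle usable even if it is silent. -/
theorem walkCycle_spec (hT : T.Valid bot) (hN : T.size ≤ x.length ^ 3) {σ : Store Var}
    (h : Resolved T bot σ) (hs : ∀ i < T.size, IsStable T (σ.m .exit) i)
    {I : ℕ} (hI : Unresolved T (σ.m .exit) I) (hv : σ.v cur = I) (ha : σ.v acc = 0)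
    (hx₀ : σ.v x₀ = I) (hf : σ.v fin = 0)
    (hp : ∃ r, 0 < r ∧ r ≤ T.size ∧ (nextNode T (σ.m .exit))^[r] I = I) :
    ∃ τ, walkCycle.run x σ = τ ∧
      Extends (2 * T.size) {ca, cb, cr, j, cur, acc, c, fin} σ τ ∧
      τ.v cur = I ∧ τ.v acc ≤ τ.v pc ∧ T.Goes True I (Store.word τ (τ.v acc)) I := by
  have key := Cmd.upto_inv (x := x) (c := c) (b := .var nn)
    (p := .ite (.var fin) .skip <| .seq walkStep <|
      .ite (.sub (.var cur) (.var x₀)) .skip <| .ite (.sub (.var x₀) (.var cur)) .skip <|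
      .assign fin (.const 1)) (fun r τ =>
      Extends (2 * r) {ca, cb, cr, j, cur, acc, c, fin} σ τ ∧ τ.v acc ≤ τ.v pc ∧
      T.Goes (0 < r) I (Store.word τ (τ.v acc)) (τ.v cur) ∧
      ((τ.v fin = 0 ∧ τ.v cur = (nextNode T (σ.m .exit))^[r] I ∧
        ∀ r', 0 < r' → r' ≤ r → (nextNode T (σ.m .exit))^[r'] I ≠ I) ∨
      (τ.v fin ≠ 0 ∧ τ.v cur = I ∧ 0 < r))) (σ := σ) hN (fun r τ h' => ?_) ?_ ?_ ?_
  · obtain ⟨k₁, k₂, k₃, k₄⟩ := key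
    obtain ⟨r, hr, hr', e⟩ := hp
    rcases k₄ with ⟨-, -, k₄⟩ | ⟨-, k₄, k₅⟩
    · exact (k₄ r hr hr' e).elim
    · refine ⟨_, rfl, k₁, k₄, k₂, ?_⟩
      rw [k₄] at k₃
      exact k₃.weaken fun _ => k₅
  · simp only [Exp.eval]
    rw [h'.1.v _ (by simp) (by simp), h.nn]
  · rintro r τ m ⟨h₁, h₂⟩
    exact ⟨h₁.update c (by simp) (by simp) m, by simpa [Store.word] using h₂⟩
  · rintro r τ hr ⟨h₁, h₂, h₃, h₄⟩ hc
    rcases h₄ with ⟨h₄, h₅, h₆⟩ | ⟨h₄, h₅, h₆⟩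
    swap
    · rw [Cmd.run, if_pos (by simpa [Exp.eval] using h₄)]
      exact ⟨hc, h₁.mono (by omega) subset_rfl, h₂, h₃.weaken fun _ => h₆,
        Or.inr ⟨h₄, h₅, by omega⟩⟩
    have hx : τ.m .exit = σ.m .exit := h₁.m _ (by simp) (by simp)
    obtain ⟨υ, e, x₁, v₁, a₁, w, hw, hg⟩ := walkStep_spec (x := x) hT (h.congr h₁ (by simp))
      (by rw [hx]; exact h.next_iterate hT hs hI r) h₅ h₂
    rw [Cmd.run, if_neg (by simp [Exp.eval, h₄]), Cmd.run, e]
    have hx' : υ.v x₀ = I := by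
      rw [x₁.v _ (by simp) (by simp), h₁.v _ (by simp) (by simp), hx₀]
    have x₂ : Extends (2 * (r + 1)) {ca, cb, cr, j, cur, acc, c, fin} σ υ := by
      refine (h₁.trans x₁).mono (by omega) ?_
      intro v; simp
    have hc' : υ.v c = r := by rw [x₁.v _ (by simp) (by simp), hc]
    have hf' : υ.v fin = 0 := by rw [x₁.v _ (by simp) (by simp), h₄]
    rw [hx, ← Function.iterate_succ_apply' (f := nextNode T (σ.m .exit))] at v₁ hg
    have hgo : T.Goes (0 < r + 1) I (Store.word υ (υ.v acc)) (υ.v cur) := by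
      rw [hw, v₁]
      rw [h₅] at h₃
      exact (h₃.trans hg).weaken fun _ => Or.inr trivial
    by_cases hcyc : υ.v cur = I
    · rw [Cmd.run, if_neg (by simp [Exp.eval, hcyc, hx']), Cmd.run,
        if_neg (by simp [Exp.eval, hcyc, hx']), Cmd.run]
      refine ⟨by simpa using hc', x₂.update fin (by simp) (by simp) _, by simpa using a₁,
        by simpa [Store.word] using hgo, Or.inr ⟨?_, by simpa using hcyc, by omega⟩⟩
      simp [Exp.eval]
    -- Equality is tested by two truncated differences; if one of them is nonzero, nothing happens.
    · have e' : (Cmd.ite (.sub (.var cur) (.var x₀)) .skip <| .ite (.sub (.var x₀) (.var cur)) .skip <|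
          .assign fin (.const 1)).run x υ = υ := by
        by_cases hlt : υ.v cur - I = 0
        · rw [Cmd.run, if_neg (by simp only [Exp.eval, hx']; omega), Cmd.run,
            if_pos (by simp only [Exp.eval, hx']; omega), Cmd.run]
        · rw [Cmd.run, if_pos (by simp only [Exp.eval, hx']; omega), Cmd.run]
      rw [e']
      refine ⟨hc', x₂, a₁, hgo, Or.inl ⟨hf', v₁, fun r' hr' hr'' => ?_⟩⟩
      rcases Nat.le_succ_iff.1 hr'' with hr'' | rfl
      · exact h₆ r' hr' hr''
      · rwa [← v₁]
  · refine ⟨Extends.refl h.grammar _, by simp [ha], ?_, Or.inl ⟨hf, hv, by omega⟩⟩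
    rw [ha, hv]
    exact (Tables.Goes.refl I).weaken (by omega)

/-- Pigeonhole among the first `N + 1` iterates: they repeat from some index at most `N` on, so the
iterate with index `N` lies on the cycle. -/
theorem exists_period {f : ℕ → ℕ} {s N : ℕ} (h : ∀ r, f^[r] s < N) :
    ∃ r, 0 < r ∧ r ≤ N ∧ f^[r] (f^[N] s) = f^[N] s := by
  obtain ⟨a, ha, b, hb, hab, e⟩ := Finset.exists_ne_map_eq_of_card_lt_of_maps_to
    (s := Finset.range (N + 1)) (t := Finset.range N) (by simp) (f := fun r => f^[r] s)
    (fun r _ => by simpa using h r)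
  wlog hlt : a < b generalizing a b
  · exact this b hb a ha hab.symm e.symm (by omega)
  simp only [Finset.mem_range] at ha hb e
  refine ⟨b - a, by omega, by omega, ?_⟩
  rw [← Function.iterate_add_apply, show b - a + N = (N - a) + b by omega,
    Function.iterate_add_apply, ← e, ← Function.iterate_add_apply]
  congr 2
  omega

/-- Two walks of at most `T.size` steps each, at two productions per step, account for `4 * T.size`.
-/
theorem walk_spec (hT : T.Valid bot) (hN : T.size ≤ x.length ^ 3) {σ : Store Var}
    (h : Resolved T bot σ) (hs : ∀ i < T.size, IsStable T (σ.m .exit) i)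
    {I : ℕ} (hI : Unresolved T (σ.m .exit) I) (hv : σ.v cur = I) :
    ∃ τ, walk.run x σ = τ ∧
      Extends (4 * T.size) {ca, cb, cr, j, cur, acc, c, fin, u, x₀} σ τ ∧
      τ.v u ≤ τ.v pc ∧ τ.v acc ≤ τ.v pc ∧ τ.v cur < T.size ∧
      T.Goes False I (Store.word τ (τ.v u)) (τ.v cur) ∧
      T.Goes True (τ.v cur) (Store.word τ (τ.v acc)) (τ.v cur) := by
  have x₁ := Extends.assign (x := x) h.grammar (show acc ≠ pc by simp) (.const 0)
  rw [walk, Cmd.run]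
  have a₁ : ((Cmd.assign acc (.const 0)).run x σ).v acc = 0 := by simp [Cmd.run, Exp.eval]
  generalize (Cmd.assign acc (.const 0)).run x σ = σ₁ at *
  have r₁ := h.congr x₁ (by simp)
  have m₁ : σ₁.m .exit = σ.m .exit := x₁.m _ (by simp) (by simp)
  obtain ⟨σ₂, e₂, x₂, v₂, a₂, g₂⟩ := walk_upto hT hN r₁ (by rwa [m₁]) (by rwa [m₁])
    (by rw [x₁.v _ (by simp) (by simp), hv]) a₁
  rw [Cmd.run, e₂]
  have r₂ := r₁.congr x₂ (by simp)
  have m₂ : σ₂.m .exit = σ.m .exit := (x₂.m _ (by simp) (by simp)).trans m₁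
  rw [m₁] at v₂
  have hp : ∃ r, 0 < r ∧ r ≤ T.size ∧ (nextNode T (σ.m .exit))^[r] (σ₂.v cur) = σ₂.v cur := by
    rw [v₂]
    exact exists_period fun r => (h.next_iterate hT hs hI r).1
  have hcur : Unresolved T (σ.m .exit) (σ₂.v cur) := by
    rw [v₂]
    exact h.next_iterate hT hs hI _
  have x₃ := Extends.assign (x := x) x₂.grammar (show u ≠ pc by simp) (.var acc)
  have x₄ := Extends.assign (x := x) x₃.grammar (show x₀ ≠ pc by simp) (.var cur)
  have x₅ := Extends.assign (x := x) x₄.grammar (show fin ≠ pc by simp) (.const 0)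
  have x₆ := Extends.assign (x := x) x₅.grammar (show acc ≠ pc by simp) (.const 0)
  have x₂₆ := ((x₃.trans x₄).trans x₅).trans x₆
  rw [Cmd.run, Cmd.run, Cmd.run, Cmd.run]
  set σ₆ := (Cmd.assign acc (.const 0)).run x ((Cmd.assign fin (.const 0)).run x
    ((Cmd.assign x₀ (.var cur)).run x ((Cmd.assign u (.var acc)).run x σ₂))) with hσ₆
  have u₆ : σ₆.v u = σ₂.v acc := by simp [hσ₆, Cmd.run, Exp.eval]
  have c₆ : σ₆.v cur = σ₂.v cur := by simp [hσ₆, Cmd.run]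
  have y₆ : σ₆.v x₀ = σ₂.v cur := by simp [hσ₆, Cmd.run, Exp.eval]
  have f₆ : σ₆.v fin = 0 := by simp [hσ₆, Cmd.run, Exp.eval]
  have a₆ : σ₆.v acc = 0 := by simp [hσ₆, Cmd.run, Exp.eval]
  have r₆ := r₂.congr x₂₆ (by simp)
  have m₆ : σ₆.m .exit = σ.m .exit := (x₂₆.m _ (by simp) (by simp)).trans m₂
  obtain ⟨σ₇, e₇, x₇, c₇, a₇, g₇⟩ := walkCycle_spec hT hN r₆ (by rwa [m₆]) (by rwa [m₆]) c₆ a₆ y₆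
    f₆ (by rwa [m₆])
  have u₇ : σ₇.v u = σ₂.v acc := by rw [x₇.v _ (by simp) (by simp), u₆]
  refine ⟨_, e₇, (((x₁.trans x₂).trans x₂₆).trans x₇).mono (by omega) ?_, ?_, a₇, ?_, ?_, ?_⟩
  · intro v; simp; tauto
  · rw [u₇]
    exact (a₂.trans x₂₆.le_pc).trans x₇.le_pc
  · rw [c₇]; exact hcur.1
  · rw [c₇, u₇, x₇.word _ (a₂.trans x₂₆.le_pc), x₂₆.word _ a₂]
    exact g₂
  · rw [c₇]; exact g₇

end FromAutomaton

end RAM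

/-! ### The complete algorithm, from automata to indicator pairs -/

namespace RAM

namespace FromAutomaton

open Var

theorem run_seq {V : Type} {x : List ℕ} (p q : Cmd V) (σ : Store V) :
    (Cmd.seq p q).run x σ = q.run x (p.run x σ) := rfl

/-- Find the number of the bottom symbol. -/
def findBot : Cmd Var :=
  .upto c (.var k) <| .ite (.inp (.add (.add (.const 3) (.var n)) (.var c)))
    (.assign bot (.var c)) .skip

/-- Store the grammar with the two terminals. -/
def terminals : Cmd Var :=
  .seq (.store .left (.const 0) (.const 0)) <| .seq (.store .right (.const 0) (.const 0)) <|
  .seq (.store .left (.const 1) (.const 0)) <| .seq (.store .right (.const 1) (.const 1)) <|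
  .assign pc (.const 2)

/-- Determine the last bit of the output, when the cycle is silent. -/
def lastBit : Cmd Var :=
  .ite (.sub (.add (.var cur) (.const 1)) (.var fb))
    (.ite (.sub (.var db) (.var cur)) (.assign e (.const 2)) (.assign e (.const 1)))
    (.assign e (.const 1))

/-- Compute the two start symbols. -/
def finish : Cmd Var :=
  .seq (.ite (.var acc) (.seq (.assign s₂ (.var acc)) (cat (.var u) (.var acc)))
    (.seq (.assign s₂ (.const 1)) (.seq lastBit (cat (.var u) (.var e)))))
  (.assign s₁ (.var cr))

/-- Write the productions. -/
def writeRules : Cmd Var :=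
  .upto c (.var pc) (.seq (.write (.arr .left (.var c))) (.write (.arr .right (.var c))))

/-- Write a grammar with a start symbol. -/
def writeGrammar (w : Var) : Cmd Var :=
  .seq (.write (.var pc)) (.seq (.write (.sub (.var w) (.const 1))) writeRules)

/-- Find the first node. -/
def startNode : Cmd Var := .assign cur (.add (.arr .mul (.inp (.const 2))) (.var bot))

/-- Compute an indicator pair from an automaton. -/
def prog : Cmd Var :=
  .seq tables <| .seq findBot <| .seq startNode <| .seq terminals <| .seq resolveAll <| .seq walk <|
  .seq finish <| .seq (writeGrammar s₁) (writeGrammar s₂)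

variable {Q Γ : Type} {N K : ℕ} {A : UPDA Q Γ} {eQ : Q ≃ Fin N} {eΓ : Γ ≃ Fin K}
  {l : List (Q × Option Unit × Γ × Q × List Γ)} {x : List ℕ} {T : Tables}

theorem findBot_spec (hx : Input A eQ eΓ l x) (hK : K ≤ x.length ^ 3) {σ : Store Var}
    (hn : σ.v n = N) (hk : σ.v k = K) : ∃ τ, findBot.run x σ = τ ∧ τ.m = σ.m ∧ τ.o = σ.o ∧
      (∀ v, v ≠ c → v ≠ bot → τ.v v = σ.v v) ∧ τ.v bot = eΓ A.bot := by
  have key := Cmd.upto_inv (x := x) (c := c) (b := .var k)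
    (p := .ite (.inp (.add (.add (.const 3) (.var n)) (.var c))) (.assign bot (.var c)) .skip)
    (fun r τ => τ.m = σ.m ∧ τ.o = σ.o ∧ (∀ v, v ≠ c → v ≠ bot → τ.v v = σ.v v) ∧
      ((eΓ A.bot : ℕ) < r → τ.v bot = eΓ A.bot)) (N := K) (σ := σ) hK (fun r τ h => ?_) ?_ ?_ ?_
  · exact ⟨_, rfl, key.1, key.2.1, key.2.2.1, key.2.2.2 (eΓ A.bot).2⟩
  · simp only [Exp.eval]
    rw [h.2.2.1 _ (by simp) (by simp), hk]
  · rintro r τ m ⟨h₁, h₂, h₃, h₄⟩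
    exact ⟨h₁, h₂, fun v hv hv' => by simp [hv, h₃ v hv hv'], by simpa using h₄⟩
  · rintro r τ hr ⟨h₁, h₂, h₃, h₄⟩ hc
    have hb := hx.bot (eΓ.symm ⟨r, hr⟩)
    rw [Equiv.apply_symm_apply, Equiv.symm_apply_eq] at hb
    have hn' : τ.v n = N := by rw [h₃ _ (by simp) (by simp), hn]
    by_cases h : x.getD (3 + N + r) 0 = 0
    · rw [Cmd.run, if_neg (by simp only [Exp.eval, hn', hc]; simpa using h), Cmd.run]
      refine ⟨hc, h₁, h₂, h₃, fun hr' => h₄ ?_⟩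
      have : (eΓ A.bot : ℕ) ≠ r := fun h' => hb.2 (Fin.ext h'.symm) h
      omega
    · rw [Cmd.run, if_pos (by simp only [Exp.eval, hn', hc]; exact h), Cmd.run]
      have e := congrArg Fin.val (hb.1 h)
      refine ⟨by simpa using hc, h₁, h₂, fun v hv hv' => by simp [hv', h₃ v hv hv'], fun _ => ?_⟩
      simpa [Exp.eval, hc] using e
  · exact ⟨rfl, rfl, fun _ _ _ => rfl, by simp⟩

theorem terminals_spec (σ : Store Var) : ∃ τ, terminals.run x σ = τ ∧ Store.Grammar τ ∧
    τ.v pc = 2 ∧ (∀ v, v ≠ pc → τ.v v = σ.v v) ∧ τ.o = σ.o ∧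
    ∀ a, a ≠ .left → a ≠ .right → τ.m a = σ.m a := by
  refine ⟨_, rfl, ?_⟩
  simp only [terminals, Cmd.run, Exp.eval, Function.update_self, ne_eq, reduceCtorEq,
    not_false_eq_true, Function.update_of_ne, true_and]
  refine ⟨?_, fun v hv => by simp [hv], fun a h h' => by simp [h, h']⟩
  simp only [Store.Grammar, Function.update_self, ne_eq, reduceCtorEq,
    not_false_eq_true, Function.update_of_ne]
  constructor
  · intro j hj
    interval_cases j <;> simp
  · intro j hj
    interval_cases j <;> simp
  · intro j hj
    interval_cases j <;> simp
  all_goals simp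

/-- Before the first round exactly the idle nodes are resolved, with empty words. -/
theorem Params.resolved {σ τ : Store Var} {bot : ℕ} (h : Params N K σ) (hb : bot < K)
    (hg : Store.Grammar τ) (hv : ∀ v, v ≠ pc → v ≠ c → v ≠ Var.bot → v ≠ cur → τ.v v = σ.v v)
    (hm : ∀ a, a ≠ .left → a ≠ .right → τ.m a = σ.m a) :
    Resolved (storeTables N K σ) bot τ := by
  have hex : ∀ i < (storeTables N K σ).size, σ.m .exit i ≠ 0 →
      ∃ c ≤ 2 * N, i = (K + 1) * c + K := by
    intro i hi h0
    obtain ⟨c, hc, g, hg, rfl⟩ := Tables.exists_node hi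
    rcases Nat.lt_or_eq_of_le hg with hg | rfl
    · exact (h0 (h.exit_ne c g hg)).elim
    · exact ⟨c, hc, rfl⟩
  have hx := hm .exit (by simp) (by simp)
  have hw := hm .word (by simp) (by simp)
  constructor
  · exact hg
  · exact hm .emit (by simp) (by simp)
  · exact hm .base (by simp) (by simp)
  · exact hm .push₁ (by simp) (by simp)
  · exact hm .push₂ (by simp) (by simp)
  · rw [hv _ (by simp) (by simp) (by simp) (by simp), h.nn]; rfl
  · rw [hx]
    intro i hi hk
    obtain ⟨c, hc, g, hg, rfl⟩ := Tables.exists_node hi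
    rw [Tables.node_mod hg] at hk
    subst hk
    have := h.exit_idle c hc
    simp only [storeTables] at this ⊢
    omega
  · rw [hx]
    intro i hi hk
    obtain ⟨c, hc, g, hg, rfl⟩ := Tables.exists_node hi
    rw [Tables.node_mod hg] at hk
    subst hk
    exact h.exit_ne c g hb
  · rw [hw]
    intro i _ _
    rw [h.word]
    exact Nat.zero_le _
  · rw [hx]
    intro i hi h0
    obtain ⟨c, hc, rfl⟩ := hex i hi h0
    exact ⟨c, hc, h.exit_idle c hc⟩
  · rw [hx, hw]
    intro i hi h0
    obtain ⟨c, hc, rfl⟩ := hex i hi h0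
    rw [h.word, h.exit_idle c hc, Nat.add_sub_cancel]
    exact Tables.pops_idle (T := storeTables N K σ) c

open Classical in
-- The flagged nodes form the interval from `fb` to `db - 1`, so two truncated differences decide
-- the promise; adding 1 to `cur` makes the lower end inclusive.
theorem lastBit_spec {σ : Store Var} (hg : Store.Grammar σ) (hf : σ.v fb = (T.k + 1) * T.n)
    (hd : σ.v db = (T.k + 1) * (2 * T.n)) : ∃ τ, lastBit.run x σ = τ ∧ Extends 0 {e} σ τ ∧
      τ.v e = if T.Flag (σ.v cur) then 2 else 1 := by
  have h₁ : T.n ≤ σ.v cur / (T.k + 1) ↔ σ.v cur + 1 - σ.v fb ≠ 0 := by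
    rw [Nat.le_div_iff_mul_le (Nat.succ_pos _), mul_comm T.n, hf]
    simp only [Nat.succ_eq_add_one]
    omega
  have h₂ : σ.v cur / (T.k + 1) < 2 * T.n ↔ σ.v db - σ.v cur ≠ 0 := by
    rw [Nat.div_lt_iff_lt_mul (Nat.succ_pos _), mul_comm (2 * T.n), hd]
    simp only [Nat.succ_eq_add_one]
    omega
  have key : ∀ m, (Cmd.assign e (.const m)).run x σ = (Cmd.assign e (.const m)).run x σ ∧
      Extends 0 {e} σ ((Cmd.assign e (.const m)).run x σ) ∧
      ((Cmd.assign e (.const m)).run x σ).v e = m :=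
    fun m => ⟨rfl, Extends.assign hg (by simp) _, by simp [Cmd.run, Exp.eval]⟩
  have e₁ : ∀ p q : Cmd Var, (Cmd.ite (.sub (.add (.var cur) (.const 1)) (.var fb)) p q).run x σ =
      if T.n ≤ σ.v cur / (T.k + 1) then p.run x σ else q.run x σ := fun p q => by
    simp only [Cmd.run, Exp.eval, h₁]
    exact if_congr Iff.rfl rfl rfl
  have e₂ : ∀ p q : Cmd Var, (Cmd.ite (.sub (.var db) (.var cur)) p q).run x σ =
      if σ.v cur / (T.k + 1) < 2 * T.n then p.run x σ else q.run x σ := fun p q => by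
    simp only [Cmd.run, Exp.eval, h₂]
    exact if_congr Iff.rfl rfl rfl
  rw [lastBit, e₁, e₂, Tables.Flag]
  by_cases c₁ : T.n ≤ σ.v cur / (T.k + 1)
  · rw [if_pos c₁]
    by_cases c₂ : σ.v cur / (T.k + 1) < 2 * T.n
    · rw [if_pos c₂, if_pos ⟨c₁, c₂⟩]
      exact ⟨_, key 2⟩
    · rw [if_neg c₂, if_neg (fun h => c₂ h.2)]
      exact ⟨_, key 1⟩
  · rw [if_neg c₁, if_neg (fun h => c₁ h.1)]
    exact ⟨_, key 1⟩

open Classical in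
theorem finish_spec {bot start : ℕ} {f : ℕ → Bool} (hT : T.Valid bot) {σ : Store Var}
    (hg : Store.Grammar σ) (hf : σ.v fb = (T.k + 1) * T.n)
    (hd : σ.v db = (T.k + 1) * (2 * T.n)) (hs : start < T.size) (hc : σ.v cur < T.size)
    (hu : σ.v u ≤ σ.v pc) (ha : σ.v acc ≤ σ.v pc)
    (hgo : T.Goes False start (Store.word σ (σ.v u)) (σ.v cur))
    (hgo' : T.Goes True (σ.v cur) (Store.word σ (σ.v acc)) (σ.v cur))
    (ht : ∀ t, f t = true ↔ T.Output start [] t) :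
    ∃ τ, finish.run x σ = τ ∧ Extends 1 {ca, cb, cr, e, s₁, s₂} σ τ ∧
      τ.v s₁ ≠ 0 ∧ τ.v s₂ ≠ 0 ∧ τ.v s₁ ≤ τ.v pc ∧ τ.v s₂ ≤ τ.v pc ∧
      IsLasso (Store.word τ (τ.v s₁)) (Store.word τ (τ.v s₂)) f := by
  obtain ⟨l₁, l₂⟩ := hT.isLasso hs hc hgo hgo' ht
  rw [finish, Cmd.run]
  -- The common end of both cases. The second factor `w'` is nonempty, so the number in `cr` is not
  -- 0 and belongs to a nonterminal that can serve as start symbol.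
  have last : ∀ (υ τ : Store Var) (w w' : List Bool) (V : Set Var), Extends 0 V σ υ →
      V ⊆ {e, s₂} → Extends 1 {ca, cb, cr} υ τ → τ.v cr ≤ τ.v pc →
      υ.v s₂ ≤ υ.v pc → υ.v s₂ ≠ 0 → w' ≠ [] →
      Store.word τ (τ.v cr) = w ++ w' → IsLasso (w ++ w') (Store.word υ (υ.v s₂)) f →
      ∃ φ, (Cmd.assign s₁ (.var cr)).run x τ = φ ∧ Extends 1 {ca, cb, cr, e, s₁, s₂} σ φ ∧
      φ.v s₁ ≠ 0 ∧ φ.v s₂ ≠ 0 ∧ φ.v s₁ ≤ φ.v pc ∧ φ.v s₂ ≤ φ.v pc ∧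
      IsLasso (Store.word φ (φ.v s₁)) (Store.word φ (φ.v s₂)) f := by
    intro υ τ w w' V h₁ hV h₂ h₃ h₄ h₅ h₆ h₇ h₈
    have x₃ := Extends.assign (x := x) h₂.grammar (show s₁ ≠ pc by simp) (.var cr)
    have v₁ : ((Cmd.assign s₁ (.var cr)).run x τ).v s₁ = τ.v cr := by simp [Cmd.run, Exp.eval]
    have v₂ : ((Cmd.assign s₁ (.var cr)).run x τ).v s₂ = υ.v s₂ := by
      rw [x₃.v _ (by simp) (by simp), h₂.v _ (by simp) (by simp)]
    refine ⟨_, rfl, ((h₁.trans h₂).trans x₃).mono (by omega) ?_, ?_⟩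
    · intro v hv
      have := @hV v
      simp at hv this ⊢
      tauto
    rw [v₁, v₂, x₃.word _ h₃, x₃.word _ (h₄.trans h₂.le_pc), h₂.word _ h₄, h₇]
    refine ⟨fun h0 => ?_, h₅, h₃.trans x₃.le_pc, (h₄.trans h₂.le_pc).trans x₃.le_pc, h₈⟩
    have := (arrayWord_eq_nil (L := τ.m .left) (R := τ.m .right)).2 h0
    rw [Store.word, this] at h₇
    simp [h₆] at h₇
  generalize Cmd.assign s₁ (.var cr) = L at last ⊢
  by_cases h0 : σ.v acc = 0
  · rw [Cmd.run, if_neg (by simp [Exp.eval, h0]), run_seq, run_seq]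
    have x₁ := Extends.assign (x := x) hg (show s₂ ≠ pc by simp) (.const 1)
    have v₁ : ((Cmd.assign s₂ (.const 1)).run x σ).v s₂ = 1 := by simp [Cmd.run, Exp.eval]
    generalize (Cmd.assign s₂ (.const 1)).run x σ = σ₁ at *
    obtain ⟨σ₂, e₂, x₂, v₂⟩ := lastBit_spec (x := x) (T := T) x₁.grammar
      (by rw [x₁.v _ (by simp) (by simp), hf]) (by rw [x₁.v _ (by simp) (by simp), hd])
    rw [e₂]
    rw [x₁.v _ (by simp) (by simp)] at v₂
    have x₁₂ := x₁.trans x₂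
    have le : σ₂.v e ≤ 2 := by rw [v₂]; split_ifs <;> omega
    obtain ⟨σ₃, e₃, x₃, c₃, w₃⟩ := cat_spec (x := x) x₂.grammar (e := .var u) (f := .var e)
      (a := σ.v u) (b := σ₂.v e)
      (by simp only [Exp.eval]; rw [x₁₂.v _ (by simp) (by simp)])
      (by simp [Exp.eval, Cmd.run]) (hu.trans x₁₂.le_pc) (le.trans x₂.grammar.two_le)
    rw [e₃]
    have s₂₂ : σ₂.v s₂ = 1 := by rw [x₂.v _ (by simp) (by simp), v₁]
    have hw : Store.word σ₂ (σ₂.v e) = [decide (T.Flag (σ.v cur))] := by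
      refine (x₂.grammar.word_bits le).trans ?_
      rw [v₂]
      by_cases hF : T.Flag (σ.v cur) <;> simp [hF, Tables.bits]
    refine last σ₂ σ₃ (Store.word σ (σ.v u)) [decide (T.Flag (σ.v cur))] _ x₁₂ ?_ x₃ c₃
      (by rw [s₂₂]; exact le_trans (by omega) x₂.grammar.two_le) (by omega) (by simp) ?_ ?_
    · intro v; simp
    · rw [w₃, hw, x₁₂.word _ hu]
    · rw [s₂₂]
      have : Store.word σ₂ 1 = Tables.bits 1 := x₂.grammar.word_bits (by omega)
      rw [this]
      exact l₂ (by rw [h0]; rfl)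
  · rw [Cmd.run, if_pos (by simpa [Exp.eval] using h0), run_seq]
    have x₁ := Extends.assign (x := x) hg (show s₂ ≠ pc by simp) (.var acc)
    have v₁ : ((Cmd.assign s₂ (.var acc)).run x σ).v s₂ = σ.v acc := by simp [Cmd.run, Exp.eval]
    generalize (Cmd.assign s₂ (.var acc)).run x σ = σ₁ at *
    obtain ⟨σ₃, e₃, x₃, c₃, w₃⟩ := cat_spec (x := x) x₁.grammar (e := .var u) (f := .var acc)
      (a := σ.v u) (b := σ.v acc)
      (by simp only [Exp.eval]; rw [x₁.v _ (by simp) (by simp)])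
      (by simp only [Exp.eval, Cmd.run, ne_eq, reduceCtorEq, not_false_eq_true,
            Function.update_of_ne]
          rw [x₁.v _ (by simp) (by simp)]) (hu.trans x₁.le_pc) (ha.trans x₁.le_pc)
    rw [e₃]
    have hne : Store.word σ (σ.v acc) ≠ [] := fun h => h0 (arrayWord_eq_nil.1 h)
    refine last σ₁ σ₃ (Store.word σ (σ.v u)) (Store.word σ (σ.v acc)) _ x₁ (by simp) x₃ c₃
      (by rw [v₁]; exact ha.trans x₁.le_pc) (by omega) hne ?_ ?_
    · rw [w₃, x₁.word _ hu, x₁.word _ ha]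
    · rw [v₁, x₁.word _ ha]
      exact l₁ hne

/-- The productions, in the order of the nonterminals. -/
def ruleList (L R : ℕ → ℕ) (N : ℕ) : List ℕ := (List.range N).flatMap fun j => [L j, R j]

theorem writeGrammar_spec {w : Var} {σ : Store Var} (hp : σ.v pc ≤ x.length ^ 3) :
    ∃ τ, (writeGrammar w).run x σ = τ ∧ τ.m = σ.m ∧ (∀ v, v ≠ c → τ.v v = σ.v v) ∧
      τ.o = σ.o ++ ([σ.v pc, σ.v w - 1] ++ ruleList (σ.m .left) (σ.m .right) (σ.v pc)) := by
  have key := Cmd.upto_inv (x := x) (c := c) (b := .var pc)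
    (p := .seq (.write (.arr .left (.var c))) (.write (.arr .right (.var c))))
    (fun r τ => τ.m = σ.m ∧ (∀ v, v ≠ c → τ.v v = σ.v v) ∧
      τ.o = σ.o ++ ([σ.v pc, σ.v w - 1] ++ ruleList (σ.m .left) (σ.m .right) r))
    (N := σ.v pc) (σ := { σ with o := σ.o ++ [σ.v pc] ++ [σ.v w - 1] }) hp (fun r τ h => ?_) ?_ ?_ ?_
  · exact ⟨_, rfl, key⟩
  · simp only [Exp.eval]
    rw [h.2.1 _ (by simp)]
  · rintro r τ m ⟨h₁, h₂, h₃⟩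
    exact ⟨h₁, fun v hv => by simp [hv, h₂ v hv], h₃⟩
  · rintro r τ hr ⟨h₁, h₂, h₃⟩ hc
    refine ⟨hc, h₁, h₂, ?_⟩
    simp [Cmd.run, Exp.eval, h₃, h₁, hc, ruleList, List.range_succ, List.flatMap_append]
  · exact ⟨rfl, fun _ _ => rfl, by simp [ruleList]⟩

/-- Productions: the two terminals, at most `2 * T.size` for resolving, `4 * T.size` for the walk,
and one for the preperiod. Both programs of the pair use the same productions and differ at most in
the start symbol. -/
theorem run_prog (hx : Input A eQ eΓ l x) (hl : ∀ t, t ∈ l ↔ t ∈ A.trans) (hA : A.Deterministic)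
    (hs : A.IsShort) : ∃ (L R : ℕ → ℕ) (M r₁ r₂ : ℕ), IsGrammar L R M ∧
      M ≤ 6 * ((2 * N + 1) * (K + 1)) + 3 ∧ r₁ ≠ 0 ∧ r₂ ≠ 0 ∧ r₁ ≤ M ∧ r₂ ≤ M ∧
      IsLasso (arrayWord L R r₁) (arrayWord L R r₂) (charSeq A.lang) ∧
      (prog.run x Store.init).o =
        ([M, r₁ - 1] ++ ruleList L R M) ++ ([M, r₂ - 1] ++ ruleList L R M) := by
  have hbound := hx.bound
  obtain ⟨σ₁, e₁, p₁, m₁⟩ := tables_spec hx hl hA hs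
  set T := storeTables N K σ₁ with hTdef
  have hsize : T.size = (2 * N + 1) * (K + 1) := rfl
  rw [← hsize] at hbound ⊢
  have hT := m₁.valid hs
  have hK : K ≤ x.length ^ 3 := by rw [hsize] at hbound; nlinarith
  obtain ⟨σ₂, e₂, hm₂, ho₂, hv₂, hb₂⟩ := findBot_spec hx hK p₁.n p₁.k
  obtain ⟨σ₃, e₃⟩ : ∃ σ₃, startNode.run x σ₂ = σ₃ := ⟨_, rfl⟩
  have hm₃ : σ₃.m = σ₂.m := by rw [← e₃]; rfl
  have ho₃ : σ₃.o = σ₂.o := by rw [← e₃]; rfl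
  have hv₃ : ∀ v, v ≠ cur → σ₃.v v = σ₂.v v := fun v hv => by
    rw [← e₃]; simp [startNode, Cmd.run, hv]
  have hstart : σ₃.v cur = (K + 1) * UPDA.stateNum eQ A.start false + eΓ A.bot := by
    rw [← e₃]
    simp only [startNode, Cmd.run, Exp.eval, Function.update_self, hx.start, hb₂, hm₂]
    have := (eQ A.start).2
    rw [p₁.mul _ (by omega)]
    simp [UPDA.stateNum]
  obtain ⟨σ₄, e₄, g₄, pc₄, hv₄, ho₄, hm₄⟩ := terminals_spec (x := x) σ₃
  have r₄ : Resolved T (eΓ A.bot) σ₄ := p₁.resolved (eΓ A.bot).2 g₄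
    (fun v h h' h'' h₃ => by rw [hv₄ v h, hv₃ v h₃, hv₂ v h' h''])
    (fun a h h' => by rw [hm₄ a h h', hm₃, hm₂])
  obtain ⟨σ₅, e₅, r₅, ho₅, pc₅, st₅, hv₅⟩ := resolveAll_spec (x := x) hT (by omega) r₄ pc₄.le
  have hlt : (K + 1) * UPDA.stateNum eQ A.start false + eΓ A.bot < T.size :=
    Tables.node_lt (T := T) (UPDA.stateNum_lt eQ A.start false).le (eΓ A.bot).2.le
  have hun : Unresolved T (σ₅.m .exit)
      ((K + 1) * UPDA.stateNum eQ A.start false + eΓ A.bot) :=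
    ⟨hlt, r₅.not_bot _ hlt (Tables.node_mod (T := T) (eΓ A.bot).2.le)⟩
  obtain ⟨σ₆, e₆, x₆, hu, ha, hc, hg, hg'⟩ := walk_spec (x := x) hT (by omega) r₅ st₅ hun
    (by rw [hv₅ _ (by simp) (by simp), hv₄ _ (by simp), hstart])
  have keep : ∀ v, v ∉ ({pc, ca, cb, cr, j, cur, acc, c, fin, u, x₀, rnd, i, b, bot} : Set Var) →
      σ₆.v v = σ₁.v v := by
    intro v hv
    simp only [Set.mem_insert_iff, Set.mem_singleton_iff, not_or] at hv
    rw [x₆.v v (by tauto) (by simp; tauto), hv₅ v (by tauto) (by simp; tauto), hv₄ v (by tauto),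
      hv₃ v (by tauto), hv₂ v (by tauto) (by tauto)]
  obtain ⟨σ₇, e₇, x₇, n₁, n₂, l₁, l₂, hlasso⟩ := finish_spec (x := x) hT x₆.grammar
    (by rw [keep _ (by simp), p₁.fb]; rfl) (by rw [keep _ (by simp), p₁.db]; rfl) hlt hc hu ha hg hg'
    (m₁.charSeq_iff hs)
  have pc₇ : σ₇.v pc ≤ 6 * T.size + 3 := by
    have := x₆.pc_le
    have := x₇.pc_le
    omega
  obtain ⟨σ₈, e₈, hm₈, hv₈, ho₈⟩ := writeGrammar_spec (x := x) (w := s₁) (σ := σ₇) (by omega)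
  obtain ⟨σ₉, e₉, hm₉, hv₉, ho₉⟩ := writeGrammar_spec (x := x) (w := s₂) (σ := σ₈)
    (by rw [hv₈ _ (by simp)]; omega)
  refine ⟨_, _, _, _, _, x₇.grammar, pc₇, n₁, n₂, l₁, l₂, hlasso, ?_⟩
  rw [prog, run_seq, e₁, run_seq, e₂, run_seq, e₃, run_seq, e₄, run_seq, e₅, run_seq, e₆, run_seq,
    e₇, run_seq, e₈, e₉, ho₉, ho₈, hm₈, hv₈ _ (by simp), hv₈ _ (by simp), x₇.o, x₆.o, ho₅, ho₄, ho₃,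
    ho₂, p₁.o, List.nil_append]

end FromAutomaton

open FromAutomaton in
theorem exists_polynomial_time_translation :
    ∃ (C : ℕ) (p : RAM.Prog) (T : Polynomial ℕ),
      ∀ (Q Γ : Type) [Finite Q] [Finite Γ] (A : UPDA Q Γ) (m : ℕ) (x : List ℕ),
        A.Deterministic → A.HasSize m → A.IsCode x →
        ∃ m' ≤ C * m, ∃ (n₁ n₂ : ℕ) (P₁ : SLP Bool (Fin n₁)) (P₂ : SLP Bool (Fin n₂))
          (y : List ℕ) (W : ℕ),
          PairHasSize P₁ P₂ m' ∧ IsIndicatorPair P₁ P₂ A.lang ∧ IsPairCode P₁ P₂ y ∧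
          RAM.OutputsWithin p x y (T.eval (RAM.inputLength x)) W := by
  obtain ⟨p, T, h⟩ := prog.exists_polynomial_time
  -- With `m = N * K` and `N, K ≤ m`, twice the bound `6 * (2 * N + 1) * (K + 1) + 3` is at most
  -- `(24 + 24 + 12 + 12 + 6) * m`.
  refine ⟨78, p, T, fun Q Γ _ _ A m x hA hm hc => ?_⟩
  obtain ⟨N, K, eQ, eΓ, l, hl, hx⟩ := hc.input
  obtain ⟨L, R, M, r₁, r₂, hG, hM, n₁, n₂, l₁, l₂, hlasso, ho⟩ := run_prog hx hl hA hm.1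
  obtain ⟨W, hW⟩ := h x
  rw [ho] at hW
  have hmNK : N * K = m := by
    rw [← hm.2, Nat.card_congr eQ, Nat.card_congr eΓ, Nat.card_fin, Nat.card_fin]
  have hN : 0 < N := (eQ A.start).pos
  have hK : 0 < K := (eΓ A.bot).pos
  have hsize : 2 * M ≤ 78 * m := by
    have h₁ : N ≤ N * K := Nat.le_mul_of_pos_right N hK
    have h₂ : K ≤ N * K := Nat.le_mul_of_pos_left K hN
    have h₃ : (2 * N + 1) * (K + 1) = 2 * (N * K) + 2 * N + K + 1 := by ring
    rw [h₃] at hM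
    omega
  have q₁ : r₁ - 1 < M := by omega
  have q₂ : r₂ - 1 < M := by omega
  refine ⟨2 * M, hsize, M, M, hG.slp ⟨_, q₁⟩, hG.slp ⟨_, q₂⟩, _, W,
    ⟨M, M, hG.slp_hasSize _, hG.slp_hasSize _, by ring⟩, ?_,
    ⟨_, _, hG.slp_isCode _, hG.slp_isCode _, rfl⟩, hW⟩
  rw [IsIndicatorPair, hG.slp_str q₁ n₁, hG.slp_str q₂ n₂]
  exact hlasso

end RAM

/-- Written words have length at most 2, so there are finitely many transitions to list. This lets
the pure size bound be deduced from the algorithm. -/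
theorem UPDA.IsShort.exists_isCode {Q Γ : Type} [Finite Q] [Finite Γ] {A : UPDA Q Γ}
    (hA : A.IsShort) : ∃ x, A.IsCode x := by
  have hfin : A.trans.Finite := by
    refine Set.Finite.subset ((Set.finite_univ (α := Q × Option Unit × Γ × Q)).prod
      (List.finite_length_le Γ 2) |>.image
        fun z => (z.1.1, z.1.2.1, z.1.2.2.1, z.1.2.2.2, z.2)) ?_
    rintro ⟨q, o, γ, q₂, s⟩ h
    exact ⟨((q, o, γ, q₂), s), ⟨Set.mem_univ _, hA _ _ _ _ _ h⟩, rfl⟩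
  exact ⟨_, hA, _, _, Finite.equivFin Q, Finite.equivFin Γ, hfin.toFinset.toList, by simp, rfl⟩

theorem theorem1 :
    -- (1) a udpda of size `m` has an indicator pair of size `O(m)` ...
    (∃ C : ℕ, ∀ (L : Language Unit) (m : ℕ),
      (∃ (Q Γ : Type) (_ : Finite Q) (_ : Finite Γ) (A : UPDA Q Γ),
        A.Deterministic ∧ A.HasSize m ∧ A.lang = L) →
      ∃ m' ≤ C * m, ∃ (n₁ n₂ : ℕ) (P₁ : SLP Bool (Fin n₁)) (P₂ : SLP Bool (Fin n₂)),
        PairHasSize P₁ P₂ m' ∧ IsIndicatorPair P₁ P₂ L) ∧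
    -- ... which is computed in polynomial time
    (∃ (C : ℕ) (p : RAM.Prog) (T : Polynomial ℕ),
      ∀ (Q Γ : Type) [Finite Q] [Finite Γ] (A : UPDA Q Γ) (m : ℕ) (x : List ℕ),
        A.Deterministic → A.HasSize m → A.IsCode x →
        ∃ m' ≤ C * m, ∃ (n₁ n₂ : ℕ) (P₁ : SLP Bool (Fin n₁)) (P₂ : SLP Bool (Fin n₂))
          (y : List ℕ) (W : ℕ),
          PairHasSize P₁ P₂ m' ∧ IsIndicatorPair P₁ P₂ A.lang ∧ IsPairCode P₁ P₂ y ∧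
          RAM.OutputsWithin p x y (T.eval (RAM.inputLength x)) W) ∧
    -- (2) an indicator pair of size `m` for `L` yields a udpda of size `O(m)` for `L` ...
    (∃ C : ℕ, ∀ (L : Language Unit) (m : ℕ),
      (∃ (Δ₁ Δ₂ : Type) (_ : Finite Δ₁) (_ : Finite Δ₂) (P₁ : SLP Bool Δ₁) (P₂ : SLP Bool Δ₂),
        PairHasSize P₁ P₂ m ∧ IsIndicatorPair P₁ P₂ L) →
      ∃ m' ≤ C * m, ∃ (n k : ℕ) (A : UPDA (Fin n) (Fin k)),
        A.Deterministic ∧ A.HasSize m' ∧ A.lang = L) ∧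
    -- ... which is computed in polynomial time and logarithmic space
    (∃ (C : ℕ) (p : RAM.Prog) (T : Polynomial ℕ) (c : ℕ),
      ∀ (Δ₁ Δ₂ : Type) [Finite Δ₁] [Finite Δ₂] (P₁ : SLP Bool Δ₁) (P₂ : SLP Bool Δ₂)
        (L : Language Unit) (m : ℕ) (x : List ℕ),
        PairHasSize P₁ P₂ m → IsIndicatorPair P₁ P₂ L → IsPairCode P₁ P₂ x →
        ∃ m' ≤ C * m, ∃ (n k : ℕ) (A : UPDA (Fin n) (Fin k)) (y : List ℕ),
          A.Deterministic ∧ A.HasSize m' ∧ A.lang = L ∧ A.IsCode y ∧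
          RAM.OutputsWithin p x y (T.eval (RAM.inputLength x))
            (c * (RAM.inputLength x).size)) := by
  have pair_of_automaton := RAM.exists_polynomial_time_translation
  have automaton_of_pair := exists_logspace_translation
  refine ⟨?_, pair_of_automaton, ?_, automaton_of_pair⟩
  · obtain ⟨C, p, T, h⟩ := pair_of_automaton
    refine ⟨C, ?_⟩
    rintro L m ⟨Q, Γ, _, _, A, hA, hm, rfl⟩
    obtain ⟨x, hx⟩ := hm.1.exists_isCode
    obtain ⟨m', hm', n₁, n₂, P₁, P₂, y, W, h₁, h₂, -⟩ := h Q Γ A m x hA hm hx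
    exact ⟨m', hm', n₁, n₂, P₁, P₂, h₁, h₂⟩
  · obtain ⟨C, p, T, c, h⟩ := automaton_of_pair
    refine ⟨C, ?_⟩
    rintro L m ⟨Δ₁, Δ₂, _, _, P₁, P₂, hm, hP⟩
    have ⟨m₁, m₂, h₁, h₂, _⟩ := hm
    obtain ⟨x₁, hx₁⟩ := h₁.1.exists_isCode
    obtain ⟨x₂, hx₂⟩ := h₂.1.exists_isCode
    obtain ⟨m', hm', n, k, A, y, hA, hs, hL, -⟩ :=
      h Δ₁ Δ₂ P₁ P₂ L m (x₁ ++ x₂) hm hP ⟨x₁, x₂, hx₁, hx₂, rfl⟩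
    exact ⟨m', hm', n, k, A, hA, hs, hL⟩
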